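/- **Setting.** Let $n\ge 1$ and let $G=(\mathbb R^n,*_G)$ be a rational stratified Lie group of step at most two in exponential coordinates: $\mathbb R^n$ carries a Lie bracket and a decomposition $\mathbb R^n=V_1\oplus V_2$ with $[V_1,V_1]=V_2$, $[V_1,V_2]=0$ ($V_2=0$ allowed), some basis has rational structure constants, and $x*_Gy=x+y+\tfrac12[x,y]$. Dilations are $D_r(v_1+v_2)=rv_1+r^2v_2$, and $Q=\dim V_1+2\dim V_2$. A homogeneous quasi-norm is a continuous $\|\cdot\|:\mathbb R^n\to[0,\infty)$ with $\|D_rx\|=r\|x\|$ for $r>0$ and $\|-x\|=\|x\|$, vanishing only at $0$; $B(c,R)=\{h:\|c^{-1}*_Gh\|<R\}$. A lattice $N\subset G$ is a discrete subgroup such that $G/N$ has a nonzero finite $G$-invariant Borel measure. **Coverings.** A covering $(Q_i)_{i\in I}$ of $\mathbb R^n$ by non-empty sets is admissible if $\sup_i\#\{j:Q_i\cap Q_j\neq\emptyset\}<\infty$. Let $Q_i^{0*}=Q_i$, and let $Q_i^{k*}$ be the union of the sets $Q_j$ that can be reached from $Q_i$ in $k$ steps, each step going from a member of the covering to one that meets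 it. Put $d_{\mathcal Q}(x,x)=0$, and for $x\ne y$ let $d_{\mathcal Q}(x,y)$ be the least $m\geq 1$ such that there are $Q_{i_1}\ni x,\dots,Q_{i_m}\ni y$ with consecutive sets intersecting. A generalized $0$-covering is an admissible covering by open connected sets $P_i$ with $|P_i|\asymp1$ uniformly in $i$ and $\sup_i R(P_i)/r(P_i)<\infty$, where $r(P_i)$ and $R(P_i)$ are the supremum of the radii of balls $B(c,r)$ contained in $P_i$ and the infimum of the radii of balls $B(c,R)$ containing $P_i$. For a lattice $N$ and $R>0$ such that it is an admissible covering, $\mathcal U(G;N)=(B(m,R))_{m\in N\setminus\{0\}}$ is a lattice covering. A $\mathcal Q$-BAPU is a family of non-negative $\psi_i\in C_c^\infty(\mathbb R^n)$ with $\operatorname{supp}\psi_i\subset Q_i$, $\sum_i\psi_i\equiv1$ and $\sup_i\|\mathcal F^{-1}\psi_i\|_{L^1}<\infty$. **Spaces.** Let $Z(\mathbb R^n)=\mathcal F(C_c^\infty(\mathbb R^n))$ with the topology transported from $C_c^\infty(\mathbb R^n)$, and let $Z'(\mathbb R^n)$ be its dual. For $1\le p,q<\infty$, a generalized $0$-covering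 $(P_i)$ and a BAPU $(\varphi_i)$ subordinate to it, the standard modulation space $M_{p,q}(G)=M^{0,0}_{p,q}(G)$ consists of all $f\in Z'(\mathbb R^n)$ with $$\|f\|_{M_{p,q}(G)}=\Big(\sum_i\|\mathcal F^{-1}(\varphi_i\cdot\mathcal F f)\|_{L^p}^q\Big)^{1/q}<\infty .$$ The Feichtinger algebra is $\mathcal S_0(\mathbb R)=M_{1,1}(\mathbb R)$, the case $G=(\mathbb R,+)$. For a lattice covering $\mathcal U(G;N)=(Q_m)$ with a BAPU $(\psi_m)$, the essential support of $f\in M_{p,q}(G)$ is $\mathcal C[f]=\bigcup\{Q_m:\|\mathcal F^{-1}(\psi_m\cdot\mathcal Ff)\|_{L^p}\ne0\}$. **Geometric embeddings.** Let $\mathcal Q=(Q_i)$ and $\mathcal Q'$ be the lattice coverings of $\mathbb R$ and of $G$. An injective bounded linear map $F:\mathcal S_0(\mathbb R)\to M_{p,q}(G)$ is a geometric embedding if there is $L>0$ and for every $k\in\mathbb N_0$ there is $C_k>0$ such that, whenever $\mathcal C[f]\subset Q_i^{k*}$ and $\mathcal C[g]\subset Q_j^{k*}$, $$\tfrac1L\,d_{\mathcal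 Q}(x,y)-C_k\le d_{\mathcal Q'}(z,w)\le L\,d_{\mathcal Q}(x,y)+C_k$$ for all $x\in Q_i^{k*}$, $y\in Q_j^{k*}$, $z\in\mathcal C[F(f)]$, $w\in\mathcal C[F(g)]$. **Statement.** For every $G$ as above and all $1\le p,q<\infty$, the Feichtinger algebra embeds geometrically into $M_{p,q}(G)$: for every choice, on $\mathbb R$ and on $G$, of the quasi-norm, the generalized $0$-covering, the lattice covering and the two BAPUs, there is a geometric embedding $F:\mathcal S_0(\mathbb R)\to M_{p,q}(G)$. -/

import Mathlib

open MeasureTheory Set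
open scoped ENNReal NNReal FourierTransform SchwartzMap Distributions ContDiff

noncomputable section

/-! ### Stratified Lie groups of step at most two, in exponential coordinates -/

/-- A stratified Lie group of step at most two, realised on its Lie algebra through the exponential
map: a Lie bracket on the vector space `E` with a stratification `E = V₁ ⊕ V₂`, `[V₁, V₁] = V₂`,
`[V₁, V₂] = 0`. Step one is the case `V₂ = 0`. -/
structure StratifiedGroup (E : Type*) [AddCommGroup E] [Module ℝ E] where
  /-- The Lie bracket. -/
  bracket : E →ₗ[ℝ] E →ₗ[ℝ] E
  bracket_self : ∀ x, bracket x x = 0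
  jacobi : ∀ x y z,
    bracket x (bracket y z) + bracket y (bracket z x) + bracket z (bracket x y) = 0
  /-- The first layer. -/
  V₁ : Submodule ℝ E
  /-- The second layer. -/
  V₂ : Submodule ℝ E
  isCompl : IsCompl V₁ V₂
  span_bracket : Submodule.span ℝ {z | ∃ x ∈ V₁, ∃ y ∈ V₁, bracket x y = z} = V₂
  bracket_V₁_V₂ : ∀ x ∈ V₁, ∀ y ∈ V₂, bracket x y = 0

namespace StratifiedGroup

section Algebra

variable {E : Type*} [AddCommGroup E] [Module ℝ E] (G : StratifiedGroup E)

/-- The additive group of a vector space: the stratified group with zero bracket. -/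
def abelian (E : Type*) [AddCommGroup E] [Module ℝ E] : StratifiedGroup E where
  bracket := 0
  bracket_self _ := rfl
  jacobi _ _ _ := by simp
  V₁ := ⊤
  V₂ := ⊥
  isCompl := isCompl_top_bot
  span_bracket := by
    refine le_antisymm (Submodule.span_le.2 ?_) bot_le
    rintro z ⟨x, -, y, -, rfl⟩
    simp
  bracket_V₁_V₂ _ _ _ _ := rfl

theorem bracket_skew (x y : E) : G.bracket x y = -G.bracket y x := by
  have h := G.bracket_self (x + y)
  simp only [map_add, LinearMap.add_apply, G.bracket_self, zero_add, add_zero] at h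
  exact eq_neg_of_add_eq_zero_right h

theorem bracket_central (x : E) {z : E} (hz : z ∈ G.V₂) : G.bracket x z = 0 := by
  have key : ∀ u ∈ G.V₂, ∀ z ∈ G.V₂, G.bracket u z = 0 := by
    intro u hu z hz
    rw [← G.span_bracket] at hu
    induction hu using Submodule.span_induction with
    | mem u hu =>
      obtain ⟨a, ha, b, hb, rfl⟩ := hu
      have h := G.jacobi a b z
      rw [G.bracket_V₁_V₂ b hb z hz, G.bracket_skew z a, G.bracket_V₁_V₂ a ha z hz] at h
      rw [G.bracket_skew]
      simpa using h
    | zero => simp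
    | add u v _ _ hu hv => simp [hu, hv]
    | smul c u _ hu => simp [hu]
  have hx : x ∈ G.V₁ ⊔ G.V₂ := by rw [G.isCompl.sup_eq_top]; trivial
  obtain ⟨a, ha, b, hb, rfl⟩ := Submodule.mem_sup.1 hx
  simp [G.bracket_V₁_V₂ a ha z hz, key b hb z hz]

theorem bracket_mem (x y : E) : G.bracket x y ∈ G.V₂ := by
  have hx : x ∈ G.V₁ ⊔ G.V₂ := by rw [G.isCompl.sup_eq_top]; trivial
  have hy : y ∈ G.V₁ ⊔ G.V₂ := by rw [G.isCompl.sup_eq_top]; trivial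
  obtain ⟨a, ha, b, hb, rfl⟩ := Submodule.mem_sup.1 hx
  obtain ⟨c, hc, d, hd, rfl⟩ := Submodule.mem_sup.1 hy
  have h1 : G.bracket b c = 0 := by rw [G.bracket_skew, G.bracket_central c hb, neg_zero]
  simp only [map_add, LinearMap.add_apply, G.bracket_central _ hd, h1, add_zero]
  rw [← G.span_bracket]
  exact Submodule.subset_span ⟨a, ha, c, hc, rfl⟩

/-- The group law; in step at most two the Baker-Campbell-Hausdorff series stops after the first
bracket. -/
def mul (x y : E) : E := x + y + (1 / 2 : ℝ) • G.bracket x y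

theorem mul_assoc' (x y z : E) : G.mul (G.mul x y) z = G.mul x (G.mul y z) := by
  have h1 : G.bracket (G.bracket x y) z = 0 := by
    rw [G.bracket_skew, G.bracket_central _ (G.bracket_mem x y), neg_zero]
  have h2 : G.bracket x (G.bracket y z) = 0 := G.bracket_central _ (G.bracket_mem y z)
  simp only [mul, map_add, map_smul, LinearMap.add_apply, LinearMap.smul_apply, h1, h2,
    smul_zero, add_zero, smul_add]
  abel

/-- The group `(E, *_G)`. -/
@[ext]
structure Carrier (G : StratifiedGroup E) where
  /-- The underlying vector (exponential coordinates). -/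
  toVec : E

instance : Group G.Carrier where
  mul x y := ⟨G.mul x.toVec y.toVec⟩
  one := ⟨0⟩
  inv x := ⟨-x.toVec⟩
  mul_assoc x y z := Carrier.ext (G.mul_assoc' _ _ _)
  one_mul x := Carrier.ext (by change G.mul 0 x.toVec = x.toVec; simp [mul])
  mul_one x := Carrier.ext (by change G.mul x.toVec 0 = x.toVec; simp [mul])
  inv_mul_cancel x :=
    Carrier.ext (by change G.mul (-x.toVec) x.toVec = 0; simp [mul, G.bracket_self])

/-- The dilations `D_r`, equal to `r ^ j` on the layer of degree `j`. -/
def dilation (r : ℝ) : E →ₗ[ℝ] E :=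
  r • (G.V₁.subtype ∘ₗ G.V₁.projectionOnto G.V₂ G.isCompl) +
    (r ^ 2) • (G.V₂.subtype ∘ₗ G.V₂.projectionOnto G.V₁ G.isCompl.symm)

/-- The homogeneous dimension `dim V₁ + 2 dim V₂`. -/
def homDim : ℕ := Module.finrank ℝ G.V₁ + 2 * Module.finrank ℝ G.V₂

/-- The group is rational: some basis of the Lie algebra has rational structure constants. -/
def IsRational : Prop :=
  ∃ b : Module.Basis (Fin (Module.finrank ℝ E)) ℝ E,
    ∀ i j k, ∃ c : ℚ, b.repr (G.bracket (b i) (b j)) k = (c : ℝ)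

/-- The ball `B(c, R) = {h | ‖c⁻¹ * h‖ < R}` of a quasi-norm `ν`. -/
def ball (ν : E → ℝ) (c : E) (R : ℝ) : Set E := {h | ν (G.mul (-c) h) < R}

end Algebra

section Topology

variable {E : Type*} [NormedAddCommGroup E] [NormedSpace ℝ E] (G : StratifiedGroup E)

instance : TopologicalSpace G.Carrier := TopologicalSpace.induced Carrier.toVec inferInstance

/-- `ν` is a homogeneous quasi-norm on `G`. -/
structure IsQuasiNorm (ν : E → ℝ) : Prop where
  continuous : Continuous ν
  nonneg : ∀ x, 0 ≤ ν x
  homogeneous : ∀ r : ℝ, 0 < r → ∀ x, ν (G.dilation r x) = r * ν x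
  symmetric : ∀ x, ν (-x) = ν x
  eq_zero : ∀ x, ν x = 0 → x = 0

/-- `N` is a lattice in `G`: a discrete subgroup such that `G / N` carries a nonzero finite
`G`-invariant Borel measure. -/
def IsLattice (N : Subgroup G.Carrier) : Prop :=
  DiscreteTopology N ∧
    ∃ μ : @Measure (G.Carrier ⧸ N) (borel (G.Carrier ⧸ N)),
      μ univ ≠ 0 ∧ μ univ ≠ ⊤ ∧
        ∀ (g : G.Carrier) (A : Set (G.Carrier ⧸ N)),
          @MeasurableSet _ (borel (G.Carrier ⧸ N)) A → μ ((fun x => g • x) ⁻¹' A) = μ A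

/-- The index set `N \ {0}` of the lattice covering; the neutral element of `G` is `0`. -/
def LatticeIndex {G : StratifiedGroup E} (N : Subgroup G.Carrier) : Type _ :=
  {m : G.Carrier // m ∈ N ∧ m ≠ 1}

/-- The lattice covering `U(G; N) = (B(m, R))_{m ∈ N \ {0}}`. -/
def latticeCovering (ν : E → ℝ) (N : Subgroup G.Carrier) (R : ℝ) (m : LatticeIndex N) : Set E :=
  G.ball ν m.1.toVec R

end Topology

end StratifiedGroup

/-! ### Coverings -/

section Coverings

variable {E ι : Type*}

/-- An admissible covering of the whole space. -/
structure IsAdmissibleCovering (Q : ι → Set E) : Prop where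
  covers : ⋃ i, Q i = univ
  nonempty : ∀ i, (Q i).Nonempty
  bounded : ∃ M : ℕ, ∀ i, {j | (Q i ∩ Q j).Nonempty}.encard ≤ M

/-- Indices of the `k`-fold neighbours of `Q i`. -/
def neighbourIndices (Q : ι → Set E) (i : ι) : ℕ → Set ι
  | 0 => {i}
  | k + 1 => {j | ∃ l ∈ neighbourIndices Q i k, (Q l ∩ Q j).Nonempty}

/-- The set `Q_i^{k*}`, the union of the `k`-fold neighbours of `Q i`; `Q_i^{0*} = Q_i`. -/
def starSet (Q : ι → Set E) (i : ι) (k : ℕ) : Set E := ⋃ j ∈ neighbourIndices Q i k, Q j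

open Classical in
/-- The distance `d_Q` associated with a covering: the least number of members of a chain
`Q (c 0), …, Q (c m)` from `x` to `y`, and `0` if `x = y`. Every admissible covering of `ℝⁿ` by
open sets admits such chains. -/
def coveringDist (Q : ι → Set E) (x y : E) : ℕ :=
  if x = y then 0 else
    sInf {k | ∃ (m : ℕ) (c : ℕ → ι), k = m + 1 ∧ x ∈ Q (c 0) ∧ y ∈ Q (c m) ∧
      ∀ j < m, (Q (c j) ∩ Q (c (j + 1))).Nonempty}

end Coverings

section Analysis

variable {E : Type*} [NormedAddCommGroup E] [InnerProductSpace ℝ E] [FiniteDimensional ℝ E]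
  [MeasurableSpace E] [BorelSpace E]

/-- A generalized `α`-covering of the stratified group `G` with quasi-norm `ν`. The inner radius
`r(P i)` and the outer radius `R(P i)` are taken in `[0, ∞]`. -/
structure StratifiedGroup.IsAlphaCovering (G : StratifiedGroup E) (ν : E → ℝ) (α : ℝ) {ι : Type*}
    (P : ι → Set E) : Prop where
  admissible : IsAdmissibleCovering P
  isOpen : ∀ i, IsOpen (P i)
  isConnected : ∀ i, IsConnected (P i)
  size : ∃ a b : ℝ, 0 < a ∧ 0 < b ∧ ∀ i, ∀ ξ ∈ P i,
    ENNReal.ofReal (a * (1 + ν ξ ^ 2) ^ (α * G.homDim / 2)) ≤ volume (P i) ∧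
    volume (P i) ≤ ENNReal.ofReal (b * (1 + ν ξ ^ 2) ^ (α * G.homDim / 2))
  ratio : ∃ K : ℝ≥0, ∀ i,
    (⨅ (R : ℝ≥0) (_ : ∃ c, P i ⊆ G.ball ν c R), (R : ℝ≥0∞)) ≤
      K * ⨆ (r : ℝ≥0) (_ : ∃ c, G.ball ν c r ⊆ P i), (r : ℝ≥0∞)

/-- A bounded admissible partition of unity subordinate to `Q`, with compactly supported members
(the compact support is automatic when the members of `Q` are bounded sets). -/
structure IsBAPU {ι : Type*} (Q : ι → Set E) (ψ : ι → 𝓓((⊤ : TopologicalSpace.Opens E), ℝ)) :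
    Prop where
  nonneg : ∀ i x, 0 ≤ ψ i x
  tsupport_subset : ∀ i, tsupport (ψ i) ⊆ Q i
  hasSum_one : ∀ x, HasSum (fun i => ψ i x) 1
  bounded : ∃ C : ℝ≥0, ∀ i, eLpNorm (𝓕⁻ (fun x : E => (ψ i x : ℂ))) 1 volume ≤ C

/-! ### The Fourier type reservoir -/

/-- The Fourier transform `C_c^∞(E) → 𝓢(E)` as a linear map. -/
def fourierTest (E : Type*) [NormedAddCommGroup E] [InnerProductSpace ℝ E] [FiniteDimensional ℝ E]
    [MeasurableSpace E] [BorelSpace E] :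
    𝓓((⊤ : TopologicalSpace.Opens E), ℂ) →ₗ[ℂ] 𝓢(E, ℂ) where
  toFun φ := 𝓕 (φ.hasCompactSupport.toSchwartzMap φ.contDiff)
  map_add' φ χ := by
    rw [← FourierTransform.fourier_add]
    congr 1
  map_smul' c φ := by
    rw [RingHom.id_apply, ← FourierTransform.fourier_smul]
    congr 1

/-- The space `Z(E) = 𝓕(C_c^∞(E))`. -/
def FourierTestSpace (E : Type*) [NormedAddCommGroup E] [InnerProductSpace ℝ E]
    [FiniteDimensional ℝ E] [MeasurableSpace E] [BorelSpace E] : Type _ :=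
  LinearMap.range (fourierTest E)

instance : AddCommGroup (FourierTestSpace E) :=
  inferInstanceAs (AddCommGroup (LinearMap.range (fourierTest E)))

instance : Module ℂ (FourierTestSpace E) :=
  inferInstanceAs (Module ℂ (LinearMap.range (fourierTest E)))

/-- The Fourier transform as a (bijective) linear map `C_c^∞(E) → Z(E)`. -/
def fourierOntoZ (E : Type*) [NormedAddCommGroup E] [InnerProductSpace ℝ E]
    [FiniteDimensional ℝ E] [MeasurableSpace E] [BorelSpace E] :
    𝓓((⊤ : TopologicalSpace.Opens E), ℂ) →ₗ[ℂ] FourierTestSpace E :=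
  (fourierTest E).rangeRestrict

/-- `Z(E)` carries the topology transported from `C_c^∞(E)` by the Fourier transform. -/
instance : TopologicalSpace (FourierTestSpace E) :=
  TopologicalSpace.coinduced (fourierOntoZ E) inferInstance

/-- The Fourier type reservoir `Z'(E)`, the dual space of `Z(E)`. -/
abbrev FourierReservoir (E : Type*) [NormedAddCommGroup E] [InnerProductSpace ℝ E]
    [FiniteDimensional ℝ E] [MeasurableSpace E] [BorelSpace E] : Type _ :=
  FourierTestSpace E →L[ℂ] ℂ

/-- The Fourier transform `Z'(E) → 𝓓'(E)`, `⟨𝓕 f, φ⟩ = ⟨f, 𝓕 φ⟩`. -/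
def reservoirFourier (f : FourierReservoir E) : 𝓓((⊤ : TopologicalSpace.Opens E), ℂ) →L[ℂ] ℂ where
  toLinearMap := f.toLinearMap ∘ₗ fourierOntoZ E
  cont := f.continuous.comp continuous_coinduced_rng

/-- The test function `η ↦ ψ(η) exp(2πi⟨η, x⟩)`. -/
def modulate (ψ : 𝓓((⊤ : TopologicalSpace.Opens E), ℝ)) (x : E) :
    𝓓((⊤ : TopologicalSpace.Opens E), ℂ) where
  toFun η := (ψ η : ℂ) * Complex.exp ((2 * Real.pi * inner ℝ η x : ℝ) * Complex.I)
  contDiff' := by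
    refine (Complex.ofRealCLM.contDiff.comp ψ.contDiff).mul ?_
    refine Complex.contDiff_exp.comp (ContDiff.mul ?_ contDiff_const)
    refine Complex.ofRealCLM.contDiff.comp (contDiff_const.mul ?_)
    exact contDiff_id.inner ℝ contDiff_const
  hasCompactSupport' := by
    refine HasCompactSupport.mul_right ?_
    exact ψ.hasCompactSupport.comp_left Complex.ofReal_zero
  tsupport_subset' := fun _ _ => trivial

/-- The function `𝓕⁻¹(ψ · 𝓕 f)`, namely `x ↦ ⟨𝓕 f, ψ exp(2πi⟨·, x⟩)⟩`; since `ψ · 𝓕 f` is a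
compactly supported distribution, this smooth function represents its inverse Fourier transform. -/
def frequencyPiece (ψ : 𝓓((⊤ : TopologicalSpace.Opens E), ℝ)) (f : FourierReservoir E) : E → ℂ :=
  fun x => reservoirFourier f (modulate ψ x)

theorem frequencyPiece_add (ψ : 𝓓((⊤ : TopologicalSpace.Opens E), ℝ)) (f g : FourierReservoir E) :
    frequencyPiece ψ (f + g) = frequencyPiece ψ f + frequencyPiece ψ g := rfl

theorem frequencyPiece_smul (ψ : 𝓓((⊤ : TopologicalSpace.Opens E), ℝ)) (c : ℂ)
    (f : FourierReservoir E) : frequencyPiece ψ (c • f) = c • frequencyPiece ψ f := rfl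

/-! ### Standard modulation spaces -/

/-- The norm of the modulation space with smoothness `s = 0` (all weights `(1 + ‖ξ_i‖²)^{s/2}` are
equal to `1`), with values in `[0, ∞]`:
`(∑_i ‖𝓕⁻¹(ψ_i · 𝓕 f)‖_{L^p}^q)^{1/q}`. -/
def modulationNorm {ι : Type*} (ψ : ι → 𝓓((⊤ : TopologicalSpace.Opens E), ℝ)) (p q : ℝ)
    (f : FourierReservoir E) : ℝ≥0∞ :=
  (∑' i, eLpNorm (frequencyPiece (ψ i) f) (ENNReal.ofReal p) volume ^ q) ^ (1 / q)

/-- The modulation space: all `f ∈ Z'` with pieces in `L^p` and finite norm. For `q < ∞` the first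
condition follows from the second, the pieces being smooth. -/
def modulationSpace {ι : Type*} (ψ : ι → 𝓓((⊤ : TopologicalSpace.Opens E), ℝ)) (p q : ℝ)
    (hq : 1 ≤ q) : Submodule ℂ (FourierReservoir E) where
  carrier := {f | (∀ i, MemLp (frequencyPiece (ψ i) f) (ENNReal.ofReal p) volume) ∧
    modulationNorm ψ p q f < ⊤}
  zero_mem' := by
    have h0 : ∀ i, frequencyPiece (ψ i) (0 : FourierReservoir E) = 0 := fun _ => rfl
    have hq0 : 0 < q := by linarith
    refine ⟨fun i => by rw [h0]; exact MemLp.zero, ?_⟩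
    simp [modulationNorm, h0, hq0]
  add_mem' := by
    rintro f g ⟨hf, hf'⟩ ⟨hg, hg'⟩
    have hq0 : 0 < q := by linarith
    have hi : 0 < 1 / q := by positivity
    refine ⟨fun i => by rw [frequencyPiece_add]; exact (hf i).add (hg i), ?_⟩
    simp only [modulationNorm, ENNReal.rpow_lt_top_iff_of_pos hi] at hf' hg' ⊢
    obtain ⟨C, hC, hle⟩ : ∃ C : ℝ≥0∞, C < ⊤ ∧ ∀ u v : E → ℂ,
        AEStronglyMeasurable u volume → AEStronglyMeasurable v volume →
        eLpNorm (u + v) (ENNReal.ofReal p) volume ≤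
          C * (eLpNorm u (ENNReal.ofReal p) volume + eLpNorm v (ENNReal.ofReal p) volume) :=
      ⟨_, ENNReal.LpAddConst_lt_top (ENNReal.ofReal p), fun u v hu hv => eLpNorm_add_le' hu hv _⟩
    calc
      _ ≤ ∑' i, C ^ q * ((2 : ℝ≥0∞) ^ (q - 1) *
          (eLpNorm (frequencyPiece (ψ i) f) (ENNReal.ofReal p) volume ^ q +
            eLpNorm (frequencyPiece (ψ i) g) (ENNReal.ofReal p) volume ^ q)) := by
        refine ENNReal.tsum_le_tsum fun i => ?_
        rw [frequencyPiece_add]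
        refine (ENNReal.rpow_le_rpow (hle _ _ (hf i).1 (hg i).1) hq0.le).trans ?_
        rw [ENNReal.mul_rpow_of_nonneg _ _ hq0.le]
        gcongr
        exact ENNReal.rpow_add_le_mul_rpow_add_rpow _ _ hq
      _ < ⊤ := by
        rw [ENNReal.tsum_mul_left, ENNReal.tsum_mul_left, ENNReal.tsum_add]
        refine ENNReal.mul_lt_top (ENNReal.rpow_lt_top_of_nonneg hq0.le hC.ne)
          (ENNReal.mul_lt_top ?_ (ENNReal.add_lt_top.2 ⟨hf', hg'⟩))
        exact ENNReal.rpow_lt_top_of_nonneg (by linarith) (by simp)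
  smul_mem' := by
    rintro c f ⟨hf, hf'⟩
    have hq0 : 0 < q := by linarith
    have hi : 0 < 1 / q := by positivity
    refine ⟨fun i => by rw [frequencyPiece_smul]; exact (hf i).const_smul c, ?_⟩
    simp only [modulationNorm, ENNReal.rpow_lt_top_iff_of_pos hi] at hf' ⊢
    simp only [frequencyPiece_smul, eLpNorm_const_smul, ENNReal.mul_rpow_of_nonneg _ _ hq0.le]
    rw [ENNReal.tsum_mul_left]
    exact ENNReal.mul_lt_top (ENNReal.rpow_lt_top_of_nonneg hq0.le (by simp)) hf'

/-- The essential support of `f` with respect to the covering `Q` and the partition of unity `ψ`: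
the union of the `Q i` with `‖𝓕⁻¹(ψ_i · 𝓕 f)‖_{L^p} ≠ 0`. -/
def essentialSupport {ι : Type*} (Q : ι → Set E) (ψ : ι → 𝓓((⊤ : TopologicalSpace.Opens E), ℝ))
    (p : ℝ) (f : FourierReservoir E) : Set E :=
  ⋃ (i) (_ : eLpNorm (frequencyPiece (ψ i) f) (ENNReal.ofReal p) volume ≠ 0), Q i

/-- The auxiliary choices behind `M_{p,q}(G)` and its geometry: a homogeneous quasi-norm, a
generalized `0`-covering `P` with a partition of unity `φ` (which define the space and its norm),
and a lattice covering with a partition of unity `ψ` (which define essential supports and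
distances). -/
structure ModulationData (G : StratifiedGroup E) where
  /-- The homogeneous quasi-norm. -/
  ν : E → ℝ
  isQuasiNorm : G.IsQuasiNorm ν
  /-- Index set of the generalized `0`-covering; admissible open coverings are countable. -/
  ι : Type
  /-- The generalized `0`-covering. -/
  P : ι → Set E
  isAlphaCovering : G.IsAlphaCovering ν 0 P
  /-- The partition of unity that defines the norm. -/
  φ : ι → 𝓓((⊤ : TopologicalSpace.Opens E), ℝ)
  isBAPU_φ : IsBAPU P φ
  /-- The lattice. -/
  N : Subgroup G.Carrier
  isLattice : G.IsLattice N
  /-- The radius of the balls of the lattice covering. -/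
  R : ℝ
  R_pos : 0 < R
  isAdmissible : IsAdmissibleCovering (G.latticeCovering ν N R)
  /-- The partition of unity that defines essential supports. -/
  ψ : StratifiedGroup.LatticeIndex N → 𝓓((⊤ : TopologicalSpace.Opens E), ℝ)
  isBAPU_ψ : IsBAPU (G.latticeCovering ν N R) ψ

namespace ModulationData

variable {G : StratifiedGroup E} (D : ModulationData G)

/-- The standard modulation space `M_{p,q}(G)`. -/
def space (p q : ℝ) (hq : 1 ≤ q) : Submodule ℂ (FourierReservoir E) := modulationSpace D.φ p q hq

/-- The norm of `M_{p,q}(G)`. -/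
def norm (p q : ℝ) (f : FourierReservoir E) : ℝ≥0∞ := modulationNorm D.φ p q f

/-- The lattice covering `U(G; N)`. -/
def covering (m : StratifiedGroup.LatticeIndex D.N) : Set E := G.latticeCovering D.ν D.N D.R m

/-- The essential support of an element of `M_{p,q}(G)`. -/
def essSupp (p : ℝ) (f : FourierReservoir E) : Set E := essentialSupport D.covering D.ψ p f

end ModulationData

end Analysis

/-- A linear map `F : M_{p₁,q₁}(G) → M_{p₂,q₂}(H)` is a geometric embedding if it is injective,
bounded, and moves frequencies in a coarsely controlled way. The additive constant may depend on the
size `k` of the frequency windows `Q_i^{k*}`, the multiplicative one may not. -/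
structure IsGeometricEmbedding
    {E₁ : Type*} [NormedAddCommGroup E₁] [InnerProductSpace ℝ E₁] [FiniteDimensional ℝ E₁]
    [MeasurableSpace E₁] [BorelSpace E₁]
    {E₂ : Type*} [NormedAddCommGroup E₂] [InnerProductSpace ℝ E₂] [FiniteDimensional ℝ E₂]
    [MeasurableSpace E₂] [BorelSpace E₂]
    {G : StratifiedGroup E₁} {H : StratifiedGroup E₂} (D : ModulationData G) (D' : ModulationData H)
    (p₁ q₁ p₂ q₂ : ℝ) (hq₁ : 1 ≤ q₁) (hq₂ : 1 ≤ q₂)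
    (F : D.space p₁ q₁ hq₁ →ₗ[ℂ] D'.space p₂ q₂ hq₂) : Prop where
  injective : Function.Injective F
  bounded : ∃ C : ℝ≥0, ∀ f, D'.norm p₂ q₂ (F f) ≤ C * D.norm p₁ q₁ f
  geometric : ∃ L : ℝ, 0 < L ∧ ∀ k : ℕ, ∃ C : ℝ, 0 < C ∧
    ∀ (i j) (f g : D.space p₁ q₁ hq₁),
      D.essSupp p₁ f ⊆ starSet D.covering i k → D.essSupp p₁ g ⊆ starSet D.covering j k →
      ∀ x ∈ starSet D.covering i k, ∀ y ∈ starSet D.covering j k,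
      ∀ z ∈ D'.essSupp p₂ (F f), ∀ w ∈ D'.essSupp p₂ (F g),
        1 / L * (coveringDist D.covering x y : ℝ) - C ≤ (coveringDist D'.covering z w : ℝ) ∧
        (coveringDist D'.covering z w : ℝ) ≤ L * (coveringDist D.covering x y : ℝ) + C

end

set_option linter.unusedSectionVars false

noncomputable section

/-! ### Geometry of stratified groups of step two -/

namespace StratifiedGroup

/-! ### Algebra of the group law -/

section Alg

variable {E : Type*} [AddCommGroup E] [Module ℝ E] (G : StratifiedGroup E)

/-! The line is laid along a one-parameter subgroup `s ↦ s • X` with `X ≠ 0` in `V₁`. An element `f`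
of the Feichtinger algebra splits into pieces `f_i = 𝓕⁻¹(φ_i 𝓕 f)` with frequencies in intervals `P
i` of length at most `b`, in which points `t i` are chosen. Multiplying `f(⟨X, x⟩)` by a single
function with Fourier transform a bump `θ` would place the spectrum in the Euclidean translates `s •
X + supp θ`. In general these do not stay in `G`-balls of fixed radius, since left translation by `s
• X` also shears by `(s / 2) [X, ·]`. Hence the window is sheared along with the piece: `f` is sent
to `∑ f_i(⟨X, x⟩) w_i(x)`, where `𝓕 w_i (ξ) = θ(ξ - (t i / 2) [X, ξ])`. Step two gives `[X, [X, ·]]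
= 0`, so the shears are unipotent and preserve volume, all windows have the same `L¹` norm and a
common sup bound, and, as `|s - t i| ≤ b`, the `i`-th term has its spectrum in balls of one radius
around the points `s • X` (`exists_radius_window`, `exists_of_fourier_shearedTerm_ne_zero`).

Boundedness: by Bernstein's inequality each term is bounded in `L¹` and in `L^∞`, hence in every
`L^p`, by a constant times `‖f_i‖₁`. It reaches only boundedly many members of the covering of `G`,
by a volume count (`exists_encard_meeting_le`). So even the `ℓ¹` sum of the `L^p` norms is
controlled, and `ℓ¹` embeds in `ℓ^q`.

Injectivity: on the orthogonal complement of `V₂` the shears act trivially. Along a line there, the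
image is `∑ f_i` times `𝓕⁻¹ θ`, and the latter is real-analytic on the line and nonzero at the
origin.

Geometry: in both groups the covering distance is at most linear along a one-parameter subgroup, by
counting members that meet a path (`exists_coveringDist_le`). It dominates each linear functional
that kills `V₂`, since such a functional is a homomorphism to `ℝ` with bounded oscillation on each
member (`exists_le_coveringDist`). A functional with value `1` at `X` recovers `s`.

All this requires `𝓕 f` to be a genuine continuous function although `f` is only an element of `Z'`
(`exists_fourier_density`). The analytic core there is `integral_modulate_mul_fourier`. -/

theorem mul_neg_cancel_left (c x : E) : G.mul c (G.mul (-c) x) = x := by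
  rw [← G.mul_assoc']
  simp [mul, G.bracket_self]

theorem neg_mul_cancel_left (c x : E) : G.mul (-c) (G.mul c x) = x := by
  rw [← G.mul_assoc']
  simp [mul, G.bracket_self]

theorem zero_mul (x : E) : G.mul 0 x = x := by simp [mul]

theorem neg_mul (x y : E) : -(G.mul x y) = G.mul (-y) (-x) := by
  simp only [mul, map_neg, LinearMap.neg_apply, neg_neg]
  rw [G.bracket_skew y x]
  simp only [smul_neg, neg_add]
  abel

theorem mem_ball {ν : E → ℝ} {c h : E} {R : ℝ} : h ∈ G.ball ν c R ↔ ν (G.mul (-c) h) < R := Iff.rfl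

/-- A linear functional that vanishes on the second layer is a homomorphism. -/
theorem map_mul_of_vanish (l : E →ₗ[ℝ] ℝ) (hl : ∀ z ∈ G.V₂, l z = 0) (x y : E) :
    l (G.mul x y) = l x + l y := by
  simp [mul, hl _ (G.bracket_mem x y)]

/-- The adjoint action of an element squares to zero. -/
theorem bracket_bracket (c x : E) : G.bracket c (G.bracket c x) = 0 :=
  G.bracket_central _ (G.bracket_mem c x)

theorem V₁_ne_bot [Nontrivial E] : G.V₁ ≠ ⊥ := by
  intro h
  have h2 : G.V₂ = ⊥ := by
    rw [← G.span_bracket, Submodule.span_eq_bot]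
    rintro z ⟨x, hx, y, hy, rfl⟩
    rw [h, Submodule.mem_bot] at hx
    simp [hx]
  have := G.isCompl.sup_eq_top
  rw [h, h2, sup_bot_eq] at this
  exact bot_ne_top this

theorem dilation_apply (r : ℝ) (x : E) : G.dilation r x =
    r • (G.V₁.projectionOnto G.V₂ G.isCompl x : E) +
      r ^ 2 • (G.V₂.projectionOnto G.V₁ G.isCompl.symm x : E) := rfl

theorem dilation_one (x : E) : G.dilation 1 x = x := by
  rw [dilation_apply]
  simp only [one_smul, one_pow]
  exact Submodule.projection_add_projection_eq_self G.isCompl x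

theorem dilation_zero (x : E) : G.dilation 0 x = 0 := by
  rw [dilation_apply]
  simp

end Alg

/-! ### Quasi-norms and their balls -/

section Top

variable {E : Type*} [NormedAddCommGroup E] [NormedSpace ℝ E] [FiniteDimensional ℝ E]
  (G : StratifiedGroup E)

theorem continuous_mul : Continuous fun p : E × E => G.mul p.1 p.2 := by
  have h : Continuous fun p : E × E => G.bracket p.1 p.2 := by
    have := G.bracket.toContinuousBilinearMap.continuous₂
    exact this
  unfold mul
  fun_prop

variable {G}

theorem IsQuasiNorm.map_zero {ν : E → ℝ} (hν : G.IsQuasiNorm ν) : ν 0 = 0 := by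
  have := hν.homogeneous 2 two_pos 0
  rw [_root_.map_zero] at this
  linarith

/-- By compactness `ν` has a positive minimum `m` on the Euclidean unit sphere. If `‖x‖ > 1`, the
curve `r ↦ D_r x` crosses the sphere at some `r ≤ 1`, so `ν x ≥ r ν x ≥ m`. Thus `{ν < m}` lies in
the unit ball, and dilation by `R / m` handles all other radii. -/
theorem IsQuasiNorm.isBounded_sublevel {ν : E → ℝ} (hν : G.IsQuasiNorm ν) (R : ℝ) :
    Bornology.IsBounded {x | ν x < R} := by
  rcases subsingleton_or_nontrivial E with hE | hE
  · exact (Set.toFinite _).isBounded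
  have hcont : ∀ x, Continuous fun r : ℝ => G.dilation r x := fun x => by
    simp only [dilation_apply]
    fun_prop
  obtain ⟨m, hm, hmin⟩ : ∃ m > 0, ∀ x ∈ Metric.sphere (0 : E) 1, m ≤ ν x := by
    have hs : (Metric.sphere (0 : E) 1).Nonempty := NormedSpace.sphere_nonempty.2 zero_le_one
    obtain ⟨x, hx, hmin⟩ := (isCompact_sphere (0 : E) 1).exists_isMinOn hs
      hν.continuous.continuousOn
    refine ⟨ν x, lt_of_le_of_ne (hν.nonneg x) fun h => ?_, fun y hy => hmin hy⟩
    have := hν.eq_zero x h.symm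
    simp [this] at hx
  have hsmall : ∀ x, ν x < m → x ∈ Metric.closedBall (0 : E) 1 := by
    intro x hx
    by_contra hn
    simp only [Metric.mem_closedBall, dist_zero_right, not_le] at hn
    have : (1 : ℝ) ∈ Icc ‖G.dilation 0 x‖ ‖G.dilation 1 x‖ := by
      rw [G.dilation_zero, G.dilation_one, norm_zero]
      exact ⟨zero_le_one, hn.le⟩
    obtain ⟨r, hr, hr1⟩ := intermediate_value_Icc (zero_le_one (α := ℝ))
      (hcont x).norm.continuousOn this
    have hr0 : 0 < r := lt_of_le_of_ne hr.1 fun h => by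
      rw [← h] at hr1
      simp [G.dilation_zero] at hr1
    have h1 := hmin (G.dilation r x) (by simpa using hr1)
    rw [hν.homogeneous r hr0] at h1
    have : r * ν x ≤ 1 * ν x := mul_le_mul_of_nonneg_right hr.2 (hν.nonneg x)
    linarith
  rcases le_or_gt R 0 with hR | hR
  · convert! Bornology.isBounded_empty
    ext x
    simpa using hR.trans (hν.nonneg x)
  have hb : Bornology.IsBounded (G.dilation (R / m) '' Metric.closedBall (0 : E) 1) :=
    ((isCompact_closedBall (0 : E) 1).image
      (LinearMap.continuous_of_finiteDimensional _)).isBounded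
  refine hb.subset fun x hx => ?_
  refine ⟨G.dilation (m / R) x, hsmall _ ?_, ?_⟩
  · rw [hν.homogeneous _ (by positivity)]
    calc m / R * ν x < m / R * R := by gcongr; exact hx
      _ = m := by field_simp
  · have h12 : ∀ y : E, y ∈ G.V₁ → G.V₁.projectionOnto G.V₂ G.isCompl y = y := by
      intro y hy
      exact congrArg Subtype.val (Submodule.projectionOnto_apply_left G.isCompl ⟨y, hy⟩)
    have h22 : ∀ y : E, y ∈ G.V₂ → G.V₂.projectionOnto G.V₁ G.isCompl.symm y = y := by
      intro y hy
      exact congrArg Subtype.val (Submodule.projectionOnto_apply_left G.isCompl.symm ⟨y, hy⟩)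
    have h10 : ∀ y : E, y ∈ G.V₂ → (G.V₁.projectionOnto G.V₂ G.isCompl y : E) = 0 := by
      intro y hy
      exact congrArg Subtype.val (Submodule.projectionOnto_apply_right G.isCompl ⟨y, hy⟩)
    have h20 : ∀ y : E, y ∈ G.V₁ → (G.V₂.projectionOnto G.V₁ G.isCompl.symm y : E) = 0 := by
      intro y hy
      exact congrArg Subtype.val (Submodule.projectionOnto_apply_right G.isCompl.symm ⟨y, hy⟩)
    have hsum := G.dilation_one x
    rw [dilation_apply] at hsum
    simp only [one_smul, one_pow] at hsum
    rw [dilation_apply, dilation_apply]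
    set a := (G.V₁.projectionOnto G.V₂ G.isCompl x) with ha
    set b := (G.V₂.projectionOnto G.V₁ G.isCompl.symm x) with hb
    simp only [map_add, map_smul, Submodule.coe_add, Submodule.coe_smul, h12 _ a.2, h22 _ b.2,
      h10 _ b.2, h20 _ a.2, smul_zero, add_zero, zero_add, smul_smul]
    rw [show R / m * (m / R) = 1 by field_simp,
      show (R / m) ^ 2 * (m / R) ^ 2 = 1 by field_simp, one_smul, one_smul, hsum]

theorem IsQuasiNorm.exists_bound {ν : E → ℝ} (hν : G.IsQuasiNorm ν) {S : Set E}
    (hS : Bornology.IsBounded S) : ∃ R > 0, ∀ x ∈ S, ν x < R := by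
  obtain ⟨C, hC⟩ := (hS.isCompact_closure.image hν.continuous).isBounded.bddAbove
  refine ⟨max C 0 + 1, by positivity, fun x hx => ?_⟩
  have := hC (mem_image_of_mem ν (subset_closure hx))
  linarith [le_max_left C 0]

/-- A substitute for the quasi-triangle inequality: sublevel sets are relatively compact and the
product is continuous. No explicit dependence of `R'` on `R` is needed later. -/
theorem IsQuasiNorm.exists_mul_bound {ν : E → ℝ} (hν : G.IsQuasiNorm ν) (R : ℝ) :
    ∃ R' > 0, ∀ x y, ν x < R → ν y < R → ν (G.mul x y) < R' := by
  have hc := (hν.isBounded_sublevel R).isCompact_closure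
  obtain ⟨R', h0, h⟩ := hν.exists_bound ((hc.prod hc).image G.continuous_mul).isBounded
  exact ⟨R', h0, fun x y hx hy => h _ ⟨(x, y), ⟨subset_closure hx, subset_closure hy⟩, rfl⟩⟩

theorem IsQuasiNorm.isOpen_ball {ν : E → ℝ} (hν : G.IsQuasiNorm ν) (c : E) (R : ℝ) :
    IsOpen (G.ball ν c R) :=
  isOpen_lt (hν.continuous.comp (G.continuous_mul.comp (Continuous.prodMk_right (-c))))
    continuous_const

theorem IsQuasiNorm.mem_ball_comm {ν : E → ℝ} (hν : G.IsQuasiNorm ν) {x y : E} {R : ℝ} :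
    x ∈ G.ball ν y R ↔ y ∈ G.ball ν x R := by
  rw [mem_ball, mem_ball, ← hν.symmetric, G.neg_mul, neg_neg]

theorem IsQuasiNorm.mem_ball_self {ν : E → ℝ} (hν : G.IsQuasiNorm ν) {x : E} {R : ℝ} (hR : 0 < R) :
    x ∈ G.ball ν x R := by
  rw [mem_ball]
  simpa [mul, G.bracket_self, hν.map_zero] using hR

/-- Balls satisfy a coarse triangle inequality. -/
theorem IsQuasiNorm.exists_ball_trans {ν : E → ℝ} (hν : G.IsQuasiNorm ν) (R : ℝ) :
    ∃ R' > 0, ∀ x y z, y ∈ G.ball ν x R → z ∈ G.ball ν y R → z ∈ G.ball ν x R' := by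
  obtain ⟨R', h0, h⟩ := hν.exists_mul_bound R
  refine ⟨R', h0, fun x y z hy hz => ?_⟩
  have := h _ _ hy hz
  rwa [G.mul_assoc', G.mul_neg_cancel_left] at this

end Top

/-! ### Left translations preserve Lebesgue measure -/

section Meas

variable {E : Type*} [NormedAddCommGroup E] [InnerProductSpace ℝ E] [FiniteDimensional ℝ E]
  [MeasurableSpace E] [BorelSpace E] 

/-- The characteristic polynomial of the nilpotent map `-N` is a power of the variable, and its
value at `1` is `det (1 + N)`. -/
theorem _root_.LinearMap.det_one_add_of_sq_eq_zero (N : E →ₗ[ℝ] E) (hN : ∀ x, N (N x) = 0) :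
    LinearMap.det (1 + N) = 1 := by
  have hnil : IsNilpotent (-N) := ⟨2, by ext x; simp [pow_two, hN]⟩
  have h := LinearMap.eval_charpoly (-N) 1
  rw [hnil.charpoly_eq_X_pow_finrank] at h
  simpa using h.symm

/-- A unipotent linear map `1 + N` with `N² = 0`, followed by a translation, preserves volume. -/
theorem measurePreserving_one_add (N : E →ₗ[ℝ] E) (hN : ∀ x, N (N x) = 0) :
    MeasurePreserving (fun x => x + N x) (volume : Measure E) volume := by
  have hd := LinearMap.det_one_add_of_sq_eq_zero N hN
  have h := Measure.map_linearMap_addHaar_eq_smul_addHaar (volume : Measure E)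
    (f := 1 + N) (by rw [hd]; exact one_ne_zero)
  rw [hd] at h
  refine ⟨(LinearMap.continuous_of_finiteDimensional (1 + N)).measurable, ?_⟩
  simp only [abs_one, inv_one, ENNReal.ofReal_one, one_smul] at h
  exact h

/-- Left translation is the unipotent shear `1 + (1 / 2) [c, ·]` followed by a Euclidean
translation. -/
theorem measurePreserving_mul (G : StratifiedGroup E) (c : E) :
    MeasurePreserving (G.mul c) (volume : Measure E) volume := by
  have h := measurePreserving_one_add ((1 / 2 : ℝ) • G.bracket c)
    (fun x => by simp [G.bracket_bracket])
  have h2 := (measurePreserving_add_left (volume : Measure E) c).comp h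
  convert h2 using 1
  ext x
  simp [mul, add_assoc]

theorem volume_ball {G : StratifiedGroup E} {ν : E → ℝ} (hν : G.IsQuasiNorm ν) (c : E) (R : ℝ) :
    volume (G.ball ν c R) = volume {x | ν x < R} :=
  (measurePreserving_mul G (-c)).measure_preimage
    (isOpen_lt hν.continuous continuous_const).measurableSet.nullMeasurableSet

end Meas

end StratifiedGroup

/-! ### Coverings by uniformly bounded open sets -/

section Coverings

variable {E ι : Type*}

/-- The members of a family that meet a set. -/
def meeting (Q : ι → Set E) (S : Set E) : Set ι := {i | (Q i ∩ S).Nonempty}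

theorem meeting_union (Q : ι → Set E) (S T : Set E) :
    meeting Q (S ∪ T) = meeting Q S ∪ meeting Q T := by
  ext i
  simp [meeting, inter_union_distrib_left, union_nonempty]

theorem meeting_mono (Q : ι → Set E) {S T : Set E} (h : S ⊆ T) : meeting Q S ⊆ meeting Q T :=
  fun _ hi => hi.mono (inter_subset_inter_right _ h)

/-- There is a chain `Q (c 0), …, Q (c m)` of consecutively intersecting sets from `x` to `y`. -/
def IsChainFromTo (Q : ι → Set E) (x y : E) (m : ℕ) : Prop :=
  ∃ c : ℕ → ι, x ∈ Q (c 0) ∧ y ∈ Q (c m) ∧ ∀ j < m, (Q (c j) ∩ Q (c (j + 1))).Nonempty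

theorem coveringDist_le_of_chain {Q : ι → Set E} {x y : E} {m : ℕ} (h : IsChainFromTo Q x y m) :
    coveringDist Q x y ≤ m + 1 := by
  classical
  rw [coveringDist]
  split_ifs
  · exact Nat.zero_le _
  · obtain ⟨c, h1, h2, h3⟩ := h
    exact Nat.sInf_le ⟨m, c, rfl, h1, h2, h3⟩

/-- The hypothesis that some chain exists matters: the infimum of the empty set of natural numbers
is `0`, and only for a nonempty set is the distance realised by a chain. -/
theorem exists_chain_coveringDist {Q : ι → Set E} {x y : E} (hxy : x ≠ y) {m : ℕ}
    (h : IsChainFromTo Q x y m) :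
    ∃ m', coveringDist Q x y = m' + 1 ∧ IsChainFromTo Q x y m' := by
  classical
  rw [coveringDist, if_neg hxy]
  obtain ⟨c, h1, h2, h3⟩ := h
  obtain ⟨m', c', h0, h1', h2', h3'⟩ := Nat.sInf_mem
    (s := {k | ∃ (m : ℕ) (c : ℕ → ι), k = m + 1 ∧ x ∈ Q (c 0) ∧ y ∈ Q (c m) ∧
      ∀ j < m, (Q (c j) ∩ Q (c (j + 1))).Nonempty}) ⟨_, m, c, rfl, h1, h2, h3⟩
  exact ⟨m', h0, c', h1', h2', h3'⟩

/-- Two points of a preconnected set are joined by a chain whose length is at most the number of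
members of the covering that meet the set. -/
theorem exists_chain_of_isPreconnected [TopologicalSpace E] {Q : ι → Set E}
    (hcov : ⋃ i, Q i = univ) (hopen : ∀ i, IsOpen (Q i)) {S : Set E} (hS : IsPreconnected S)
    {K : ℕ} (hK : (meeting Q S).encard ≤ K) {x y : E} (hx : x ∈ S) (hy : y ∈ S) :
    ∃ m < K, IsChainFromTo Q x y m := by
  classical
  have hfin : (meeting Q S).Finite := finite_of_encard_le_coe hK
  have := hfin.fintype
  -- The intersection graph of the members that meet `S`.
  let Γ : SimpleGraph (meeting Q S) :=
    { Adj := fun i j => i ≠ j ∧ (Q i ∩ Q j).Nonempty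
      symm := ⟨fun i j h => ⟨h.1.symm, by rw [inter_comm]; exact h.2⟩⟩
      loopless := ⟨fun i h => h.1 rfl⟩ }
  have hmem : ∀ z ∈ S, ∃ i : meeting Q S, z ∈ Q i := by
    intro z hz
    obtain ⟨i, hi⟩ := mem_iUnion.1 (hcov.symm ▸ mem_univ z : z ∈ ⋃ i, Q i)
    exact ⟨⟨i, z, hi, hz⟩, hi⟩
  obtain ⟨i, hi⟩ := hmem x hx
  obtain ⟨j, hj⟩ := hmem y hy
  -- Otherwise the members reachable from `i` and the remaining ones cover `S` by two open sets that
  -- both meet `S`. By preconnectedness they share a point, which gives an edge from a reachable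
  -- member to an unreachable one.
  have hreach : Γ.Reachable i j := by
    by_contra hn
    obtain ⟨z, hzS, hz1, hz2⟩ := hS (⋃ (k) (_ : Γ.Reachable i k), Q k)
      (⋃ (k) (_ : ¬ Γ.Reachable i k), Q k)
      (isOpen_iUnion fun k => isOpen_iUnion fun _ => hopen k)
      (isOpen_iUnion fun k => isOpen_iUnion fun _ => hopen k)
      (by
        intro z hz
        obtain ⟨k, hk⟩ := hmem z hz
        by_cases h : Γ.Reachable i k
        · exact Or.inl (mem_iUnion₂.2 ⟨k, h, hk⟩)
        · exact Or.inr (mem_iUnion₂.2 ⟨k, h, hk⟩))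
      ⟨x, hx, mem_iUnion₂.2 ⟨i, SimpleGraph.Reachable.refl _, hi⟩⟩
      ⟨y, hy, mem_iUnion₂.2 ⟨j, hn, hj⟩⟩
    obtain ⟨k, hk, hzk⟩ := mem_iUnion₂.1 hz1
    obtain ⟨l, hl, hzl⟩ := mem_iUnion₂.1 hz2
    refine hl (hk.trans (SimpleGraph.Adj.reachable ⟨?_, z, hzk, hzl⟩))
    rintro rfl
    exact hl hk
  -- A path visits no vertex twice, so its length is strictly below the number of vertices.
  obtain ⟨p, hp⟩ := hreach.exists_isPath
  refine ⟨p.length, ?_, fun k => p.getVert k, ?_, ?_, ?_⟩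
  · have h1 := hp.length_lt
    have h2 : Fintype.card (meeting Q S) ≤ K := by
      rw [← Nat.card_eq_fintype_card, Nat.card_coe_set_eq]
      have := hfin.cast_ncard_eq
      rw [← this] at hK
      exact_mod_cast hK
    omega
  · simpa using hi
  · simpa using hj
  · intro k hk
    exact (p.adj_getVert_succ hk).2

end Coverings

/-! ### Uniform coverings: counting members and estimating the covering distance -/

namespace StratifiedGroup

variable {E : Type*} [NormedAddCommGroup E] [InnerProductSpace ℝ E] [FiniteDimensional ℝ E]
  [MeasurableSpace E] [BorelSpace E] {ι : Type*}

/-- An admissible covering by open sets, of volume bounded below and contained in balls of a fixed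
radius. -/
structure IsUniformCovering (G : StratifiedGroup E) (ν : E → ℝ) (Q : ι → Set E) : Prop where
  admissible : IsAdmissibleCovering Q
  isOpen : ∀ i, IsOpen (Q i)
  volume_lower : ∃ a : ℝ≥0∞, a ≠ 0 ∧ ∀ i, a ≤ volume (Q i)
  subset_ball : ∃ R : ℝ, ∀ i, ∃ c, Q i ⊆ G.ball ν c R

variable {G : StratifiedGroup E} {ν : E → ℝ} {Q : ι → Set E}

theorem IsQuasiNorm.ball_mono {c : E} {R R' : ℝ} (h : R ≤ R') : G.ball ν c R ⊆ G.ball ν c R' :=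
  fun _ hx => lt_of_lt_of_le hx h

theorem IsUniformCovering.exists_mem_ball (hQ : IsUniformCovering G ν Q) (hν : G.IsQuasiNorm ν) :
    ∃ R > 0, ∀ i, ∀ x ∈ Q i, ∀ y ∈ Q i, y ∈ G.ball ν x R := by
  obtain ⟨R, hR⟩ := hQ.subset_ball
  obtain ⟨R', h0, h⟩ := hν.exists_ball_trans R
  refine ⟨R', h0, fun i x hx y hy => ?_⟩
  obtain ⟨c, hc⟩ := hR i
  exact h x c y (hν.mem_ball_comm.1 (hc hx)) (hc hy)

/-- Only boundedly many members of a uniform covering meet a ball of given radius. -/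
theorem IsUniformCovering.exists_encard_meeting_le (hQ : IsUniformCovering G ν Q)
    (hν : G.IsQuasiNorm ν) (ρ : ℝ) :
    ∃ K : ℕ, ∀ c, (meeting Q (G.ball ν c ρ)).encard ≤ K := by
  classical
  obtain ⟨M, hM⟩ := hQ.admissible.bounded
  obtain ⟨a, ha0, ha⟩ := hQ.volume_lower
  obtain ⟨R, hR0, hR⟩ := hQ.exists_mem_ball hν
  obtain ⟨R', h0, h⟩ := hν.exists_ball_trans (max R ρ)
  set W := volume {x | ν x < R'} with hW
  have hWfin : W ≠ ⊤ := (hν.isBounded_sublevel R').measure_lt_top.ne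
  rcases isEmpty_or_nonempty ι with hι | ⟨⟨i0⟩⟩
  · refine ⟨0, fun c => ?_⟩
    rw [Set.eq_empty_of_isEmpty (meeting Q _)]
    simp
  have hatop : a ≠ ⊤ := by
    intro htop
    obtain ⟨x, hx⟩ := hQ.admissible.nonempty i0
    have : Q i0 ⊆ G.ball ν x R := fun y hy => hR i0 x hx y hy
    have h1 := measure_mono (μ := volume) this
    rw [volume_ball hν] at h1
    have h2 := ha i0
    rw [htop] at h2
    exact (hν.isBounded_sublevel R).measure_lt_top.ne (top_unique (h2.trans h1))
  obtain ⟨K, hK⟩ := ENNReal.exists_nat_gt (r := M * W / a)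
    (ENNReal.div_ne_top (ENNReal.mul_ne_top (ENNReal.natCast_ne_top M) hWfin) ha0)
  -- Volume count: the members that meet the ball lie in the concentric ball of radius `R'`, of
  -- volume `W`. Each has volume at least `a` and no point lies in more than `M` of them, so there
  -- are at most `M * W / a`.
  have key : ∀ c, ∀ s : Finset ι, ↑s ⊆ meeting Q (G.ball ν c ρ) → s.card ≤ K := by
    intro c s hs
    have hsub : ∀ i ∈ s, Q i ⊆ G.ball ν c R' := by
      intro i hi y hy
      obtain ⟨x, hx, hxc⟩ := hs hi
      exact h c x y (IsQuasiNorm.ball_mono (le_max_right _ _) hxc)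
        (IsQuasiNorm.ball_mono (le_max_left _ _) (hR i x hx y hy))
    have hpt : ∀ x, ∑ i ∈ s, (Q i).indicator (1 : E → ℝ≥0∞) x ≤
        (G.ball ν c R').indicator (fun _ => (M : ℝ≥0∞)) x := by
      intro x
      by_cases hx : ∃ i ∈ s, x ∈ Q i
      · obtain ⟨i, hi, hxi⟩ := hx
        rw [indicator_of_mem (hsub i hi hxi)]
        simp only [indicator_apply, Pi.one_apply, Finset.sum_boole]
        have h1 : (({j ∈ s | x ∈ Q j} : Finset ι) : Set ι) ⊆ {j | (Q i ∩ Q j).Nonempty} :=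
          fun j hj => ⟨x, hxi, by simp at hj; exact hj.2⟩
        have h2 := (encard_le_encard h1).trans (hM i)
        rw [encard_coe_eq_coe_finsetCard] at h2
        exact_mod_cast h2
      · push Not at hx
        rw [Finset.sum_eq_zero fun i hi => indicator_of_notMem (hx i hi) _]
        exact zero_le
    have h1 : (s.card : ℝ≥0∞) * a ≤ M * W := by
      calc (s.card : ℝ≥0∞) * a = ∑ i ∈ s, a := by simp
        _ ≤ ∑ i ∈ s, volume (Q i) := Finset.sum_le_sum fun i _ => ha i
        _ = ∑ i ∈ s, ∫⁻ x, (Q i).indicator (1 : E → ℝ≥0∞) x := by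
          refine Finset.sum_congr rfl fun i _ => ?_
          rw [lintegral_indicator_one (hQ.isOpen i).measurableSet]
        _ = ∫⁻ x, ∑ i ∈ s, (Q i).indicator (1 : E → ℝ≥0∞) x := by
          rw [lintegral_finsetSum]
          exact fun i _ => measurable_one.indicator (hQ.isOpen i).measurableSet
        _ ≤ ∫⁻ x, (G.ball ν c R').indicator (fun _ => (M : ℝ≥0∞)) x := lintegral_mono hpt
        _ = M * W := by
          rw [lintegral_indicator_const (hν.isOpen_ball c R').measurableSet, volume_ball hν]
    have h2 : (s.card : ℝ≥0∞) ≤ M * W / a :=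
      (ENNReal.le_div_iff_mul_le (Or.inl ha0) (Or.inl hatop)).2 h1
    exact_mod_cast (h2.trans hK.le)
  refine ⟨K, fun c => ?_⟩
  by_contra hcon
  push Not at hcon
  -- The family might be infinite; a subfamily of exactly `K + 1` members already contradicts the
  -- finite count.
  obtain ⟨t, ht, htc⟩ := exists_subset_encard_eq (Order.add_one_le_of_lt hcon)
  have hfin : t.Finite := finite_of_encard_eq_coe (k := K + 1) (by rw [htc]; norm_cast)
  have := key c hfin.toFinset (by simpa using ht)
  rw [← hfin.coe_toFinset, encard_coe_eq_coe_finsetCard] at htc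
  have h3 : hfin.toFinset.card = K + 1 := by exact_mod_cast htc
  omega

/-- Since `[X, X] = 0`, the multiples of `X` form a one-parameter subgroup, so the position of `t •
X` relative to `s • X` depends on `t - s` alone. -/
theorem smul_mem_ball_smul {X : E} (s t : ℝ) :
    G.mul (-(s • X)) (t • X) = (t - s) • X := by
  simp only [mul, map_neg, map_smul, LinearMap.neg_apply, LinearMap.smul_apply, G.bracket_self,
    smul_zero, neg_zero, add_zero]
  module

/-- The covering distance grows at most linearly along a one-parameter subgroup. -/
theorem IsUniformCovering.exists_coveringDist_le (hQ : IsUniformCovering G ν Q)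
    (hν : G.IsQuasiNorm ν) (X : E) :
    ∃ A > 0, ∀ ρ : ℝ, ∃ C > 0, ∀ s t : ℝ, ∀ z ∈ G.ball ν (s • X) ρ, ∀ w ∈ G.ball ν (t • X) ρ,
      (∃ m, IsChainFromTo Q z w m) ∧ (coveringDist Q z w : ℝ) ≤ A * |s - t| + C := by
  obtain ⟨r0, hr00, hr0⟩ := hν.exists_bound
    ((isCompact_Icc (a := (0 : ℝ)) (b := 1)).image
      (continuous_id.smul continuous_const : Continuous fun τ : ℝ => τ • X)).isBounded
  obtain ⟨K0, hK0⟩ := hQ.exists_encard_meeting_le hν r0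
  -- The slope counts the members met by a unit segment of the subgroup. It is fixed before `ρ`,
  -- which affects only the additive constant.
  refine ⟨K0 + 1, by positivity, fun ρ => ?_⟩
  -- balls of radius `ρ` are star-shaped up to enlarging the radius
  obtain ⟨r1, hr10, hr1⟩ := hν.exists_bound
    (((isCompact_Icc (a := (0 : ℝ)) (b := 1)).prod
      (hν.isBounded_sublevel ρ).isCompact_closure).image
      (continuous_fst.smul continuous_snd : Continuous fun p : ℝ × E => p.1 • p.2)).isBounded
  obtain ⟨K1, hK1⟩ := hQ.exists_encard_meeting_le hν r1
  have hray : ∀ (s : ℝ) (z : E), z ∈ G.ball ν (s • X) ρ → ∃ S : Set E, IsPreconnected S ∧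
      z ∈ S ∧ s • X ∈ S ∧ (meeting Q S).encard ≤ K1 := by
    intro s z hz
    refine ⟨(fun τ : ℝ => G.mul (s • X) (τ • G.mul (-(s • X)) z)) '' Icc 0 1, ?_, ?_, ?_, ?_⟩
    · refine isPreconnected_Icc.image _ (Continuous.continuousOn ?_)
      exact G.continuous_mul.comp (Continuous.prodMk_right (s • X) |>.comp
        (continuous_id.smul continuous_const))
    · exact ⟨1, by simp, by simp [G.mul_neg_cancel_left]⟩
    · exact ⟨0, by simp, by simp [mul]⟩
    · refine (encard_le_encard (meeting_mono Q ?_)).trans (hK1 (s • X))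
      rintro _ ⟨τ, hτ, rfl⟩
      rw [mem_ball, G.neg_mul_cancel_left]
      exact hr1 _ ⟨(τ, G.mul (-(s • X)) z), ⟨hτ, subset_closure hz⟩, rfl⟩
  -- The segment is cut into `⌊t - s⌋₊ + 1` pieces of length at most one, each inside a left
  -- translate of the ball of radius `r0`, where at most `K0` members meet it.
  have hline : ∀ s t : ℝ, s ≤ t → ∃ S : Set E, IsPreconnected S ∧ s • X ∈ S ∧ t • X ∈ S ∧
      (meeting Q S).encard ≤ ((⌊t - s⌋₊ + 1) * K0 : ℕ) := by
    intro s t hst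
    refine ⟨(fun τ : ℝ => τ • X) '' Icc s t, ?_, ⟨s, by simp [hst], rfl⟩, ⟨t, by simp [hst], rfl⟩,
      ?_⟩
    · exact isPreconnected_Icc.image _ (continuous_id.smul continuous_const).continuousOn
    · have hsub : meeting Q ((fun τ : ℝ => τ • X) '' Icc s t) ⊆
          ⋃ k ∈ Finset.range (⌊t - s⌋₊ + 1), meeting Q (G.ball ν ((s + k) • X) r0) := by
        rintro i ⟨_, hi, τ, hτ, rfl⟩
        have h0 : 0 ≤ τ - s := sub_nonneg.2 hτ.1
        refine mem_iUnion₂.2 ⟨⌊τ - s⌋₊, ?_, τ • X, hi, ?_⟩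
        · rw [Finset.mem_range, Nat.lt_succ_iff]
          exact Nat.floor_le_floor (by linarith [hτ.2])
        · rw [mem_ball, smul_mem_ball_smul]
          refine hr0 _ ⟨τ - (s + ⌊τ - s⌋₊), ⟨?_, ?_⟩, rfl⟩
          · linarith [Nat.floor_le h0]
          · linarith [Nat.lt_floor_add_one (τ - s)]
      have hbi : ∀ (F : Finset ℕ), (⋃ k ∈ F, meeting Q (G.ball ν ((s + k) • X) r0)).encard ≤
          (F.card * K0 : ℕ) := by
        intro F
        induction F using Finset.induction_on with
        | empty => simp
        | insert k F hk ih =>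
          rw [Finset.set_biUnion_insert, Finset.card_insert_of_notMem hk]
          refine (encard_union_le _ _).trans ((add_le_add (hK0 _) ih).trans ?_)
          norm_cast
          exact le_of_eq (by ring)
      refine (encard_le_encard hsub).trans ((hbi _).trans ?_)
      simp
  have hline' : ∀ s t : ℝ, ∃ S : Set E, IsPreconnected S ∧ s • X ∈ S ∧ t • X ∈ S ∧
      (meeting Q S).encard ≤ ((⌊|s - t|⌋₊ + 1) * K0 : ℕ) := by
    intro s t
    rcases le_total s t with h | h
    · obtain ⟨S, h1, h2, h3, h4⟩ := hline s t h
      exact ⟨S, h1, h2, h3, by rwa [abs_sub_comm, abs_of_nonneg (sub_nonneg.2 h)]⟩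
    · obtain ⟨S, h1, h2, h3, h4⟩ := hline t s h
      exact ⟨S, h1, h3, h2, by rwa [abs_of_nonneg (sub_nonneg.2 h)]⟩
  refine ⟨K0 + 2 * K1 + 1, by positivity, fun s t z hz w hw => ?_⟩
  obtain ⟨S1, c1, z1, x1, m1⟩ := hray s z hz
  obtain ⟨S2, c2, z2, x2, m2⟩ := hray t w hw
  obtain ⟨S3, c3, z3, x3, m3⟩ := hline' s t
  have hconn : IsPreconnected (S1 ∪ S3 ∪ S2) :=
    (c1.union (s • X) x1 z3 c3).union (t • X) (Or.inr x3) x2 c2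
  have hcard : (meeting Q (S1 ∪ S3 ∪ S2)).encard ≤
      (K1 + (⌊|s - t|⌋₊ + 1) * K0 + K1 : ℕ) := by
    rw [meeting_union, meeting_union]
    refine (encard_union_le _ _).trans ?_
    push_cast
    refine add_le_add ((encard_union_le _ _).trans (add_le_add m1 ?_)) m2
    exact_mod_cast m3
  obtain ⟨m, hm, hch⟩ := exists_chain_of_isPreconnected hQ.admissible.covers hQ.isOpen hconn hcard
    (Or.inl (Or.inl z1)) (Or.inr z2)
  refine ⟨⟨m, hch⟩, ?_⟩
  have h1 := coveringDist_le_of_chain hch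
  have h2 : (coveringDist Q z w : ℝ) ≤ (K1 + (⌊|s - t|⌋₊ + 1) * K0 + K1 : ℕ) := by
    exact_mod_cast (by omega : coveringDist Q z w ≤ K1 + (⌊|s - t|⌋₊ + 1) * K0 + K1)
  push_cast at h2
  have h3 := Nat.floor_le (abs_nonneg (s - t))
  have h4 : (K0 : ℝ) * ⌊|s - t|⌋₊ ≤ K0 * |s - t| := by gcongr
  nlinarith [abs_nonneg (s - t)]

/-- The covering distance dominates every functional that vanishes on the second layer. -/
theorem IsUniformCovering.exists_le_coveringDist (hQ : IsUniformCovering G ν Q)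
    (hν : G.IsQuasiNorm ν) (l : E →ₗ[ℝ] ℝ) (hl : ∀ z ∈ G.V₂, l z = 0) :
    ∃ A > 0, ∀ z w, |l z - l w| ≤ A * coveringDist Q z w := by
  obtain ⟨R, hR0, hR⟩ := hQ.exists_mem_ball hν
  obtain ⟨Λ, hΛ0, hΛ⟩ : ∃ Λ > 0, ∀ x, ν x < R → |l x| ≤ Λ := by
    have hc : Continuous l := LinearMap.continuous_of_finiteDimensional l
    obtain ⟨C, hC⟩ := ((hν.isBounded_sublevel R).isCompact_closure.image hc.abs).isBounded.bddAbove
    exact ⟨max C 1, by positivity, fun x hx =>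
      (hC ⟨x, subset_closure hx, rfl⟩).trans (le_max_left _ _)⟩
  -- With `X = 0` and a large radius this only serves to join any two points by some chain, so that
  -- the distance is attained.
  obtain ⟨A', -, hA'⟩ := hQ.exists_coveringDist_le hν (0 : E)
  have hstep : ∀ i, ∀ x ∈ Q i, ∀ y ∈ Q i, |l x - l y| ≤ Λ := by
    intro i x hx y hy
    have h := hΛ _ (hR i x hx y hy)
    rwa [G.map_mul_of_vanish l hl, map_neg, neg_add_eq_sub, abs_sub_comm] at h
  refine ⟨Λ, hΛ0, fun z w => ?_⟩
  rcases eq_or_ne z w with rfl | hzw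
  · simp only [sub_self, abs_zero]
    positivity
  obtain ⟨C, -, hC⟩ := hA' (max (ν z) (ν w) + 1)
  obtain ⟨⟨m, hm⟩, -⟩ := hC 0 0 z
    (by rw [mem_ball, smul_zero, neg_zero, G.zero_mul]; linarith [le_max_left (ν z) (ν w)]) w
    (by rw [mem_ball, smul_zero, neg_zero, G.zero_mul]; linarith [le_max_right (ν z) (ν w)])
  obtain ⟨m', hm', c, h0, h1, h2⟩ := exists_chain_coveringDist hzw hm
  rw [hm']
  -- Up to index `k` the chain has `k + 1` members, and each contributes an oscillation of at most
  -- `Λ`.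
  have hind : ∀ k ≤ m', ∀ y ∈ Q (c k), |l z - l y| ≤ Λ * (k + 1) := by
    intro k
    induction k with
    | zero => intro _ y hy; simpa using hstep _ z h0 y hy
    | succ k ih =>
      intro hk y hy
      obtain ⟨v, hv1, hv2⟩ := h2 k (by omega)
      have e1 := ih (by omega) v hv1
      have e2 := hstep _ v hv2 y hy
      push_cast
      calc |l z - l y| ≤ |l z - l v| + |l v - l y| := abs_sub_le _ _ _
        _ ≤ Λ * (k + 1) + Λ := add_le_add e1 e2
        _ = _ := by ring
  have := hind m' le_rfl w h1
  push_cast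
  exact this

theorem isUniformCovering_latticeCovering (hν : G.IsQuasiNorm ν) {N : Subgroup G.Carrier} {R : ℝ}
    (hR : 0 < R) (h : IsAdmissibleCovering (G.latticeCovering ν N R)) :
    IsUniformCovering G ν (G.latticeCovering ν N R) where
  admissible := h
  isOpen i := hν.isOpen_ball _ _
  volume_lower := by
    refine ⟨volume {x | ν x < R}, ?_, fun i => (volume_ball hν _ _).ge⟩
    exact ((isOpen_lt hν.continuous continuous_const).measure_pos volume
      ⟨0, by simpa [hν.map_zero] using hR⟩).ne'
  subset_ball := ⟨R, fun i => ⟨_, Subset.rfl⟩⟩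

theorem IsAlphaCovering.exists_volume_bounds (h : G.IsAlphaCovering ν 0 Q) :
    ∃ a b : ℝ, 0 < a ∧ 0 < b ∧ ∀ i, ENNReal.ofReal a ≤ volume (Q i) ∧
      volume (Q i) ≤ ENNReal.ofReal b := by
  obtain ⟨a, b, ha, hb, hab⟩ := h.size
  refine ⟨a, b, ha, hb, fun i => ?_⟩
  obtain ⟨x, hx⟩ := h.admissible.nonempty i
  simpa using hab i x hx

/-- The upper volume bound caps the inner radii, because balls of large radius have large volume,
and the bounded ratio then caps the outer radii. Nontriviality makes the total volume infinite. -/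
theorem IsAlphaCovering.isUniformCovering [Nontrivial E] (hν : G.IsQuasiNorm ν)
    (h : G.IsAlphaCovering ν 0 Q) : IsUniformCovering G ν Q := by
  obtain ⟨a, b, ha, hb, hab⟩ := h.exists_volume_bounds
  refine ⟨h.admissible, h.isOpen, ⟨ENNReal.ofReal a, by simpa using ha, fun i => (hab i).1⟩, ?_⟩
  -- large balls have large volume
  have hlim : Filter.Tendsto (fun k : ℕ => volume {x | ν x < k}) Filter.atTop
      (nhds (volume (⋃ k : ℕ, {x | ν x < k}))) :=
    tendsto_measure_iUnion_atTop fun k l hkl x (hx : ν x < k) =>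
      show ν x < l from lt_of_lt_of_le hx (Nat.cast_le.2 hkl)
  have huniv : (⋃ k : ℕ, {x | ν x < k}) = univ := by
    ext x
    simpa using exists_nat_gt (ν x)
  rw [huniv, measure_univ_of_isAddLeftInvariant] at hlim
  obtain ⟨k, hk⟩ := (hlim.eventually (lt_mem_nhds (ENNReal.ofReal_lt_top (r := b)))).exists
  obtain ⟨K, hK⟩ := h.ratio
  refine ⟨K * k + 1, fun i => ?_⟩
  have hsup : ⨆ (r : ℝ≥0) (_ : ∃ c, G.ball ν c r ⊆ Q i), (r : ℝ≥0∞) ≤ (k : ℝ≥0) := by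
    refine iSup₂_le fun r ⟨c, hc⟩ => ?_
    by_contra hlt
    push Not at hlt
    have h1 : (k : ℝ) ≤ r := by exact_mod_cast hlt.le
    have h2 : volume {x | ν x < k} ≤ ENNReal.ofReal b := by
      rw [← volume_ball hν c]
      exact (measure_mono ((IsQuasiNorm.ball_mono h1).trans hc)).trans (hab i).2
    exact absurd hk (not_lt.2 h2)
  have hinf : ⨅ (R : ℝ≥0) (_ : ∃ c, Q i ⊆ G.ball ν c R), (R : ℝ≥0∞) < (K * k + 1 : ℝ≥0) := by
    refine lt_of_le_of_lt ((hK i).trans (mul_le_mul_right hsup _)) ?_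
    norm_cast
    exact lt_add_one _
  simp only [iInf_lt_iff] at hinf
  obtain ⟨R, ⟨c, hc⟩, hR⟩ := hinf
  refine ⟨c, hc.trans (IsQuasiNorm.ball_mono ?_)⟩
  have : R ≤ K * k + 1 := by exact_mod_cast hR.le
  exact_mod_cast this

end StratifiedGroup

/-! ### Reservoir elements given by integrable functions -/

section Reservoir

variable {E : Type*} [NormedAddCommGroup E] [InnerProductSpace ℝ E] [FiniteDimensional ℝ E]
  [MeasurableSpace E] [BorelSpace E]

/-- The inclusion `Z(E) → 𝓢(E)`. -/
def FourierTestSpace.toSchwartz : FourierTestSpace E →ₗ[ℂ] 𝓢(E, ℂ) :=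
  (LinearMap.range (fourierTest E)).subtype

theorem integrable_mul_schwartz {u : E → ℂ} (hu : Integrable u) (w : 𝓢(E, ℂ)) :
    Integrable fun x => u x * w x := by
  refine hu.mul_bdd (c := ‖w.toBoundedContinuousFunction‖) w.continuous.aestronglyMeasurable ?_
  exact Filter.Eventually.of_forall fun x => w.toBoundedContinuousFunction.norm_coe_le_norm x

theorem fourier_continuous {u : E → ℂ} (hu : Integrable u) : Continuous (𝓕 u) :=
  VectorFourier.fourierIntegral_continuous Real.continuous_fourierChar continuous_inner hu

theorem fourierInv_continuous {u : E → ℂ} (hu : Integrable u) : Continuous (𝓕⁻ u) := by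
  rw [Real.fourierInv_eq_fourier_comp_neg]
  exact fourier_continuous hu.comp_neg

theorem norm_fourier_le {u : E → ℂ} (ξ : E) : ‖𝓕 u ξ‖ ≤ ∫ x, ‖u x‖ :=
  VectorFourier.norm_fourierIntegral_le_integral_norm _ _ _ _ _

theorem integral_mul_fourier_eq {u v : E → ℂ} (hu : Integrable u) (hv : Integrable v) :
    ∫ x, u x * 𝓕 v x = ∫ x, 𝓕 u x * v x := by
  have h := VectorFourier.integral_fourierIntegral_smul_eq_flip (L := innerₗ E)
    Real.continuous_fourierChar continuous_inner hu hv
  simp only [smul_eq_mul, flip_innerₗ] at h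
  exact h.symm

theorem TestFunction.integrable_volume (χ : 𝓓((⊤ : TopologicalSpace.Opens E), ℂ)) :
    Integrable (χ : E → ℂ) :=
  χ.continuous.integrable_of_hasCompactSupport χ.hasCompactSupport

/-- The element of `Z'(E)` represented by an integrable function. -/
def reservoirOfIntegrable (u : E → ℂ) (hu : Integrable u) : FourierReservoir E where
  toFun z := ∫ x, u x * FourierTestSpace.toSchwartz z x
  map_add' z w := by
    simp only [map_add, add_apply, mul_add]
    exact integral_add (integrable_mul_schwartz hu _) (integrable_mul_schwartz hu _)
  map_smul' c z := by
    simp only [map_smul, smul_apply, smul_eq_mul, RingHom.id_apply]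
    rw [← integral_const_mul]
    congr 1 with x
    ring
  cont := by
    refine continuous_coinduced_dom.2 ?_
    -- As the topology of `Z(E)` is coinduced, continuity is tested on `C_c^∞`. There the
    -- multiplication formula turns the functional into integration against the continuous function
    -- `𝓕 u`.
    have hloc : LocallyIntegrable (𝓕 u) := (fourier_continuous hu).locallyIntegrable
    have := (TestFunction.integralAgainstBilinCLM (Ω := (⊤ : TopologicalSpace.Opens E)) (n := ⊤)
      (ContinuousLinearMap.mul ℂ ℂ) (volume : Measure E) (𝓕 u)).continuous
    convert! this using 1
    ext χ
    rw [TestFunction.integralAgainstBilinCLM_apply, if_pos (hloc.locallyIntegrableOn _)]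
    change ∫ x, u x * 𝓕 (χ : E → ℂ) x = ∫ x, χ x * 𝓕 u x
    rw [integral_mul_fourier_eq hu χ.integrable_volume]
    congr 1 with x
    ring

theorem reservoirFourier_reservoirOfIntegrable {u : E → ℂ} (hu : Integrable u)
    (χ : 𝓓((⊤ : TopologicalSpace.Opens E), ℂ)) :
    reservoirFourier (reservoirOfIntegrable u hu) χ = ∫ ξ, 𝓕 u ξ * χ ξ := by
  change ∫ x, u x * 𝓕 (χ : E → ℂ) x = _
  rw [integral_mul_fourier_eq hu χ.integrable_volume]

theorem modulate_apply (ψ : 𝓓((⊤ : TopologicalSpace.Opens E), ℝ)) (x η : E) :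
    modulate ψ x η = (ψ η : ℂ) * Complex.exp ((2 * Real.pi * inner ℝ η x : ℝ) * Complex.I) := rfl

/-- If `𝓕 f` is a function, then so are the frequency pieces of `f`. -/
theorem frequencyPiece_eq_fourierInv {f : FourierReservoir E} {h : E → ℂ}
    (hf : ∀ χ, reservoirFourier f χ = ∫ ξ, h ξ * χ ξ)
    (ψ : 𝓓((⊤ : TopologicalSpace.Opens E), ℝ)) :
    frequencyPiece ψ f = 𝓕⁻ (fun ξ => (ψ ξ : ℂ) * h ξ) := by
  ext x
  rw [frequencyPiece, hf, Real.fourierInv_eq']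
  congr 1 with ξ
  rw [modulate_apply, smul_eq_mul]
  ring

/-- Locality: a piece sees the density only where `ψ` is nonzero. This allows distant terms of a sum
to be discarded before norms are estimated. -/
theorem frequencyPiece_congr {f f' : FourierReservoir E} {h h' : E → ℂ}
    (hf : ∀ χ, reservoirFourier f χ = ∫ ξ, h ξ * χ ξ)
    (hf' : ∀ χ, reservoirFourier f' χ = ∫ ξ, h' ξ * χ ξ)
    (ψ : 𝓓((⊤ : TopologicalSpace.Opens E), ℝ)) (hh : ∀ ξ, ψ ξ ≠ 0 → h ξ = h' ξ) :
    frequencyPiece ψ f = frequencyPiece ψ f' := by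
  rw [frequencyPiece_eq_fourierInv hf, frequencyPiece_eq_fourierInv hf']
  congr 1 with ξ
  by_cases hψ : ψ ξ = 0
  · simp [hψ]
  · rw [hh ξ hψ]

theorem integrable_testFunction_mul (ψ : 𝓓((⊤ : TopologicalSpace.Opens E), ℝ)) {h : E → ℂ}
    (hh : Continuous h) : Integrable fun ξ => (ψ ξ : ℂ) * h ξ := by
  refine Continuous.integrable_of_hasCompactSupport
    ((Complex.continuous_ofReal.comp ψ.continuous).mul hh) ?_
  exact (ψ.hasCompactSupport.comp_left (g := ((↑) : ℝ → ℂ)) Complex.ofReal_zero).mul_right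

theorem integrable_testFunction (ψ : 𝓓((⊤ : TopologicalSpace.Opens E), ℝ)) :
    Integrable fun ξ => (ψ ξ : ℂ) := by
  simpa using integrable_testFunction_mul ψ (continuous_const (y := (1 : ℂ)))

theorem frequencyPiece_continuous {f : FourierReservoir E} {h : E → ℂ}
    (hf : ∀ χ, reservoirFourier f χ = ∫ ξ, h ξ * χ ξ) (hh : Continuous h)
    (ψ : 𝓓((⊤ : TopologicalSpace.Opens E), ℝ)) : Continuous (frequencyPiece ψ f) := by
  rw [frequencyPiece_eq_fourierInv hf]
  exact fourierInv_continuous (integrable_testFunction_mul ψ hh)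

/-- A frequency piece of an integrable function is a convolution. -/
theorem frequencyPiece_eq_convolution {u : E → ℂ} (hu : Integrable u)
    (ψ : 𝓓((⊤ : TopologicalSpace.Opens E), ℝ)) (x : E) :
    frequencyPiece ψ (reservoirOfIntegrable u hu) x =
      ∫ y, u y * 𝓕⁻ (fun ξ => (ψ ξ : ℂ)) (x - y) := by
  change ∫ y, u y * 𝓕 (modulate ψ x : E → ℂ) y = _
  congr 1 with y
  congr 1
  rw [Real.fourier_eq', Real.fourierInv_eq']
  congr 1 with ξ
  rw [modulate_apply, smul_eq_mul, smul_eq_mul, mul_left_comm, ← Complex.exp_add, mul_comm]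
  congr 2
  rw [inner_sub_right]
  push_cast
  ring

theorem enorm_frequencyPiece_le {u : E → ℂ} (hu : Integrable u)
    (ψ : 𝓓((⊤ : TopologicalSpace.Opens E), ℝ)) (x : E) :
    ‖frequencyPiece ψ (reservoirOfIntegrable u hu) x‖ₑ ≤
      ∫⁻ y, ‖u y‖ₑ * ‖𝓕⁻ (fun ξ => (ψ ξ : ℂ)) (x - y)‖ₑ := by
  rw [frequencyPiece_eq_convolution]
  refine (enorm_integral_le_lintegral_enorm _).trans (le_of_eq ?_)
  simp only [enorm_mul]

/-- Young's inequality for `L^∞ * L¹`, applied to the convolution formula. -/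
theorem enorm_frequencyPiece_le_of_bound {u : E → ℂ} (hu : Integrable u)
    (ψ : 𝓓((⊤ : TopologicalSpace.Opens E), ℝ)) {B : ℝ≥0∞} (hB : ∀ y, ‖u y‖ₑ ≤ B) (x : E) :
    ‖frequencyPiece ψ (reservoirOfIntegrable u hu) x‖ₑ ≤
      B * eLpNorm (𝓕⁻ (fun ξ => (ψ ξ : ℂ))) 1 volume := by
  refine (enorm_frequencyPiece_le hu ψ x).trans ?_
  have hm : Measurable fun y => ‖𝓕⁻ (fun ξ => (ψ ξ : ℂ)) y‖ₑ :=
    (fourierInv_continuous (integrable_testFunction ψ)).measurable.enorm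
  rw [eLpNorm_one_eq_lintegral_enorm,
    ← lintegral_sub_left_eq_self (fun y => ‖𝓕⁻ (fun ξ => (ψ ξ : ℂ)) y‖ₑ) x,
    ← lintegral_const_mul B (show Measurable fun y => ‖𝓕⁻ (fun ξ => (ψ ξ : ℂ)) (x - y)‖ₑ from
      hm.comp (measurable_id.const_sub x))]
  exact lintegral_mono fun y => mul_le_mul_left (hB y) _

/-- Young's inequality for `L¹ * L¹`, by Tonelli. -/
theorem lintegral_frequencyPiece_le {u : E → ℂ} (hu : Integrable u)
    (ψ : 𝓓((⊤ : TopologicalSpace.Opens E), ℝ)) :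
    ∫⁻ x, ‖frequencyPiece ψ (reservoirOfIntegrable u hu) x‖ₑ ≤
      (∫⁻ y, ‖u y‖ₑ) * eLpNorm (𝓕⁻ (fun ξ => (ψ ξ : ℂ))) 1 volume := by
  have hm : Measurable fun y => ‖𝓕⁻ (fun ξ => (ψ ξ : ℂ)) y‖ₑ :=
    (fourierInv_continuous (integrable_testFunction ψ)).measurable.enorm
  calc _ ≤ ∫⁻ x, ∫⁻ y, ‖u y‖ₑ * ‖𝓕⁻ (fun ξ => (ψ ξ : ℂ)) (x - y)‖ₑ :=
        lintegral_mono fun x => enorm_frequencyPiece_le hu ψ x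
    _ = ∫⁻ y, ∫⁻ x, ‖u y‖ₑ * ‖𝓕⁻ (fun ξ => (ψ ξ : ℂ)) (x - y)‖ₑ := by
        refine lintegral_lintegral_swap ?_
        have h1 : AEMeasurable (fun z : E × E => ‖u z.2‖ₑ) (volume.prod volume) :=
          hu.1.comp_snd.enorm
        have h2 : Measurable fun z : E × E => ‖𝓕⁻ (fun ξ => (ψ ξ : ℂ)) (z.1 - z.2)‖ₑ :=
          hm.comp (measurable_fst.sub measurable_snd)
        exact h1.mul h2.aemeasurable
    _ = ∫⁻ y, ‖u y‖ₑ * eLpNorm (𝓕⁻ (fun ξ => (ψ ξ : ℂ))) 1 volume := by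
        refine lintegral_congr fun y => ?_
        rw [lintegral_const_mul _
            (show Measurable fun x => ‖𝓕⁻ (fun ξ => (ψ ξ : ℂ)) (x - y)‖ₑ from
              hm.comp (measurable_id.sub_const y)),
          lintegral_sub_right_eq_self (fun x => ‖𝓕⁻ (fun ξ => (ψ ξ : ℂ)) x‖ₑ) y,
          eLpNorm_one_eq_lintegral_enorm]
    _ = _ := lintegral_mul_const'' _ hu.1.enorm

/-- Interpolation between `L¹` and `L^∞`. -/
theorem eLpNorm_le_of_bounds {w : E → ℂ} {p : ℝ} (hp : 1 ≤ p) {A : ℝ≥0∞} (hA : A ≠ ⊤)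
    (h1 : ∫⁻ x, ‖w x‖ₑ ≤ A) (h2 : ∀ x, ‖w x‖ₑ ≤ A) :
    eLpNorm w (ENNReal.ofReal p) volume ≤ A := by
  have hp0 : 0 < p := by linarith
  rw [eLpNorm_eq_lintegral_rpow_enorm_toReal (by simpa using hp0) ENNReal.ofReal_ne_top,
    ENNReal.toReal_ofReal hp0.le, one_div, ENNReal.rpow_inv_le_iff hp0]
  have hpp : ∀ y : ℝ≥0∞, y ^ p = y ^ (p - 1) * y := by
    intro y
    conv_lhs => rw [show p = (p - 1) + 1 by ring,
      ENNReal.rpow_add_of_nonneg _ _ (by linarith) zero_le_one, ENNReal.rpow_one]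
  calc ∫⁻ x, ‖w x‖ₑ ^ p ≤ ∫⁻ x, A ^ (p - 1) * ‖w x‖ₑ := by
        refine lintegral_mono fun x => ?_
        rw [hpp]
        exact mul_le_mul_left (ENNReal.rpow_le_rpow (h2 x) (by linarith)) _
    _ = A ^ (p - 1) * ∫⁻ x, ‖w x‖ₑ :=
        lintegral_const_mul' _ _ (ENNReal.rpow_ne_top_of_nonneg (by linarith) hA)
    _ ≤ A ^ (p - 1) * A := by gcongr
    _ = A ^ p := (hpp A).symm

/-- With `S = ∑ b i`, each `b i ^ q` is at most `S ^ (q - 1) * b i`; summation gives `S ^ q`. -/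
theorem tsum_rpow_le {ι : Type*} (b : ι → ℝ≥0∞) {q : ℝ} (hq : 1 ≤ q) :
    (∑' i, b i ^ q) ^ (1 / q) ≤ ∑' i, b i := by
  have hq0 : 0 < q := by linarith
  rw [one_div, ENNReal.rpow_inv_le_iff hq0]
  have hpp : ∀ y : ℝ≥0∞, y ^ q = y ^ (q - 1) * y := by
    intro y
    conv_lhs => rw [show q = (q - 1) + 1 by ring,
      ENNReal.rpow_add_of_nonneg _ _ (by linarith) zero_le_one, ENNReal.rpow_one]
  rw [hpp (∑' i, b i), ← ENNReal.tsum_mul_left]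
  refine ENNReal.tsum_le_tsum fun i => ?_
  rw [hpp]
  exact mul_le_mul_left (ENNReal.rpow_le_rpow (ENNReal.le_tsum i) (by linarith)) _

/-- Sums of families of continuous functions that are summable in `L¹` and uniformly. -/
theorem summable_family {ι : Type*} [Countable ι] {v : ι → E → ℂ} {a : ι → ℝ}
    (ha : Summable a) (hc : ∀ i, Continuous (v i)) (hi : ∀ i, Integrable (v i))
    (hb : ∀ i x, ‖v i x‖ ≤ a i) (h1 : ∀ i, ∫ x, ‖v i x‖ ≤ a i) :
    Continuous (fun x => ∑' i, v i x) ∧ Integrable (fun x => ∑' i, v i x) ∧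
      (∀ x, ‖∑' i, v i x‖ ≤ ∑' i, a i) ∧ (∫ x, ‖∑' i, v i x‖) ≤ ∑' i, a i ∧
      ∀ ξ, HasSum (fun i => 𝓕 (v i) ξ) (𝓕 (fun x => ∑' i, v i x) ξ) := by
  have hs : ∀ x, Summable fun i => ‖v i x‖ := fun x =>
    Summable.of_nonneg_of_le (fun _ => norm_nonneg _) (fun i => hb i x) ha
  have hs1 : Summable fun i => ∫ x, ‖v i x‖ :=
    Summable.of_nonneg_of_le (fun _ => integral_nonneg fun _ => norm_nonneg _) h1 ha
  have hcont := continuous_tsum hc ha hb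
  have hnorm : Integrable (fun x => ∑' i, ‖v i x‖) := by
    refine ⟨(continuous_tsum (fun i => (hc i).norm) ha
      (fun i x => by simpa using hb i x)).aestronglyMeasurable, ?_⟩
    rw [hasFiniteIntegral_iff_enorm]
    calc ∫⁻ x, ‖∑' i, ‖v i x‖‖ₑ = ∫⁻ x, ∑' i, ‖v i x‖ₑ := by
          refine lintegral_congr fun x => ?_
          rw [Real.enorm_of_nonneg (tsum_nonneg fun _ => norm_nonneg _),
            ENNReal.ofReal_tsum_of_nonneg (fun _ => norm_nonneg _) (hs x)]
          simp
      _ = ∑' i, ∫⁻ x, ‖v i x‖ₑ := lintegral_tsum fun i => (hi i).1.enorm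
      _ = ∑' i, ENNReal.ofReal (∫ x, ‖v i x‖) := by
          congr 1 with i
          rw [ofReal_integral_norm_eq_lintegral_enorm (hi i)]
      _ < ⊤ := by
          rw [← ENNReal.ofReal_tsum_of_nonneg
            (fun _ => integral_nonneg fun _ => norm_nonneg _) hs1]
          exact ENNReal.ofReal_lt_top
  have hint : Integrable (fun x => ∑' i, v i x) :=
    hnorm.mono' hcont.aestronglyMeasurable
      (Filter.Eventually.of_forall fun x => norm_tsum_le_tsum_norm (hs x))
  refine ⟨hcont, hint, fun x => ?_, ?_, fun ξ => ?_⟩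
  · exact (norm_tsum_le_tsum_norm (hs x)).trans ((hs x).tsum_le_tsum (fun i => hb i x) ha)
  · calc ∫ x, ‖∑' i, v i x‖ ≤ ∫ x, ∑' i, ‖v i x‖ :=
          integral_mono hint.norm hnorm fun x => norm_tsum_le_tsum_norm (hs x)
      _ = ∑' i, ∫ x, ‖v i x‖ :=
          (integral_tsum_of_summable_integral_norm (fun i => (hi i).norm) (by simpa using hs1)).symm
      _ ≤ ∑' i, a i := hs1.tsum_le_tsum h1 ha
  · have h := hasSum_integral_of_summable_integral_norm (μ := volume)
      (F := fun i x => Real.fourierChar (-inner ℝ x ξ) • v i x)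
      (fun i => (Real.fourierIntegral_convergent_iff ξ).2 (hi i)) (by simpa using hs1)
    simp only [Real.fourier_eq]
    convert! h using 2
    ext x
    simp only [Circle.smul_def, smul_eq_mul, tsum_mul_left]

/-- A continuous integrable function with vanishing Fourier transform vanishes. -/
theorem eq_zero_of_fourier_eq_zero {u : E → ℂ} (hu : Integrable u) (hc : Continuous u)
    (h : ∀ ξ, 𝓕 u ξ = 0) (x : E) : u x = 0 := by
  have h0 : 𝓕 u = 0 := funext h
  have := congrFun (hc.fourierInv_fourier_eq hu (by rw [h0]; exact integrable_zero _ _ _)) x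
  rw [← this, h0, Real.fourierInv_eq]
  simp

theorem eq_zero_of_fourierInv_eq_zero {u : E → ℂ} (hu : Integrable u) (hc : Continuous u)
    (h : ∀ ξ, 𝓕⁻ u ξ = 0) (x : E) : u x = 0 := by
  refine eq_zero_of_fourier_eq_zero hu hc (fun ξ => ?_) x
  rw [← neg_neg ξ, ← Real.fourierInv_eq_fourier_neg]
  exact h _

/-- A continuous function orthogonal to all test functions vanishes. -/
theorem eq_of_integral_testFunction_eq {u v : E → ℂ} (hu : Continuous u) (hv : Continuous v)
    (h : ∀ χ : 𝓓((⊤ : TopologicalSpace.Opens E), ℂ), ∫ x, u x * χ x = ∫ x, v x * χ x) :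
    u = v := by
  refine Continuous.ae_eq_iff_eq volume hu hv |>.1 ?_
  refine ae_eq_of_integral_contDiff_smul_eq hu.locallyIntegrable hv.locallyIntegrable ?_
  intro g hg hgc
  have : ∫ x, u x * (g x : ℂ) = ∫ x, v x * (g x : ℂ) :=
    h ⟨fun x => (g x : ℂ), Complex.ofRealCLM.contDiff.comp hg,
      hgc.comp_left Complex.ofReal_zero, fun _ _ => trivial⟩
  simpa [mul_comm] using this

end Reservoir

/-! ### Distributions tested against modulated test functions -/

/-- A linear functional that is bounded by the norm of a linear map factors through this map. -/
theorem exists_clm_comp_eq {V Y : Type*} [AddCommGroup V] [Module ℂ V] [NormedAddCommGroup Y]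
    [NormedSpace ℂ Y] (T : V →ₗ[ℂ] ℂ) (J : V →ₗ[ℂ] Y) (C : ℝ) (h : ∀ v, ‖T v‖ ≤ C * ‖J v‖) :
    ∃ l : Y →L[ℂ] ℂ, ∀ v, l (J v) = T v := by
  obtain ⟨r, hr⟩ := J.rangeRestrict.exists_rightInverse_of_surjective J.range_rangeRestrict
  have hJr : ∀ y : LinearMap.range J, J (r y) = y := fun y =>
    congrArg Subtype.val (LinearMap.congr_fun hr y)
  let f : StrongDual ℂ (LinearMap.range J) := (T ∘ₗ r).mkContinuous C fun y => by
    refine (h (r y)).trans (le_of_eq ?_)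
    rw [hJr]
    rfl
  obtain ⟨g, hg, -⟩ := exists_extension_norm_eq (LinearMap.range J) f
  refine ⟨g, fun v => ?_⟩
  have h1 := hg ⟨J v, v, rfl⟩
  have h2 : f ⟨J v, v, rfl⟩ = T (r ⟨J v, v, rfl⟩) := rfl
  -- The section `r` need not return `v` itself, but the bound forces `T` to vanish on the kernel of
  -- `J`, so `T` does not see the difference.
  have h3 := h (r ⟨J v, v, rfl⟩ - v)
  rw [map_sub J, hJr, sub_self, norm_zero, mul_zero, map_sub] at h3
  rw [h1, h2]
  exact sub_eq_zero.1 (norm_le_zero_iff.1 h3)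

section OneDim

variable {K : TopologicalSpace.Compacts ℝ}

/-- The iterated derivative as a linear map into bounded continuous functions. -/
def iteratedDerivBCF (K : TopologicalSpace.Compacts ℝ) (i : ℕ) :
    𝓓_{K}(ℝ, ℂ) →ₗ[ℂ] BoundedContinuousFunction ℝ ℂ where
  toFun φ := BoundedContinuousFunction.ofNormedAddCommGroup (iteratedDeriv i φ)
    (φ.contDiff.continuous_iteratedDeriv i (by exact_mod_cast le_top))
    (ContDiffMapSupportedIn.seminorm ℂ ℝ ℂ ⊤ K i φ) fun x => by
      rw [← norm_iteratedFDeriv_eq_norm_iteratedDeriv]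
      exact ContDiffMapSupportedIn.norm_iteratedFDeriv_apply_le_seminorm_top ℂ
  map_add' φ χ := by
    ext x
    have h : ∀ φ : 𝓓_{K}(ℝ, ℂ), ContDiffAt ℝ i φ x := fun φ =>
      (φ.contDiff.of_le (by exact_mod_cast le_top)).contDiffAt
    exact iteratedDeriv_add (h φ) (h χ)
  map_smul' c φ := by
    ext x
    have h : ∀ φ : 𝓓_{K}(ℝ, ℂ), ContDiffAt ℝ i φ x := fun φ =>
      (φ.contDiff.of_le (by exact_mod_cast le_top)).contDiffAt
    exact iteratedDeriv_const_smul (h φ) c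

theorem iteratedDerivBCF_apply (i : ℕ) (φ : 𝓓_{K}(ℝ, ℂ)) (x : ℝ) :
    iteratedDerivBCF K i φ x = iteratedDeriv i φ x := rfl

theorem seminorm_le_norm_iteratedDerivBCF (i : ℕ) (φ : 𝓓_{K}(ℝ, ℂ)) :
    ContDiffMapSupportedIn.seminorm ℂ ℝ ℂ ⊤ K i φ ≤ ‖iteratedDerivBCF K i φ‖ := by
  refine (ContDiffMapSupportedIn.seminorm_top_le_iff ℂ (norm_nonneg _) i φ).2 fun x _ => ?_
  rw [norm_iteratedFDeriv_eq_norm_iteratedDeriv]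
  exact (iteratedDerivBCF K i φ).norm_coe_le_norm x

/-- On test functions supported in a fixed compact set, a distribution factors through finitely
many derivatives. -/
theorem exists_clm_iteratedDerivBCF (T : 𝓓((⊤ : TopologicalSpace.Opens ℝ), ℂ) →L[ℂ] ℂ)
    (K : TopologicalSpace.Compacts ℝ) :
    ∃ (s : Finset ℕ) (l : (s → BoundedContinuousFunction ℝ ℂ) →L[ℂ] ℂ),
      ∀ φ : 𝓓_{K}(ℝ, ℂ), l (fun i => iteratedDerivBCF K i φ) =
        T (TestFunction.ofSupportedIn (fun _ _ => trivial) φ) := by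
  let S : 𝓓_{K}(ℝ, ℂ) →L[ℂ] ℂ := T.comp (TestFunction.ofSupportedInCLM ℂ (fun _ _ => trivial))
  -- Continuity on the test functions supported in `K` means control by finitely many derivatives,
  -- i.e. finite order on `K`.
  obtain ⟨s, C, -, hC⟩ := Seminorm.bound_of_continuous
    (ContDiffMapSupportedIn.withSeminorms ℂ ℝ ℂ ⊤ K)
    ((normSeminorm ℂ ℂ).comp S.toLinearMap) (S.continuous.norm)
  obtain ⟨l, hl⟩ := exists_clm_comp_eq S.toLinearMap
    (LinearMap.pi fun i : s => iteratedDerivBCF K (i : ℕ)) (C : ℝ) (fun φ => by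
      refine (hC φ).trans ?_
      rw [smul_apply, NNReal.smul_def, smul_eq_mul]
      refine mul_le_mul_of_nonneg_left ?_ C.2
      refine Seminorm.finset_sup_apply_le (norm_nonneg _) fun i hi => ?_
      refine (seminorm_le_norm_iteratedDerivBCF i φ).trans ?_
      exact norm_le_pi_norm (LinearMap.pi (fun i : s => iteratedDerivBCF K (i : ℕ)) φ) ⟨i, hi⟩)
  exact ⟨s, l, hl⟩

/-- The character `η ↦ exp(2πiηx)`. -/
def charBCF (x : ℝ) : BoundedContinuousFunction ℝ ℂ :=
  BoundedContinuousFunction.ofNormedAddCommGroup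
    (fun η => Complex.exp ((2 * Real.pi * inner ℝ η x : ℝ) * Complex.I)) (by fun_prop) 1
    fun η => (Complex.norm_exp_ofReal_mul_I _).le

theorem norm_charBCF_le (x : ℝ) : ‖charBCF x‖ ≤ 1 :=
  BoundedContinuousFunction.norm_ofNormedAddCommGroup_le _ zero_le_one _

theorem charBCF_apply (x η : ℝ) :
    charBCF x η = Complex.exp ((2 * Real.pi * inner ℝ η x : ℝ) * Complex.I) := rfl

/-- In the sup norm the characters do not depend continuously on `x`. After multiplication by a
compactly supported `a` they are Lipschitz, with constant `2π sup |η a(η)|`. This provides the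
measurability needed for Bochner integrals. -/
theorem continuous_mul_charBCF (a : BoundedContinuousFunction ℝ ℂ) (ha : HasCompactSupport a) :
    Continuous fun x => a * charBCF x := by
  obtain ⟨C, hC⟩ := ((a.continuous.norm.mul continuous_norm).bounded_above_of_compact_support
    (f := fun η : ℝ => ‖a η‖ * ‖η‖) ha.norm.mul_right)
  have hC0 : 0 ≤ C := (norm_nonneg _).trans (hC 0)
  refine LipschitzWith.continuous (K := (2 * Real.pi * C).toNNReal)
    (LipschitzWith.of_dist_le_mul fun x y => ?_)
  rw [Real.coe_toNNReal _ (by positivity)]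
  refine (BoundedContinuousFunction.dist_le (by positivity)).2 fun η => ?_
  rw [dist_eq_norm, BoundedContinuousFunction.mul_apply, BoundedContinuousFunction.mul_apply,
    ← mul_sub, norm_mul]
  have h1 : ‖charBCF x η - charBCF y η‖ ≤ 2 * Real.pi * (‖η‖ * dist x y) := by
    have h2 : charBCF x η - charBCF y η = charBCF y η *
        (Complex.exp (Complex.I * (2 * Real.pi * (η * (x - y)) : ℝ)) - 1) := by
      rw [mul_sub, mul_one, charBCF_apply, charBCF_apply, ← Complex.exp_add]
      congr 2
      simp only [RCLike.inner_apply, conj_trivial]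
      push_cast
      ring
    rw [h2, norm_mul, charBCF_apply, Complex.norm_exp_ofReal_mul_I, one_mul]
    refine Real.norm_exp_I_mul_ofReal_sub_one_le.trans (le_of_eq ?_)
    rw [norm_mul, Real.norm_of_nonneg (by positivity : (0 : ℝ) ≤ 2 * Real.pi), norm_mul,
      Real.dist_eq, Real.norm_eq_abs (x - y)]
  have h3 := hC η
  rw [norm_mul, norm_norm, norm_norm] at h3
  calc ‖a η‖ * ‖charBCF x η - charBCF y η‖ ≤ ‖a η‖ * (2 * Real.pi * (‖η‖ * dist x y)) := by gcongr
    _ = 2 * Real.pi * (‖a η‖ * ‖η‖) * dist x y := by ring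
    _ ≤ 2 * Real.pi * C * dist x y := by gcongr

theorem iteratedDeriv_charBCF (l : ℕ) (x η : ℝ) :
    iteratedDeriv l (charBCF x) η = (2 * Real.pi * Complex.I * x) ^ l * charBCF x η := by
  induction l generalizing η with
  | zero => simp
  | succ l ih =>
    rw [iteratedDeriv_succ, show iteratedDeriv l (charBCF x) = fun η =>
      (2 * Real.pi * Complex.I * x) ^ l * charBCF x η from funext ih]
    have h : HasDerivAt (fun η : ℝ => charBCF x η)
        (charBCF x η * (2 * Real.pi * Complex.I * x)) η := by
      have h0 : HasDerivAt (fun η : ℝ => (2 * Real.pi * Complex.I * x) * (η : ℂ))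
          ((2 * Real.pi * Complex.I * x) * 1) η :=
        (HasDerivAt.ofReal_comp (hasDerivAt_id η)).const_mul _
      have h1 := h0.cexp
      rw [mul_one] at h1
      have h2 : ∀ η : ℝ, charBCF x η = Complex.exp ((2 * Real.pi * Complex.I * x) * (η : ℂ)) := by
        intro η
        rw [charBCF_apply]
        congr 1
        simp only [RCLike.inner_apply, conj_trivial]
        push_cast
        ring
      simp only [h2]
      exact h1
    rw [(h.const_mul _).deriv]
    ring

theorem contDiff_charBCF (x : ℝ) : ContDiff ℝ ∞ (charBCF x) := by
  change ContDiff ℝ ∞ fun η : ℝ => Complex.exp ((2 * Real.pi * inner ℝ η x : ℝ) * Complex.I)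
  refine Complex.contDiff_exp.comp (ContDiff.mul ?_ contDiff_const)
  refine Complex.ofRealCLM.contDiff.comp (contDiff_const.mul ?_)
  exact contDiff_id.inner ℝ contDiff_const

/-- The product of a real and a complex test function. -/
def TestFunction.realMul (ψ : 𝓓((⊤ : TopologicalSpace.Opens ℝ), ℝ))
    (χ : 𝓓((⊤ : TopologicalSpace.Opens ℝ), ℂ)) : 𝓓((⊤ : TopologicalSpace.Opens ℝ), ℂ) where
  toFun η := (ψ η : ℂ) * χ η
  contDiff' := (Complex.ofRealCLM.contDiff.comp ψ.contDiff).mul χ.contDiff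
  hasCompactSupport' := χ.hasCompactSupport.mul_left
  tsupport_subset' := fun _ _ => trivial

theorem TestFunction.realMul_apply (ψ : 𝓓((⊤ : TopologicalSpace.Opens ℝ), ℝ))
    (χ : 𝓓((⊤ : TopologicalSpace.Opens ℝ), ℂ)) (η : ℝ) :
    TestFunction.realMul ψ χ η = (ψ η : ℂ) * χ η := rfl

/-- Pairing the function `x ↦ ⟨T, ψ exp(2πi⟨·, x⟩)⟩` with the Fourier transform of a test
function. -/
theorem integral_modulate_mul_fourier (T : 𝓓((⊤ : TopologicalSpace.Opens ℝ), ℂ) →L[ℂ] ℂ)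
    (ψ : 𝓓((⊤ : TopologicalSpace.Opens ℝ), ℝ)) (χ : 𝓓((⊤ : TopologicalSpace.Opens ℝ), ℂ)) :
    ∫ x, T (modulate ψ x) * 𝓕 (χ : ℝ → ℂ) x = T (TestFunction.realMul ψ χ) := by
  -- All functions involved are supported in `K`, where `T` factors through a continuous functional
  -- `l` on a finite product of Banach spaces. There it commutes with Bochner integrals, so the
  -- formula is proved for each derivative separately.
  let K : TopologicalSpace.Compacts ℝ := ⟨tsupport ψ, ψ.hasCompactSupport⟩
  obtain ⟨s, l, hl⟩ := exists_clm_iteratedDerivBCF T K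
  let ψc : ℝ → ℂ := fun η => (ψ η : ℂ)
  have hψc : ContDiff ℝ ∞ ψc := Complex.ofRealCLM.contDiff.comp ψ.contDiff
  have hψs : HasCompactSupport ψc := ψ.hasCompactSupport.comp_left Complex.ofReal_zero
  have hsupp : ∀ f : ℝ → ℂ, Function.support (fun η => ψc η * f η) ⊆ K := by
    intro f η hη
    refine subset_tsupport _ fun h => hη ?_
    simp [ψc, h]
  let m : ℝ → 𝓓_{K}(ℝ, ℂ) := fun x => ContDiffMapSupportedIn.of_support_subset
    (hψc.mul (contDiff_charBCF x)) (hsupp _)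
  let w : 𝓓_{K}(ℝ, ℂ) := ContDiffMapSupportedIn.of_support_subset (hψc.mul χ.contDiff) (hsupp _)
  have hTm : ∀ x, T (modulate ψ x) = l (fun i => iteratedDerivBCF K i (m x)) := fun x => (hl (m x)).symm
  have hTw : T (TestFunction.realMul ψ χ) = l (fun i => iteratedDerivBCF K i w) := (hl w).symm
  -- bounded continuous versions of the derivatives of `ψ`
  let a : ℕ → BoundedContinuousFunction ℝ ℂ := fun i =>
    iteratedDerivBCF K i (ContDiffMapSupportedIn.of_support_subset hψc
      (by simpa using hsupp (fun _ => 1)))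
  have ha : ∀ i η, a i η = iteratedDeriv i ψc η := fun _ _ => rfl
  have hcs : ∀ i, HasCompactSupport (a i) := fun i => by
    refine HasCompactSupport.intro K.isCompact fun η hη => ?_
    rw [ha, iteratedDeriv_eq_iteratedFDeriv]
    have := ContDiffMapSupportedIn.iteratedFDeriv_zero_on_compl
      (ContDiffMapSupportedIn.of_support_subset hψc (by simpa using hsupp (fun _ => 1)) :
        𝓓_{K}(ℝ, ℂ)) (i := i) hη
    change iteratedFDeriv ℝ i ψc η = 0 at this
    rw [this]
    rfl
  -- derivatives of `χ`
  have hχi : ∀ k, Integrable (iteratedDeriv k χ) := fun k => by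
    refine Continuous.integrable_of_hasCompactSupport
      (χ.contDiff.continuous_iteratedDeriv k (by exact_mod_cast le_top)) ?_
    refine HasCompactSupport.intro χ.hasCompactSupport fun η hη => ?_
    rw [iteratedDeriv_eq_iteratedFDeriv]
    have : iteratedFDeriv ℝ k χ η = 0 := by
      by_contra h
      exact hη (support_iteratedFDeriv_subset k h)
    rw [this]
    rfl
  let v : ℕ → ℝ → ℂ := fun k => 𝓕 (iteratedDeriv k χ)
  have hv : ∀ k x, v k x = (2 * Real.pi * Complex.I * x) ^ k * 𝓕 (χ : ℝ → ℂ) x := fun k x => by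
    have := congrFun (Real.fourier_iteratedDeriv (N := ⊤) (n := k) χ.contDiff
      (fun n _ => hχi n) le_top) x
    rw [smul_eq_mul] at this
    exact this
  have hvc : ∀ k, Continuous (v k) := fun k => fourier_continuous (hχi k)
  have hvi : ∀ k, Integrable (v k) := fun k => by
    let S := fourierTest ℝ χ
    have h1 : Integrable fun x : ℝ => ‖x‖ ^ k * ‖S x‖ := S.integrable_pow_mul volume k
    refine (h1.const_mul ((2 * Real.pi) ^ k)).mono' (hvc k).aestronglyMeasurable
      (Filter.Eventually.of_forall fun x => ?_)
    rw [hv, norm_mul, norm_pow, norm_mul, norm_mul, norm_mul, Complex.norm_I, Complex.norm_real,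
      Complex.norm_real, Real.norm_of_nonneg Real.pi_pos.le, mul_one, mul_pow, mul_assoc]
    simp only [RCLike.norm_ofNat]
    exact le_of_eq rfl
  have hinv : ∀ k η, ∫ x, v k x * charBCF x η = iteratedDeriv k χ η := fun k η => by
    have := congrFun (Continuous.fourierInv_fourier_eq
      (χ.contDiff.continuous_iteratedDeriv k (by exact_mod_cast le_top)) (hχi k) (hvi k)) η
    rw [← this, Real.fourierInv_eq']
    congr 1 with x
    rw [charBCF_apply, smul_eq_mul, mul_comm, real_inner_comm]
  -- the Leibniz formula
  have hterm : ∀ k j, Integrable fun x => v k x • (a j * charBCF x) := fun k j => by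
    refine ((hvi k).norm.mul_const ‖a j‖).mono'
      ((hvc k).smul (continuous_mul_charBCF _ (hcs j))).aestronglyMeasurable
      (Filter.Eventually.of_forall fun x => ?_)
    rw [norm_smul]
    refine mul_le_mul_of_nonneg_left ((norm_mul_le _ _).trans ?_) (norm_nonneg _)
    exact mul_le_of_le_one_right (norm_nonneg _) (norm_charBCF_le x)
  -- Differentiating the character produces powers of `2πix`; multiplied by `𝓕 χ` they become the
  -- transforms `v (i - j)` of derivatives of `χ`, which are integrable.
  have hF : ∀ (i : ℕ) x, 𝓕 (χ : ℝ → ℂ) x • iteratedDerivBCF K i (m x) =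
      ∑ j ∈ Finset.range (i + 1), (i.choose j : ℂ) • v (i - j) x • (a j * charBCF x) := by
    intro i x
    ext η
    rw [BoundedContinuousFunction.coe_sum, Finset.sum_apply]
    simp only [BoundedContinuousFunction.smul_apply, BoundedContinuousFunction.mul_apply,
      smul_eq_mul, iteratedDerivBCF_apply]
    change _ * iteratedDeriv i (ψc * (charBCF x : ℝ → ℂ)) η = _
    rw [iteratedDeriv_mul (hψc.of_le (by exact_mod_cast le_top)).contDiffAt
      ((contDiff_charBCF x).of_le (by exact_mod_cast le_top)).contDiffAt, Finset.mul_sum]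
    refine Finset.sum_congr rfl fun j _ => ?_
    rw [iteratedDeriv_charBCF, hv, ha]
    ring
  have hFi : ∀ i : ℕ, Integrable fun x => 𝓕 (χ : ℝ → ℂ) x • iteratedDerivBCF K i (m x) := by
    intro i
    simp only [hF]
    exact integrable_finsetSum _ fun j _ => (hterm (i - j) j).smul (i.choose j : ℂ)
  have hint : ∀ i : ℕ, ∫ x, 𝓕 (χ : ℝ → ℂ) x • iteratedDerivBCF K i (m x) =
      iteratedDerivBCF K i w := by
    intro i
    ext η
    -- The Banach-space integral is identified pointwise: evaluation at `η` passes inside, Fourier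
    -- inversion recovers the derivatives of `χ`, and Leibniz is applied backwards.
    have h1 := ContinuousLinearMap.integral_comp_comm
      (BoundedContinuousFunction.evalCLM ℂ η : BoundedContinuousFunction ℝ ℂ →L[ℂ] ℂ) (hFi i)
    change ∫ x, (𝓕 (χ : ℝ → ℂ) x • iteratedDerivBCF K i (m x)) η =
      (∫ x, 𝓕 (χ : ℝ → ℂ) x • iteratedDerivBCF K i (m x)) η at h1
    rw [← h1]
    have h2 : ∀ k j, Integrable fun x => v k x * (a j η * charBCF x η) := fun k j =>
      ContinuousLinearMap.integrable_comp
        (BoundedContinuousFunction.evalCLM ℂ η : BoundedContinuousFunction ℝ ℂ →L[ℂ] ℂ) (hterm k j)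
    calc ∫ x, (𝓕 (χ : ℝ → ℂ) x • iteratedDerivBCF K i (m x)) η
        = ∫ x, ∑ j ∈ Finset.range (i + 1),
            (i.choose j : ℂ) * (v (i - j) x * (a j η * charBCF x η)) := by
          congr 1 with x
          rw [hF, BoundedContinuousFunction.coe_sum, Finset.sum_apply]
          rfl
      _ = ∑ j ∈ Finset.range (i + 1), (i.choose j : ℂ) * (a j η * iteratedDeriv (i - j) χ η) := by
          rw [integral_finsetSum _ fun j _ => (h2 _ _).const_mul _]
          refine Finset.sum_congr rfl fun j _ => ?_
          rw [integral_const_mul, ← hinv, ← integral_const_mul (a j η)]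
          congr 1
          refine integral_congr_ae (Filter.Eventually.of_forall fun x => ?_)
          change v (i - j) x * (a j η * charBCF x η) = a j η * (v (i - j) x * charBCF x η)
          ring
      _ = iteratedDeriv i (ψc * (χ : ℝ → ℂ)) η := by
          rw [iteratedDeriv_mul (hψc.of_le (by exact_mod_cast le_top)).contDiffAt
            (χ.contDiff.of_le (by exact_mod_cast le_top)).contDiffAt]
          refine Finset.sum_congr rfl fun j _ => ?_
          rw [ha]
          ring
  have hpi : Integrable fun x => 𝓕 (χ : ℝ → ℂ) x •
      (fun i : s => iteratedDerivBCF K (i : ℕ) (m x)) :=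
    Integrable.of_eval fun i => hFi i
  have hpint : ∫ x, 𝓕 (χ : ℝ → ℂ) x • (fun i : s => iteratedDerivBCF K (i : ℕ) (m x)) =
      fun i : s => iteratedDerivBCF K (i : ℕ) w := by
    funext i
    exact (eval_integral (f := fun x (i : s) => 𝓕 (χ : ℝ → ℂ) x • iteratedDerivBCF K (i : ℕ) (m x))
      (fun i => hFi i) i).trans (hint i)
  rw [hTw, ← hpint, ← ContinuousLinearMap.integral_comp_comm l hpi]
  congr 1 with x
  rw [map_smul, hTm, smul_eq_mul, mul_comm]

end OneDim

/-! ### Elements of the Feichtinger algebra have continuous Fourier transforms -/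

theorem IsAdmissibleCovering.locallyFinite {E ι : Type*} [TopologicalSpace E] {P : ι → Set E}
    (hP : IsAdmissibleCovering P) (ho : ∀ i, IsOpen (P i)) : LocallyFinite P := by
  obtain ⟨M, hM⟩ := hP.bounded
  intro x
  obtain ⟨i, hi⟩ := mem_iUnion.1 (hP.covers.symm ▸ mem_univ x : x ∈ ⋃ i, P i)
  refine ⟨P i, (ho i).mem_nhds hi, (finite_of_encard_le_coe (hM i)).subset fun j hj => ?_⟩
  change (P i ∩ P j).Nonempty
  rwa [inter_comm]

theorem IsAdmissibleCovering.countable {E ι : Type*} [TopologicalSpace E] [SigmaCompactSpace E]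
    {P : ι → Set E} (hP : IsAdmissibleCovering P) (ho : ∀ i, IsOpen (P i)) : Countable ι :=
  countable_univ_iff.1 ((hP.locallyFinite ho).countable_univ hP.nonempty)

theorem IsBAPU.hasSum_one_complex {E ι : Type*} [NormedAddCommGroup E] [InnerProductSpace ℝ E]
    [FiniteDimensional ℝ E] [MeasurableSpace E] [BorelSpace E] {P : ι → Set E}
    {φ : ι → 𝓓((⊤ : TopologicalSpace.Opens E), ℝ)} (hφ : IsBAPU P φ) (x : E) :
    HasSum (fun i => (φ i x : ℂ)) 1 := by
  simpa using Complex.ofRealCLM.hasSum (hφ.hasSum_one x)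

section

variable {ι : Type*} {P : ι → Set ℝ} {φ : ι → 𝓓((⊤ : TopologicalSpace.Opens ℝ), ℝ)}

/-- In the sense of distributions, the Fourier transform of the piece really is `ψ · 𝓕 f`. -/
theorem integral_fourier_frequencyPiece_mul (f : FourierReservoir ℝ)
    (ψ : 𝓓((⊤ : TopologicalSpace.Opens ℝ), ℝ)) (hi : Integrable (frequencyPiece ψ f))
    (χ : 𝓓((⊤ : TopologicalSpace.Opens ℝ), ℂ)) :
    ∫ ξ, 𝓕 (frequencyPiece ψ f) ξ * χ ξ =
      reservoirFourier f (TestFunction.realMul ψ χ) := by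
  rw [← integral_mul_fourier_eq hi χ.integrable_volume]
  exact integral_modulate_mul_fourier _ _ _

/-- An element whose frequency pieces are absolutely summable in `L¹` has a continuous Fourier
transform. -/
theorem exists_fourier_density (hP : IsAdmissibleCovering P) (ho : ∀ i, IsOpen (P i))
    (hφ : IsBAPU P φ) (f : FourierReservoir ℝ) (hi : ∀ i, Integrable (frequencyPiece (φ i) f))
    (hs : Summable fun i => ∫ x, ‖frequencyPiece (φ i) f x‖) :
    ∃ h : ℝ → ℂ, Continuous h ∧ (∀ χ, reservoirFourier f χ = ∫ ξ, h ξ * χ ξ) ∧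
      ∀ i ξ, 𝓕 (frequencyPiece (φ i) f) ξ = (φ i ξ : ℂ) * h ξ := by
  classical
  have := hP.countable ho
  -- The density will be the sum of the transforms of the pieces. It converges uniformly, because
  -- `|𝓕 u| ≤ ‖u‖₁`.
  let v : ι → ℝ → ℂ := fun i => 𝓕 (frequencyPiece (φ i) f)
  have hv : ∀ i, Continuous (v i) := fun i => fourier_continuous (hi i)
  have hvb : ∀ i ξ, ‖v i ξ‖ ≤ ∫ x, ‖frequencyPiece (φ i) f x‖ := fun i ξ => norm_fourier_le ξ
  have hh : Continuous fun ξ => ∑' i, v i ξ := continuous_tsum hv hs hvb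
  have hT : ∀ χ, reservoirFourier f χ = ∫ ξ, (∑' i, v i ξ) * χ ξ := by
    intro χ
    -- By local finiteness `χ` is a finite sum of the products `φ i · χ`, so linearity of the
    -- functional is enough.
    have hfin : {i | (P i ∩ tsupport χ).Nonempty}.Finite :=
      (hP.locallyFinite ho).finite_nonempty_inter_compact χ.hasCompactSupport
    have hzero : ∀ i ∉ hfin.toFinset, ∀ ξ, (φ i ξ : ℂ) * χ ξ = 0 := by
      intro i hi' ξ
      by_contra hne
      have h1 := mul_ne_zero_iff.1 hne
      refine hi' (hfin.mem_toFinset.2 ⟨ξ, hφ.tsupport_subset i (subset_tsupport _ ?_),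
        subset_tsupport _ h1.2⟩)
      exact_mod_cast h1.1
    have hsum : χ = ∑ i ∈ hfin.toFinset, TestFunction.realMul (φ i) χ := by
      ext ξ
      have h1 : HasSum (fun i => (φ i ξ : ℂ) * χ ξ) (1 * χ ξ) :=
        (hφ.hasSum_one_complex ξ).mul_right _
      have h2 := h1.unique (hasSum_sum_of_ne_finset_zero fun i hi => hzero i hi ξ)
      rw [one_mul] at h2
      rw [h2, FunLike.coe_sum, Finset.sum_apply]
      rfl
    have hint : ∀ i, Integrable fun ξ => v i ξ * χ ξ := fun i =>
      ((hv i).mul χ.continuous).integrable_of_hasCompactSupport χ.hasCompactSupport.mul_left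
    have h3 : HasSum (fun i => ∫ ξ, v i ξ * χ ξ) (∫ ξ, ∑' i, v i ξ * χ ξ) := by
      refine hasSum_integral_of_summable_integral_norm hint ?_
      refine Summable.of_nonneg_of_le (fun _ => integral_nonneg fun _ => norm_nonneg _) (fun i => ?_)
        (hs.mul_right (∫ ξ, ‖χ ξ‖))
      rw [← integral_const_mul]
      refine integral_mono (hint i).norm (χ.integrable_volume.norm.const_mul _) fun ξ => ?_
      rw [norm_mul]
      exact mul_le_mul_of_nonneg_right (hvb i ξ) (norm_nonneg _)
    simp only [v, integral_fourier_frequencyPiece_mul f _ (hi _)] at h3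
    have h4 := h3.unique (hasSum_sum_of_ne_finset_zero (s := hfin.toFinset) fun i hi' => by
      have : TestFunction.realMul (φ i) χ = 0 := by
        ext ξ
        exact hzero i hi' ξ
      rw [this, map_zero])
    conv_lhs => rw [hsum]
    rw [map_sum, ← h4]
    congr 1 with ξ
    rw [tsum_mul_right]
  refine ⟨fun ξ => ∑' i, v i ξ, hh, hT, fun i => ?_⟩
  refine congrFun (eq_of_integral_testFunction_eq (hv i)
    ((Complex.continuous_ofReal.comp (φ i).continuous).mul hh) fun χ => ?_)
  rw [integral_fourier_frequencyPiece_mul f _ (hi _), hT]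
  congr 1 with ξ
  rw [TestFunction.realMul_apply]
  simp only
  ring

theorem reservoir_eq_zero_of_density {E : Type*} [NormedAddCommGroup E] [InnerProductSpace ℝ E]
    [FiniteDimensional ℝ E] [MeasurableSpace E] [BorelSpace E] {f : FourierReservoir E}
    {h : E → ℂ} (hf : ∀ χ, reservoirFourier f χ = ∫ ξ, h ξ * χ ξ) (h0 : ∀ ξ, h ξ = 0) : f = 0 := by
  ext z
  obtain ⟨χ, rfl⟩ : ∃ χ, fourierOntoZ E χ = z := LinearMap.surjective_rangeRestrict (fourierTest E) z
  have := hf χ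
  simp only [h0, MulZeroClass.zero_mul, integral_zero] at this
  exact this

theorem eLpNorm_ofReal_one (w : ℝ → ℂ) :
    eLpNorm w (ENNReal.ofReal 1) volume = ∫⁻ x, ‖w x‖ₑ := by
  rw [ENNReal.ofReal_one, eLpNorm_one_eq_lintegral_enorm]

theorem modulationNorm_one_one (f : FourierReservoir ℝ) :
    modulationNorm φ 1 1 f = ∑' i, ∫⁻ x, ‖frequencyPiece (φ i) f x‖ₑ := by
  simp only [modulationNorm, ENNReal.rpow_one, one_div, inv_one, eLpNorm_ofReal_one]

theorem integrable_of_mem_modulationSpace {f : FourierReservoir ℝ}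
    (hf : f ∈ modulationSpace φ 1 1 le_rfl) (i : ι) : Integrable (frequencyPiece (φ i) f) := by
  have := hf.1 i
  rw [ENNReal.ofReal_one] at this
  exact memLp_one_iff_integrable.1 this

theorem summable_of_mem_modulationSpace {f : FourierReservoir ℝ}
    (hf : f ∈ modulationSpace φ 1 1 le_rfl) :
    Summable fun i => ∫ x, ‖frequencyPiece (φ i) f x‖ := by
  have h := hf.2
  rw [modulationNorm_one_one] at h
  have h2 := ENNReal.summable_toReal h.ne
  convert h2 using 2 with i
  rw [integral_norm_eq_lintegral_enorm (integrable_of_mem_modulationSpace hf i).1]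

/-- Bernstein's inequality for the frequency pieces. -/
theorem norm_frequencyPiece_le {f : FourierReservoir ℝ} {h : ℝ → ℂ}
    (hf : ∀ χ, reservoirFourier f χ = ∫ ξ, h ξ * χ ξ) {ψ : 𝓓((⊤ : TopologicalSpace.Opens ℝ), ℝ)}
    {S : Set ℝ} (hS : tsupport ψ ⊆ S) {b : ℝ} (hb : 0 ≤ b) (hSb : volume S ≤ ENNReal.ofReal b)
    (hψ : ∀ ξ, 𝓕 (frequencyPiece ψ f) ξ = (ψ ξ : ℂ) * h ξ) (x : ℝ) :
    ‖frequencyPiece ψ f x‖ ≤ b * ∫ y, ‖frequencyPiece ψ f y‖ := by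
  set A := ∫ y, ‖frequencyPiece ψ f y‖ with hA
  have hA0 : 0 ≤ A := integral_nonneg fun _ => norm_nonneg _
  have h1 : ‖frequencyPiece ψ f x‖ ≤ ∫ ξ, ‖(ψ ξ : ℂ) * h ξ‖ := by
    rw [frequencyPiece_eq_fourierInv hf, Real.fourierInv_eq_fourier_neg]
    exact norm_fourier_le _
  refine h1.trans ?_
  have h2 : ∫ ξ, ‖(ψ ξ : ℂ) * h ξ‖ = ∫ ξ in tsupport ψ, ‖(ψ ξ : ℂ) * h ξ‖ := by
    refine (setIntegral_eq_integral_of_forall_compl_eq_zero fun ξ hξ => ?_).symm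
    rw [image_eq_zero_of_notMem_tsupport hξ]
    simp
  have hfin : volume (tsupport ψ) ≤ ENNReal.ofReal b := (measure_mono hS).trans hSb
  rw [h2]
  -- The integrand is `|𝓕|` of the piece itself, hence at most its `L¹` norm `A`, on a set of
  -- measure at most `b`.
  have h3 := norm_setIntegral_le_of_norm_le_const (μ := volume) (s := tsupport ψ)
    (f := fun ξ => ‖(ψ ξ : ℂ) * h ξ‖) (C := A)
    (hfin.trans_lt ENNReal.ofReal_lt_top) fun ξ _ => by
      rw [norm_norm, ← hψ]
      exact norm_fourier_le ξ
  refine (le_abs_self _).trans (h3.trans ?_)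
  rw [mul_comm]
  refine mul_le_mul_of_nonneg_right ?_ hA0
  rw [measureReal_def]
  exact ENNReal.toReal_le_of_le_ofReal hb hfin

/-- A connected set in `ℝ` contains the whole interval between two of its points, so its measure
bounds its diameter. -/
theorem abs_sub_le_of_isConnected {S : Set ℝ} (hS : IsConnected S) {b : ℝ} (hb : 0 < b)
    (hSb : volume S ≤ ENNReal.ofReal b) {x y : ℝ} (hx : x ∈ S) (hy : y ∈ S) : |x - y| ≤ b := by
  have key : ∀ x ∈ S, ∀ y ∈ S, y - x ≤ b := by
    intro x hx y hy
    have h1 := (measure_mono (μ := volume) (hS.isPreconnected.Icc_subset hx hy)).trans hSb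
    rw [Real.volume_Icc] at h1
    exact (ENNReal.ofReal_le_ofReal_iff hb.le).1 h1
  exact abs_sub_le_iff.2 ⟨key y hy x hx, key x hx y hy⟩

end

/-! ### Sheared products -/

section Product

variable {E : Type*} [NormedAddCommGroup E] [InnerProductSpace ℝ E] [FiniteDimensional ℝ E]
  [MeasurableSpace E] [BorelSpace E]

/-- The Fourier transform of a product `x ↦ (𝓕⁻¹ κ)(⟨X, x⟩) G(x)`. -/
theorem fourier_inner_mul {κ : ℝ → ℂ} (hκ : Integrable κ) {G : E → ℂ} (hG : Integrable G)
    (X ξ : E) :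
    𝓕 (fun x => 𝓕⁻ κ (inner ℝ X x) * G x) ξ = ∫ t, κ t * 𝓕 G (ξ - t • X) := by
  have h1 : 𝓕 (fun x => 𝓕⁻ κ (inner ℝ X x) * G x) ξ =
      ∫ x, ∫ t, (κ t * G x) * (Complex.exp ((2 * Real.pi * inner ℝ t (inner ℝ X x) : ℝ) * Complex.I)
        * Complex.exp ((-2 * Real.pi * inner ℝ x ξ : ℝ) * Complex.I)) := by
    rw [Real.fourier_eq']
    congr 1 with x
    rw [smul_eq_mul, mul_left_comm, Real.fourierInv_eq', ← integral_mul_const]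
    congr 1 with t
    rw [smul_eq_mul]
    ring
  rw [h1, integral_integral_swap]
  · congr 1 with t
    rw [Real.fourier_eq', ← integral_const_mul]
    congr 1 with x
    rw [← Complex.exp_add, smul_eq_mul, mul_assoc, mul_comm (G x)]
    congr 3
    rw [inner_sub_right, inner_smul_right, real_inner_comm X x]
    simp only [RCLike.inner_apply, conj_trivial]
    push_cast
    ring
  · have h2 : Integrable (fun z : E × ℝ => ‖κ z.2‖ * ‖G z.1‖) (volume.prod volume) := by
      simpa [mul_comm] using hG.norm.mul_prod hκ.norm
    refine h2.mono' ?_ (Filter.Eventually.of_forall fun z => ?_)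
    · refine AEStronglyMeasurable.mul (hκ.1.comp_snd.mul hG.1.comp_fst)
        (Continuous.aestronglyMeasurable ?_)
      fun_prop
    · simp only [Function.uncurry, norm_mul, Complex.norm_exp_ofReal_mul_I, mul_one]
      exact le_rfl

/-- The Fourier transform of a function composed with a unipotent map. -/
theorem fourier_comp_shear (N : E →L[ℝ] E) (hN : ∀ x, N (N x) = 0) {g : E → ℂ}
    (hg : Continuous g) (ξ : E) :
    𝓕 (fun x => g (x + ContinuousLinearMap.adjoint N x)) ξ = 𝓕 g (ξ - N ξ) := by
  set B := ContinuousLinearMap.adjoint N with hB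
  have hBB : ∀ x, B (B x) = 0 := by
    intro x
    refine ext_inner_left ℝ fun y => ?_
    rw [hB, ContinuousLinearMap.adjoint_inner_right, ContinuousLinearMap.adjoint_inner_right, hN]
    simp
  -- The adjoint also squares to zero, so the substitution preserves volume and its inverse is `y ↦
  -- y - B y`.
  have hmp : MeasurePreserving (fun x => x + B x) (volume : Measure E) volume :=
    StratifiedGroup.measurePreserving_one_add (B : E →ₗ[ℝ] E) hBB
  have hc : Continuous fun y => Complex.exp ((-2 * Real.pi * inner ℝ (y - B y) ξ : ℝ) * Complex.I) •
      g y := by fun_prop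
  have h1 := integral_map hmp.measurable.aemeasurable (μ := volume)
    (f := fun y => Complex.exp ((-2 * Real.pi * inner ℝ (y - B y) ξ : ℝ) * Complex.I) • g y)
    hc.aestronglyMeasurable
  rw [hmp.map_eq] at h1
  rw [Real.fourier_eq', Real.fourier_eq']
  have h2 : ∀ y, inner ℝ y (ξ - N ξ) = inner ℝ (y - B y) ξ := by
    intro y
    rw [inner_sub_right, inner_sub_left, hB, ContinuousLinearMap.adjoint_inner_left]
  simp only [h2]
  rw [h1]
  congr 1 with x
  rw [map_add, hBB, add_zero, add_sub_cancel_right]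

/-- The inverse Fourier transform of a test function is integrable. -/
theorem integrable_fourierInv_testFunction (θ : 𝓓((⊤ : TopologicalSpace.Opens E), ℝ)) :
    Integrable (𝓕⁻ (fun ξ => (θ ξ : ℂ))) := by
  let S : 𝓢(E, ℂ) := (θ.hasCompactSupport.comp_left (g := ((↑) : ℝ → ℂ))
    Complex.ofReal_zero).toSchwartzMap (Complex.ofRealCLM.contDiff.comp θ.contDiff)
  have h := (𝓕⁻ S).integrable (μ := volume)
  rw [SchwartzMap.fourierInv_coe] at h
  exact h

theorem fourier_fourierInv_testFunction (θ : 𝓓((⊤ : TopologicalSpace.Opens E), ℝ)) :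
    𝓕 (𝓕⁻ (fun ξ => (θ ξ : ℂ))) = fun ξ => (θ ξ : ℂ) := by
  refine Continuous.fourier_fourierInv_eq (Complex.continuous_ofReal.comp θ.continuous)
    (integrable_testFunction θ) ?_
  have h := (integrable_fourierInv_testFunction θ).comp_neg
  convert! h using 2 with ξ
  rw [Real.fourierInv_eq_fourier_neg, neg_neg]

theorem norm_fourierInv_testFunction_le (θ : 𝓓((⊤ : TopologicalSpace.Opens E), ℝ)) (x : E) :
    ‖𝓕⁻ (fun ξ => (θ ξ : ℂ)) x‖ ≤ ∫ ξ, ‖(θ ξ : ℂ)‖ := by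
  rw [Real.fourierInv_eq_fourier_neg]
  exact norm_fourier_le _

/-- The inverse Fourier transform of a non-negative test function cannot vanish on a segment of a
line through the origin. -/
theorem fourierInv_testFunction_line (θ : 𝓓((⊤ : TopologicalSpace.Opens E), ℝ))
    (h0 : ∀ ξ, 0 ≤ θ ξ) (hpos : 0 < ∫ ξ, θ ξ) (x₀ : E) (s₀ : ℝ)
    (h : ∀ᶠ s in nhds s₀, 𝓕⁻ (fun ξ => (θ ξ : ℂ)) (s • x₀) = 0) : False := by
  let d : E → ℝ≥0 := fun ξ => (θ ξ).toNNReal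
  have hd : Measurable d := θ.continuous.measurable.real_toNNReal
  have hdr : ∀ ξ, (d ξ : ℝ) = θ ξ := fun ξ => Real.coe_toNNReal _ (h0 ξ)
  -- Analyticity comes from the complex moment generating function of `ξ ↦ 2π⟨ξ, x₀⟩` under the
  -- measure with density `θ`. It is entire because `θ` has compact support.
  let μ : Measure E := volume.withDensity fun ξ => (d ξ : ℝ≥0∞)
  let L : E → ℝ := fun ξ => 2 * Real.pi * inner ℝ ξ x₀
  have hLc : Continuous L := by fun_prop
  have hset : ProbabilityTheory.integrableExpSet L μ = univ := by
    refine eq_univ_of_forall fun t => ?_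
    change Integrable (fun ξ => Real.exp (t * L ξ)) μ
    rw [integrable_withDensity_iff_integrable_smul hd]
    refine Continuous.integrable_of_hasCompactSupport ?_ ?_
    · exact (continuous_real_toNNReal.comp θ.continuous).smul
        (Real.continuous_exp.comp (continuous_const.mul hLc))
    · refine θ.hasCompactSupport.mono fun ξ hξ hz => hξ ?_
      have : d ξ = 0 := by simp [d, hz]
      simp [this]
  -- On the imaginary axis it is the inverse Fourier transform along the line. Vanishing near `s₀`
  -- thus makes it vanish identically, contradicting its value `∫ θ > 0` at `0`.
  have hval : ∀ s : ℝ, ProbabilityTheory.complexMGF L μ (Complex.I * s) =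
      𝓕⁻ (fun ξ => (θ ξ : ℂ)) (s • x₀) := by
    intro s
    rw [ProbabilityTheory.complexMGF, integral_withDensity_eq_integral_smul hd,
      Real.fourierInv_eq']
    congr 1 with ξ
    rw [NNReal.smul_def, hdr, smul_eq_mul, Complex.real_smul, mul_comm]
    congr 2
    rw [inner_smul_right]
    simp only [L]
    push_cast
    ring
  have han : AnalyticOnNhd ℂ (ProbabilityTheory.complexMGF L μ) univ := by
    have := ProbabilityTheory.analyticOnNhd_complexMGF (X := L) (μ := μ)
    rw [hset, interior_univ] at this
    exact this
  have hzero := han.eqOn_zero_of_preconnected_of_frequently_eq_zero isPreconnected_univ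
    (mem_univ (Complex.I * s₀)) (by
      have hev : ∀ᶠ s : ℝ in nhdsWithin s₀ {s₀}ᶜ,
          ProbabilityTheory.complexMGF L μ (Complex.I * s) = 0 := by
        filter_upwards [h.filter_mono nhdsWithin_le_nhds] with s hs
        rw [hval, hs]
      refine Filter.Tendsto.frequently (f := fun s : ℝ => Complex.I * (s : ℂ)) ?_ hev.frequently
      refine tendsto_nhdsWithin_iff.2 ⟨?_, ?_⟩
      · exact (Continuous.tendsto (by fun_prop) s₀).mono_left nhdsWithin_le_nhds
      · filter_upwards [self_mem_nhdsWithin] with s hs heq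
        refine hs ?_
        have := mul_left_cancel₀ Complex.I_ne_zero heq
        exact_mod_cast this)
  have h1 := hzero (mem_univ (Complex.I * (0 : ℝ)))
  rw [hval, zero_smul, Real.fourierInv_eq'] at h1
  simp only [inner_zero_right, mul_zero, Complex.ofReal_zero, MulZeroClass.zero_mul,
    Complex.exp_zero, one_smul, Pi.zero_apply] at h1
  rw [integral_complex_ofReal] at h1
  exact hpos.ne' (by exact_mod_cast h1)

/-- A non-negative test function with positive integral. -/
theorem exists_testFunction_pos (E : Type*) [NormedAddCommGroup E] [InnerProductSpace ℝ E]
    [FiniteDimensional ℝ E] [MeasurableSpace E] [BorelSpace E] :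
    ∃ θ : 𝓓((⊤ : TopologicalSpace.Opens E), ℝ), (∀ ξ, 0 ≤ θ ξ) ∧ 0 < ∫ ξ, θ ξ := by
  let β : ContDiffBump (0 : E) := ⟨1, 2, zero_lt_one, one_lt_two⟩
  exact ⟨⟨β, β.contDiff, β.hasCompactSupport, fun _ _ => trivial⟩, fun ξ => β.nonneg,
    β.integral_pos⟩

/-- Only those members of a summable family contribute to a frequency piece whose Fourier
transforms meet the corresponding window. -/
theorem eLpNorm_frequencyPiece_tsum_le {ι : Type*} [Countable ι] {v : ι → E → ℂ} {a : ι → ℝ}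
    (ha : Summable a) (hc : ∀ i, Continuous (v i)) (hi : ∀ i, Integrable (v i))
    (hb : ∀ i x, ‖v i x‖ ≤ a i) (h1 : ∀ i, ∫ x, ‖v i x‖ ≤ a i)
    (hu : Integrable fun x => ∑' i, v i x) (ψ : 𝓓((⊤ : TopologicalSpace.Opens E), ℝ)) (I : Set ι)
    (hI : ∀ i ∉ I, ∀ ξ, ψ ξ ≠ 0 → 𝓕 (v i) ξ = 0) {C : ℝ≥0}
    (hC : eLpNorm (𝓕⁻ (fun ξ => (ψ ξ : ℂ))) 1 volume ≤ C) {p : ℝ} (hp : 1 ≤ p) :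
    eLpNorm (frequencyPiece ψ (reservoirOfIntegrable _ hu)) (ENNReal.ofReal p) volume ≤
      (∑' i, I.indicator (fun i => ENNReal.ofReal (a i)) i) * C := by
  classical
  have ha0 : ∀ i, 0 ≤ a i := fun i => (norm_nonneg _).trans (hb i 0)
  have haI : Summable (I.indicator a) := ha.indicator I
  have haI0 : ∀ i, 0 ≤ I.indicator a i := fun i => indicator_nonneg (fun i _ => ha0 i) i
  -- The truncated family yields the same frequency piece but has the smaller bound `∑_{i ∈ I} a i`,
  -- both in `L¹` and uniformly.
  let v' : ι → E → ℂ := fun i => if i ∈ I then v i else 0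
  have hv' : ∀ i, v' i = if i ∈ I then v i else 0 := fun _ => rfl
  obtain ⟨hc', hi', hb', h1', hF'⟩ := summable_family (v := v') haI
    (fun i => by
      rw [hv']; split_ifs
      · exact hc i
      · exact continuous_zero)
    (fun i => by
      rw [hv']; split_ifs
      · exact hi i
      · exact integrable_zero _ _ _)
    (fun i x => by
      rw [hv']; split_ifs with h
      · rw [indicator_of_mem h]; exact hb i x
      · rw [indicator_of_notMem h]; simp)
    (fun i => by
      rw [hv']; split_ifs with h
      · rw [indicator_of_mem h]; exact h1 i
      · rw [indicator_of_notMem h]; simp)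
  obtain ⟨-, -, -, -, hF⟩ := summable_family ha hc hi hb h1
  have hcongr := frequencyPiece_congr (reservoirFourier_reservoirOfIntegrable hu)
    (reservoirFourier_reservoirOfIntegrable hi') ψ (fun ξ hξ => by
      refine (hF ξ).unique ?_
      convert! hF' ξ using 2 with i
      rw [hv']
      split_ifs with h
      · rfl
      · rw [hI i h ξ hξ, Real.fourier_eq]
        simp)
  have hsum : ∑' i, I.indicator (fun i => ENNReal.ofReal (a i)) i =
      ENNReal.ofReal (∑' i, I.indicator a i) := by
    rw [ENNReal.ofReal_tsum_of_nonneg haI0 haI]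
    congr 1 with i
    by_cases h : i ∈ I <;> simp [h]
  rw [hcongr, hsum]
  refine eLpNorm_le_of_bounds hp (ENNReal.mul_ne_top ENNReal.ofReal_ne_top ENNReal.coe_ne_top)
    ?_ fun x => ?_
  · refine (lintegral_frequencyPiece_le hi' ψ).trans (mul_le_mul' ?_ hC)
    rw [← ofReal_integral_norm_eq_lintegral_enorm hi']
    exact ENNReal.ofReal_le_ofReal h1'
  · refine (enorm_frequencyPiece_le_of_bound hi' ψ (B := ENNReal.ofReal (∑' i, I.indicator a i))
      (fun y => ?_) x).trans (mul_le_mul' le_rfl hC)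
    rw [← ofReal_norm]
    exact ENNReal.ofReal_le_ofReal (hb' y)

/-- Summing over the windows of a family with bounded overlap. -/
theorem tsum_tsum_indicator_le {ι κ : Type*} (I : κ → Set ι) (a : ι → ℝ≥0∞) {K : ℕ}
    (hK : ∀ i, {j | i ∈ I j}.encard ≤ K) :
    ∑' j, ∑' i, (I j).indicator a i ≤ K * ∑' i, a i := by
  rw [ENNReal.tsum_comm, ← ENNReal.tsum_mul_left]
  refine ENNReal.tsum_le_tsum fun i => ?_
  have h1 : ∀ j, (I j).indicator a i = {j | i ∈ I j}.indicator (fun _ => a i) j := by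
    intro j
    by_cases h : i ∈ I j <;> simp [h]
  simp only [h1]
  rw [← tsum_subtype, ENNReal.tsum_set_const]
  refine mul_le_mul_left ?_ _
  exact_mod_cast ENat.toENNReal_le.2 (hK i)

end Product

/-! ### The sheared embedding -/

namespace StratifiedGroup

variable {E : Type*} [NormedAddCommGroup E] [InnerProductSpace ℝ E] [FiniteDimensional ℝ E]
  [MeasurableSpace E] [BorelSpace E] (G : StratifiedGroup E) (X : E)
  (θ : 𝓓((⊤ : TopologicalSpace.Opens E), ℝ))

/-- The linear part of the left translation by `t • X`, minus the identity. -/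
def shear (t : ℝ) : E →L[ℝ] E := (t / 2) • LinearMap.toContinuousLinearMap (G.bracket X)

theorem shear_apply (t : ℝ) (x : E) : G.shear X t x = (t / 2) • G.bracket X x := rfl

theorem shear_shear (t : ℝ) (x : E) : G.shear X t (G.shear X t x) = 0 := by
  simp [shear_apply, G.bracket_bracket]

/-- The window at `t • X`: its Fourier transform is the bump `θ`, sheared like the left translation
by `t • X`. -/
def window (t : ℝ) (x : E) : ℂ :=
  𝓕⁻ (fun ξ => (θ ξ : ℂ)) (x + ContinuousLinearMap.adjoint (G.shear X t) x)

theorem adjoint_shear_shear (t : ℝ) (x : E) : ContinuousLinearMap.adjoint (G.shear X t)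
    (ContinuousLinearMap.adjoint (G.shear X t) x) = 0 := by
  refine ext_inner_left ℝ fun y => ?_
  rw [ContinuousLinearMap.adjoint_inner_right, ContinuousLinearMap.adjoint_inner_right,
    shear_shear]
  simp

theorem measurePreserving_adjoint_shear (t : ℝ) :
    MeasurePreserving (fun x => x + ContinuousLinearMap.adjoint (G.shear X t) x)
      (volume : Measure E) volume :=
  measurePreserving_one_add (ContinuousLinearMap.adjoint (G.shear X t) : E →ₗ[ℝ] E)
    (G.adjoint_shear_shear X t)

theorem continuous_window (t : ℝ) : Continuous (G.window X θ t) :=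
  (fourierInv_continuous (integrable_testFunction θ)).comp (by fun_prop)

theorem integrable_window (t : ℝ) : Integrable (G.window X θ t) :=
  (G.measurePreserving_adjoint_shear X t).integrable_comp_of_integrable
    (integrable_fourierInv_testFunction θ)

theorem integral_norm_window (t : ℝ) :
    ∫ x, ‖G.window X θ t x‖ = ∫ x, ‖𝓕⁻ (fun ξ => (θ ξ : ℂ)) x‖ := by
  have hmp := G.measurePreserving_adjoint_shear X t
  have h := integral_map hmp.measurable.aemeasurable (μ := volume)
    (f := fun x => ‖𝓕⁻ (fun ξ => (θ ξ : ℂ)) x‖)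
    (fourierInv_continuous (integrable_testFunction θ)).norm.aestronglyMeasurable
  rw [hmp.map_eq] at h
  exact h.symm

theorem norm_window_le (t : ℝ) (x : E) : ‖G.window X θ t x‖ ≤ ∫ ξ, ‖(θ ξ : ℂ)‖ :=
  norm_fourierInv_testFunction_le θ _

theorem fourier_window (t : ℝ) (ξ : E) :
    𝓕 (G.window X θ t) ξ = (θ (ξ - G.shear X t ξ) : ℂ) := by
  have h := fourier_comp_shear (G.shear X t) (G.shear_shear X t)
    (fourierInv_continuous (integrable_testFunction θ)) ξ
  rw [fourier_fourierInv_testFunction] at h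
  exact h

/-- The shear takes values in `V₂`, so its adjoint kills vectors orthogonal to `V₂`. On these all
windows coincide, which makes injectivity visible. -/
theorem window_of_orthogonal (t : ℝ) {x : E} (hx : ∀ y ∈ G.V₂, inner ℝ x y = 0) :
    G.window X θ t x = 𝓕⁻ (fun ξ => (θ ξ : ℂ)) x := by
  have h : ContinuousLinearMap.adjoint (G.shear X t) x = 0 := by
    refine ext_inner_right ℝ fun y => ?_
    rw [ContinuousLinearMap.adjoint_inner_left, shear_apply, inner_smul_right,
      hx _ (G.bracket_mem X y)]
    simp
  rw [window, h, add_zero]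

/-- The sheared windows are carried by balls of a fixed radius around `s • X`. -/
theorem exists_radius_window {ν : E → ℝ} (hν : G.IsQuasiNorm ν) (b : ℝ) :
    ∃ R > 0, ∀ s t : ℝ, |t - s| ≤ b → ∀ ξ,
      θ (ξ - s • X - G.shear X t (ξ - s • X)) ≠ 0 → ξ ∈ G.ball ν (s • X) R := by
  -- For `η = (1 - shear t)(ξ - s • X)` one has `[X, η] = [X, ξ]`, hence `(-s • X) * ξ = η + ((t -
  -- s) / 2) [X, η]`. With `η ∈ supp θ` and `|t - s| ≤ b` this stays in a compact set.
  have hcont : Continuous fun p : ℝ × E => p.2 + p.1 • G.bracket X p.2 := by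
    have : Continuous fun x => G.bracket X x := LinearMap.continuous_of_finiteDimensional _
    fun_prop
  obtain ⟨R, hR0, hR⟩ := hν.exists_bound (((isCompact_Icc (a := -b) (b := b)).prod
    θ.hasCompactSupport.isCompact).image hcont).isBounded
  refine ⟨R, hR0, fun s t hst ξ hξ => ?_⟩
  have hb : 0 ≤ b := (abs_nonneg _).trans hst
  have h := hR _ ⟨((t - s) / 2, _), ⟨?_, subset_tsupport _ hξ⟩, rfl⟩
  · rw [mem_ball]
    convert h using 2
    simp only [mul, shear_apply, map_neg, map_smul, map_sub, LinearMap.neg_apply,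
      LinearMap.smul_apply, G.bracket_self, G.bracket_bracket, smul_zero, sub_zero]
    module
  · rw [mem_Icc, ← abs_le, abs_div, abs_two]
    linarith

end StratifiedGroup

/-- A covering of `ℝ` by open intervals of bounded length with a subordinate partition of unity and
a choice of points. -/
structure IsIntervalPartition {ι : Type*} (P : ι → Set ℝ)
    (φ : ι → 𝓓((⊤ : TopologicalSpace.Opens ℝ), ℝ)) (b : ℝ) (t : ι → ℝ) : Prop where
  admissible : IsAdmissibleCovering P
  isOpen : ∀ i, IsOpen (P i)
  isConnected : ∀ i, IsConnected (P i)
  isBAPU : IsBAPU P φ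
  pos : 0 < b
  volume_le : ∀ i, volume (P i) ≤ ENNReal.ofReal b
  mem : ∀ i, t i ∈ P i

namespace IsIntervalPartition

variable {ι : Type*} {P : ι → Set ℝ} {φ : ι → 𝓓((⊤ : TopologicalSpace.Opens ℝ), ℝ)} {b : ℝ}
  {t : ι → ℝ} {E : Type*} [NormedAddCommGroup E] [InnerProductSpace ℝ E] [FiniteDimensional ℝ E]
  [MeasurableSpace E] [BorelSpace E]

theorem countable (hp : IsIntervalPartition P φ b t) : Countable ι :=
  hp.admissible.countable hp.isOpen

theorem exists_density (hp : IsIntervalPartition P φ b t) {f : FourierReservoir ℝ}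
    (hf : f ∈ modulationSpace φ 1 1 le_rfl) :
    ∃ h : ℝ → ℂ, Continuous h ∧ (∀ χ, reservoirFourier f χ = ∫ ξ, h ξ * χ ξ) ∧
      ∀ i ξ, 𝓕 (frequencyPiece (φ i) f) ξ = (φ i ξ : ℂ) * h ξ :=
  exists_fourier_density hp.admissible hp.isOpen hp.isBAPU f
    (integrable_of_mem_modulationSpace hf) (summable_of_mem_modulationSpace hf)

theorem abs_sub_le (hp : IsIntervalPartition P φ b t) {i : ι} {s : ℝ} (h : φ i s ≠ 0) :
    |t i - s| ≤ b :=
  abs_sub_le_of_isConnected (hp.isConnected i) hp.pos (hp.volume_le i) (hp.mem i)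
    (hp.isBAPU.tsupport_subset i (subset_tsupport _ h))

end IsIntervalPartition

/-! ### Transplanting the pieces: convergence, spectrum, injectivity, boundedness -/

section Sheared

variable {ι : Type*} {P : ι → Set ℝ} {φ : ι → 𝓓((⊤ : TopologicalSpace.Opens ℝ), ℝ)} {b : ℝ}
  {t : ι → ℝ} {E : Type*} [NormedAddCommGroup E] [InnerProductSpace ℝ E] [FiniteDimensional ℝ E]
  [MeasurableSpace E] [BorelSpace E] (G : StratifiedGroup E) (X : E)
  (θ : 𝓓((⊤ : TopologicalSpace.Opens E), ℝ))

/-- A frequency piece of a function on the line, transplanted to the one-parameter subgroup of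
`X`. -/
def shearedTerm (φ : ι → 𝓓((⊤ : TopologicalSpace.Opens ℝ), ℝ)) (t : ι → ℝ)
    (f : FourierReservoir ℝ) (i : ι) (x : E) : ℂ :=
  frequencyPiece (φ i) f (inner ℝ X x) * G.window X θ (t i) x

/-- The sum of the transplanted frequency pieces. -/
def shearedSum (φ : ι → 𝓓((⊤ : TopologicalSpace.Opens ℝ), ℝ)) (t : ι → ℝ)
    (f : FourierReservoir ℝ) (x : E) : ℂ := ∑' i, shearedTerm G X θ φ t f i x

/-- A bound for the windows in `L¹` and in `L^∞`, times the length of the intervals. -/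
def shearConst (θ : 𝓓((⊤ : TopologicalSpace.Opens E), ℝ)) (b : ℝ) : ℝ :=
  max (∫ ξ, ‖(θ ξ : ℂ)‖) (∫ x, ‖𝓕⁻ (fun ξ => (θ ξ : ℂ)) x‖) * b

theorem shearConst_nonneg {b : ℝ} (hb : 0 < b) : 0 ≤ shearConst θ b :=
  mul_nonneg (le_max_of_le_left (integral_nonneg fun _ => norm_nonneg _)) hb.le

/-- The bound of a transplanted frequency piece. -/
def shearBound (θ : 𝓓((⊤ : TopologicalSpace.Opens E), ℝ))
    (φ : ι → 𝓓((⊤ : TopologicalSpace.Opens ℝ), ℝ)) (b : ℝ) (f : FourierReservoir ℝ) (i : ι) : ℝ :=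
  shearConst θ b * ∫ y, ‖frequencyPiece (φ i) f y‖

variable {f : FourierReservoir ℝ}

theorem summable_shearBound (hf : f ∈ modulationSpace φ 1 1 le_rfl) :
    Summable (shearBound θ φ b f) :=
  (summable_of_mem_modulationSpace hf).mul_left _

theorem norm_frequencyPiece_le_of_mem (hp : IsIntervalPartition P φ b t)
    (hf : f ∈ modulationSpace φ 1 1 le_rfl) (i : ι) (s : ℝ) :
    ‖frequencyPiece (φ i) f s‖ ≤ b * ∫ y, ‖frequencyPiece (φ i) f y‖ := by
  obtain ⟨h, -, h1, h2⟩ := hp.exists_density hf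
  exact norm_frequencyPiece_le h1 (hp.isBAPU.tsupport_subset i) hp.pos.le (hp.volume_le i) (h2 i) s

theorem continuous_frequencyPiece_of_mem (hp : IsIntervalPartition P φ b t)
    (hf : f ∈ modulationSpace φ 1 1 le_rfl) (i : ι) : Continuous (frequencyPiece (φ i) f) := by
  obtain ⟨h, h0, h1, -⟩ := hp.exists_density hf
  exact frequencyPiece_continuous h1 h0 _

theorem continuous_shearedTerm (hp : IsIntervalPartition P φ b t)
    (hf : f ∈ modulationSpace φ 1 1 le_rfl) (i : ι) : Continuous (shearedTerm G X θ φ t f i) :=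
  ((continuous_frequencyPiece_of_mem hp hf i).comp (continuous_const.inner continuous_id)).mul
    (G.continuous_window X θ _)

theorem integrable_shearedTerm (hp : IsIntervalPartition P φ b t)
    (hf : f ∈ modulationSpace φ 1 1 le_rfl) (i : ι) : Integrable (shearedTerm G X θ φ t f i) := by
  refine (G.integrable_window X θ (t i)).bdd_mul
    (c := b * ∫ y, ‖frequencyPiece (φ i) f y‖) ?_
    (Filter.Eventually.of_forall fun x => norm_frequencyPiece_le_of_mem hp hf i _)
  exact ((continuous_frequencyPiece_of_mem hp hf i).comp
    (continuous_const.inner continuous_id)).aestronglyMeasurable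

theorem norm_shearedTerm_le (hp : IsIntervalPartition P φ b t)
    (hf : f ∈ modulationSpace φ 1 1 le_rfl) (i : ι) (x : E) :
    ‖shearedTerm G X θ φ t f i x‖ ≤ shearBound θ φ b f i := by
  have h0 : 0 ≤ ∫ y, ‖frequencyPiece (φ i) f y‖ := integral_nonneg fun _ => norm_nonneg _
  have hb := hp.pos.le
  rw [shearedTerm, norm_mul]
  calc _ ≤ (b * ∫ y, ‖frequencyPiece (φ i) f y‖) *
        max (∫ ξ, ‖(θ ξ : ℂ)‖) (∫ x, ‖𝓕⁻ (fun ξ => (θ ξ : ℂ)) x‖) := by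
        refine mul_le_mul (norm_frequencyPiece_le_of_mem hp hf i _)
          ((G.norm_window_le X θ _ _).trans (le_max_left _ _)) (norm_nonneg _) (by positivity)
    _ = _ := by rw [shearBound, shearConst]; ring

theorem integral_norm_shearedTerm_le (hp : IsIntervalPartition P φ b t)
    (hf : f ∈ modulationSpace φ 1 1 le_rfl) (i : ι) :
    ∫ x, ‖shearedTerm G X θ φ t f i x‖ ≤ shearBound θ φ b f i := by
  have h0 : 0 ≤ ∫ y, ‖frequencyPiece (φ i) f y‖ := integral_nonneg fun _ => norm_nonneg _
  have hb := hp.pos.le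
  calc ∫ x, ‖shearedTerm G X θ φ t f i x‖
      ≤ ∫ x, (b * ∫ y, ‖frequencyPiece (φ i) f y‖) * ‖G.window X θ (t i) x‖ := by
        refine integral_mono (integrable_shearedTerm G X θ hp hf i).norm
          ((G.integrable_window X θ _).norm.const_mul _) fun x => ?_
        simp only [shearedTerm, norm_mul]
        exact mul_le_mul_of_nonneg_right (norm_frequencyPiece_le_of_mem hp hf i _) (norm_nonneg _)
    _ ≤ (b * ∫ y, ‖frequencyPiece (φ i) f y‖) *
        max (∫ ξ, ‖(θ ξ : ℂ)‖) (∫ x, ‖𝓕⁻ (fun ξ => (θ ξ : ℂ)) x‖) := by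
        rw [integral_const_mul, G.integral_norm_window]
        exact mul_le_mul_of_nonneg_left (le_max_right _ _) (by positivity)
    _ = _ := by rw [shearBound, shearConst]; ring

theorem continuous_shearedSum (hp : IsIntervalPartition P φ b t)
    (hf : f ∈ modulationSpace φ 1 1 le_rfl) : Continuous (shearedSum G X θ φ t f) :=
  continuous_tsum (continuous_shearedTerm G X θ hp hf) (summable_shearBound θ hf)
    (norm_shearedTerm_le G X θ hp hf)

theorem integrable_shearedSum (hp : IsIntervalPartition P φ b t)
    (hf : f ∈ modulationSpace φ 1 1 le_rfl) : Integrable (shearedSum G X θ φ t f) := by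
  have := hp.countable
  exact (summable_family (summable_shearBound θ hf) (continuous_shearedTerm G X θ hp hf)
    (integrable_shearedTerm G X θ hp hf) (norm_shearedTerm_le G X θ hp hf)
    (integral_norm_shearedTerm_le G X θ hp hf)).2.1

theorem hasSum_fourier_shearedTerm (hp : IsIntervalPartition P φ b t)
    (hf : f ∈ modulationSpace φ 1 1 le_rfl) (ξ : E) :
    HasSum (fun i => 𝓕 (shearedTerm G X θ φ t f i) ξ) (𝓕 (shearedSum G X θ φ t f) ξ) := by
  have := hp.countable
  exact (summable_family (summable_shearBound θ hf) (continuous_shearedTerm G X θ hp hf)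
    (integrable_shearedTerm G X θ hp hf) (norm_shearedTerm_le G X θ hp hf)
    (integral_norm_shearedTerm_le G X θ hp hf)).2.2.2.2 ξ

/-- The frequencies of a transplanted piece lie near the corresponding points of the one-parameter
subgroup. -/
theorem exists_of_fourier_shearedTerm_ne_zero (hp : IsIntervalPartition P φ b t) {h : ℝ → ℂ}
    (hh : Continuous h) (hfh : ∀ χ, reservoirFourier f χ = ∫ ξ, h ξ * χ ξ) {ν : E → ℝ} {R : ℝ}
    (hR : ∀ s t : ℝ, |t - s| ≤ b → ∀ ξ,
      θ (ξ - s • X - G.shear X t (ξ - s • X)) ≠ 0 → ξ ∈ G.ball ν (s • X) R)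
    {i : ι} {ξ : E} (hne : 𝓕 (shearedTerm G X θ φ t f i) ξ ≠ 0) :
    ∃ s, φ i s ≠ 0 ∧ h s ≠ 0 ∧ |t i - s| ≤ b ∧ ξ ∈ G.ball ν (s • X) R := by
  -- The transform is the density of the piece, carried by `s ↦ s • X` and smeared by the window. If
  -- it is nonzero at `ξ`, the integrand is nonzero for some `s`.
  have h1 : 𝓕 (shearedTerm G X θ φ t f i) ξ =
      ∫ s, ((φ i s : ℂ) * h s) * 𝓕 (G.window X θ (t i)) (ξ - s • X) := by
    have := fourier_inner_mul (integrable_testFunction_mul (φ i) hh)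
      (G.integrable_window X θ (t i)) X ξ
    rw [← this, ← frequencyPiece_eq_fourierInv hfh]
    rfl
  by_contra hcon
  push Not at hcon
  refine hne ?_
  rw [h1]
  refine integral_eq_zero_of_ae (Filter.Eventually.of_forall fun s => ?_)
  by_contra hs
  obtain ⟨h2, h3⟩ := mul_ne_zero_iff.1 hs
  obtain ⟨h4, h5⟩ := mul_ne_zero_iff.1 h2
  have h6 : φ i s ≠ 0 := by exact_mod_cast h4
  have h7 := hp.abs_sub_le h6
  refine hcon s h6 h5 h7 (hR s (t i) h7 ξ ?_)
  rw [G.fourier_window] at h3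
  exact_mod_cast h3

/-- A function with vanishing transplant vanishes. -/
theorem eq_zero_of_shearedSum_eq_zero (hp : IsIntervalPartition P φ b t)
    (hf : f ∈ modulationSpace φ 1 1 le_rfl) (hX : X ∉ G.V₂) (hθ : ∀ ξ, 0 ≤ θ ξ)
    (hθ' : 0 < ∫ ξ, θ ξ) (h0 : ∀ x, shearedSum G X θ φ t f x = 0) : f = 0 := by
  have := hp.countable
  obtain ⟨h, hh, hfh, hφh⟩ := hp.exists_density hf
  -- a vector orthogonal to the second layer with `⟨X, x₀⟩ = 1`
  obtain ⟨x₀, hx₀, hX1⟩ : ∃ x₀ : E, (∀ y ∈ G.V₂, inner ℝ x₀ y = 0) ∧ inner ℝ X x₀ = 1 := by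
    have hX' : X ∉ G.V₂ᗮᗮ := by rwa [Submodule.orthogonal_orthogonal]
    rw [Submodule.mem_orthogonal] at hX'
    push Not at hX'
    obtain ⟨u, hu, hne⟩ := hX'
    refine ⟨(inner ℝ u X)⁻¹ • u, fun y hy => ?_, ?_⟩
    · rw [inner_smul_left, Submodule.inner_left_of_mem_orthogonal hy hu, mul_zero]
    · rw [inner_smul_right, real_inner_comm u X, inv_mul_cancel₀ hne]
  set F : ℝ → ℂ := fun s => ∑' i, frequencyPiece (φ i) f s with hF
  -- At `s • x₀` every window takes the same value and `⟨X, s • x₀⟩ = s`, so the common window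
  -- factors out of the sum.
  have hprod : ∀ s : ℝ, F s * 𝓕⁻ (fun ξ => (θ ξ : ℂ)) (s • x₀) = 0 := by
    intro s
    have h1 := h0 (s • x₀)
    simp only [shearedSum, shearedTerm] at h1
    rw [← h1, hF, ← tsum_mul_right]
    congr 1 with i
    rw [inner_smul_right, hX1, mul_one, G.window_of_orthogonal]
    intro y hy
    rw [inner_smul_left, hx₀ y hy, mul_zero]
  have hs := summable_of_mem_modulationSpace hf
  have hA : ∀ i, 0 ≤ ∫ y, ‖frequencyPiece (φ i) f y‖ :=
    fun i => integral_nonneg fun _ => norm_nonneg _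
  -- The factor `b` is for the sup norm, by Bernstein, and the factor `1` for the `L¹` norm.
  obtain ⟨hFc, hFi, -, -, hFF⟩ := summable_family (hs.mul_left (max b 1))
    (continuous_frequencyPiece_of_mem hp hf) (integrable_of_mem_modulationSpace hf)
    (fun i x => (norm_frequencyPiece_le_of_mem hp hf i x).trans
      (mul_le_mul_of_nonneg_right (le_max_left _ _) (hA i)))
    (fun i => (one_mul _).ge.trans (mul_le_mul_of_nonneg_right (le_max_right _ _) (hA i)))
  have hF0 : ∀ s, F s = 0 := by
    intro s
    by_contra hne
    have hev : ∀ᶠ s' in nhds s, F s' ≠ 0 := hFc.continuousAt.eventually_ne hne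
    refine fourierInv_testFunction_line θ hθ hθ' x₀ s (hev.mono fun s' hs' => ?_)
    exact (mul_eq_zero.1 (hprod s')).resolve_left hs'
  refine reservoir_eq_zero_of_density hfh fun ξ => ?_
  -- The partition of unity identifies the density `h` with the Fourier transform of `∑ f_i`, which
  -- is zero.
  have h2 : HasSum (fun i => (φ i ξ : ℂ) * h ξ) (1 * h ξ) :=
    (hp.isBAPU.hasSum_one_complex ξ).mul_right _
  simp only [← hφh] at h2
  have h3 := h2.unique (hFF ξ)
  rw [one_mul] at h3
  have h4 : (fun x => ∑' i, frequencyPiece (φ i) f x) = 0 := funext hF0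
  rw [h3, h4, Real.fourier_eq]
  simp

theorem shearedSum_add {f f' : FourierReservoir ℝ} (hp : IsIntervalPartition P φ b t)
    (hf : f ∈ modulationSpace φ 1 1 le_rfl) (hf' : f' ∈ modulationSpace φ 1 1 le_rfl) :
    shearedSum G X θ φ t (f + f') = shearedSum G X θ φ t f + shearedSum G X θ φ t f' := by
  have hs : ∀ {f : FourierReservoir ℝ}, f ∈ modulationSpace φ 1 1 le_rfl → ∀ x,
      Summable fun i => shearedTerm G X θ φ t f i x := fun hf x =>
    Summable.of_norm_bounded (summable_shearBound θ hf) fun i =>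
      norm_shearedTerm_le G X θ hp hf i x
  ext x
  rw [Pi.add_apply, shearedSum, shearedSum, shearedSum, ← (hs hf x).tsum_add (hs hf' x)]
  congr 1 with i
  rw [shearedTerm, shearedTerm, shearedTerm, frequencyPiece_add, Pi.add_apply, add_mul]

theorem shearedSum_smul (c : ℂ) (f : FourierReservoir ℝ) :
    shearedSum G X θ φ t (c • f) = c • shearedSum G X θ φ t f := by
  ext x
  rw [Pi.smul_apply, shearedSum, shearedSum, smul_eq_mul, ← tsum_mul_left]
  congr 1 with i
  rw [shearedTerm, shearedTerm, frequencyPiece_smul, Pi.smul_apply, smul_eq_mul, mul_assoc]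

theorem reservoirOfIntegrable_add {u v : E → ℂ} (hu : Integrable u) (hv : Integrable v) :
    reservoirOfIntegrable (u + v) (hu.add hv) =
      reservoirOfIntegrable u hu + reservoirOfIntegrable v hv := by
  ext z
  change ∫ x, (u + v) x * FourierTestSpace.toSchwartz z x =
    (∫ x, u x * FourierTestSpace.toSchwartz z x) + ∫ x, v x * FourierTestSpace.toSchwartz z x
  rw [← integral_add (integrable_mul_schwartz hu _) (integrable_mul_schwartz hv _)]
  simp only [Pi.add_apply, add_mul]

theorem reservoirOfIntegrable_smul (c : ℂ) {u : E → ℂ} (hu : Integrable u) :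
    reservoirOfIntegrable (c • u) (hu.smul c) = c • reservoirOfIntegrable u hu := by
  ext z
  change ∫ x, (c • u) x * FourierTestSpace.toSchwartz z x =
    c * ∫ x, u x * FourierTestSpace.toSchwartz z x
  rw [← integral_const_mul]
  simp only [Pi.smul_apply, smul_eq_mul, mul_assoc]

/-- The transplanted element of `Z'(E)`. -/
def shearedReservoir (hp : IsIntervalPartition P φ b t)
    (hf : f ∈ modulationSpace φ 1 1 le_rfl) : FourierReservoir E :=
  reservoirOfIntegrable (shearedSum G X θ φ t f) (integrable_shearedSum G X θ hp hf)

theorem shearedReservoir_eq_zero (hp : IsIntervalPartition P φ b t)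
    (hf : f ∈ modulationSpace φ 1 1 le_rfl) (hX : X ∉ G.V₂) (hθ : ∀ ξ, 0 ≤ θ ξ)
    (hθ' : 0 < ∫ ξ, θ ξ) (h0 : shearedReservoir G X θ hp hf = 0) : f = 0 := by
  refine eq_zero_of_shearedSum_eq_zero G X θ hp hf hX hθ hθ' ?_
  have hi := integrable_shearedSum G X θ hp hf
  refine eq_zero_of_fourier_eq_zero hi (continuous_shearedSum G X θ hp hf) (congrFun ?_)
  refine eq_of_integral_testFunction_eq (fourier_continuous hi) continuous_zero fun χ => ?_
  have h1 := reservoirFourier_reservoirOfIntegrable hi χ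
  have h2 : reservoirFourier (reservoirOfIntegrable _ hi) χ = 0 := by
    change reservoirFourier (shearedReservoir G X θ hp hf) χ = 0
    rw [h0]
    rfl
  rw [← h1, h2]
  simp

/-- Boundedness of the transplantation. -/
theorem exists_bound_shearedReservoir (hp : IsIntervalPartition P φ b t) {ν : E → ℝ}
    (hν : G.IsQuasiNorm ν) {κ : Type*} {P' : κ → Set E}
    (hP' : StratifiedGroup.IsUniformCovering G ν P')
    {φ' : κ → 𝓓((⊤ : TopologicalSpace.Opens E), ℝ)} (hφ' : IsBAPU P' φ') {p : ℝ} (hp1 : 1 ≤ p) :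
    ∃ C : ℝ≥0, ∀ (f : FourierReservoir ℝ) (hf : f ∈ modulationSpace φ 1 1 le_rfl),
      ∑' j, eLpNorm (frequencyPiece (φ' j) (shearedReservoir G X θ hp hf))
        (ENNReal.ofReal p) volume ≤ C * modulationNorm φ 1 1 f := by
  have := hp.countable
  obtain ⟨C₀, hC₀⟩ := hφ'.bounded
  obtain ⟨R, hR0, hR⟩ := G.exists_radius_window X θ hν b
  -- `s • X` and `t i • X` are close
  obtain ⟨r, hr0, hr⟩ := hν.exists_bound
    ((isCompact_Icc (a := -b) (b := b)).image
      (continuous_id.smul continuous_const : Continuous fun τ : ℝ => τ • X)).isBounded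
  obtain ⟨R', hR'0, hR'⟩ := hν.exists_ball_trans (max R r)
  obtain ⟨K, hK⟩ := hP'.exists_encard_meeting_le hν R'
  -- The indices of the terms whose spectrum may meet `P' j`. Each `i` lies in at most `K` of these
  -- sets, whence the factor `K` below; `C₀` comes from the partition of unity on `G`.
  let I : κ → Set ι := fun j => {i | j ∈ meeting P' (G.ball ν (t i • X) R')}
  refine ⟨K * (shearConst θ b).toNNReal * C₀, fun f hf => ?_⟩
  obtain ⟨h, hh, hfh, -⟩ := hp.exists_density hf
  have hI : ∀ j, ∀ i ∉ I j, ∀ ξ, φ' j ξ ≠ 0 → 𝓕 (shearedTerm G X θ φ t f i) ξ = 0 := by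
    intro j i hi ξ hξ
    by_contra hne
    obtain ⟨s, -, -, hs, hball⟩ := exists_of_fourier_shearedTerm_ne_zero G X θ hp hh hfh hR hne
    refine hi ⟨ξ, hφ'.tsupport_subset j (subset_tsupport _ hξ), ?_⟩
    refine hR' _ (s • X) _ ?_ (StratifiedGroup.IsQuasiNorm.ball_mono (le_max_left _ _) hball)
    refine StratifiedGroup.IsQuasiNorm.ball_mono (le_max_right _ _) ?_
    rw [StratifiedGroup.mem_ball, StratifiedGroup.smul_mem_ball_smul]
    refine hr _ ⟨s - t i, ?_, rfl⟩
    rw [mem_Icc, ← abs_le, abs_sub_comm]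
    exact hs
  calc _ ≤ ∑' j, (∑' i, (I j).indicator
          (fun i => ENNReal.ofReal (shearBound θ φ b f i)) i) * C₀ :=
        ENNReal.tsum_le_tsum fun j => eLpNorm_frequencyPiece_tsum_le (summable_shearBound θ hf)
          (continuous_shearedTerm G X θ hp hf) (integrable_shearedTerm G X θ hp hf)
          (norm_shearedTerm_le G X θ hp hf) (integral_norm_shearedTerm_le G X θ hp hf)
          (integrable_shearedSum G X θ hp hf) (φ' j) (I j) (hI j) (hC₀ j) hp1
    _ ≤ (K * ∑' i, ENNReal.ofReal (shearBound θ φ b f i)) * C₀ := by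
        rw [ENNReal.tsum_mul_right]
        refine mul_le_mul_left (tsum_tsum_indicator_le I _ fun i => ?_) _
        exact hK (t i • X)
    _ = _ := by
        have h1 : ∀ i, ENNReal.ofReal (shearBound θ φ b f i) =
            ENNReal.ofReal (shearConst θ b) * ∫⁻ x, ‖frequencyPiece (φ i) f x‖ₑ := by
          intro i
          rw [shearBound, ENNReal.ofReal_mul (shearConst_nonneg θ hp.pos),
            ofReal_integral_norm_eq_lintegral_enorm (integrable_of_mem_modulationSpace hf i)]
        simp only [h1]
        rw [ENNReal.tsum_mul_left, modulationNorm_one_one]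
        push_cast
        rw [ENNReal.ofReal]
        ring

end Sheared

/-! ### Geometry of essential supports -/

section EssentialSupport

variable {E : Type*} [NormedAddCommGroup E] [InnerProductSpace ℝ E] [FiniteDimensional ℝ E]
  [MeasurableSpace E] [BorelSpace E] {ι : Type*} {Q : ι → Set E}
  {ψ : ι → 𝓓((⊤ : TopologicalSpace.Opens E), ℝ)}

/-- The essential support contains every point at which the Fourier transform does not vanish. -/
theorem mem_essentialSupport_of_density_ne_zero (hψ : IsBAPU Q ψ) {f : FourierReservoir E}
    {h : E → ℂ} (hh : Continuous h) (hf : ∀ χ, reservoirFourier f χ = ∫ ξ, h ξ * χ ξ) {p : ℝ}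
    (hp : 0 < p) {x : E} (hx : h x ≠ 0) : x ∈ essentialSupport Q ψ p f := by
  obtain ⟨i, hi⟩ : ∃ i, ψ i x ≠ 0 := by
    by_contra hcon
    push Not at hcon
    have h1 := hψ.hasSum_one x
    simp only [hcon] at h1
    exact one_ne_zero (h1.unique hasSum_zero)
  -- A continuous piece of zero norm vanishes identically, so by Fourier uniqueness `ψ i · h`
  -- vanishes, in particular at `x`.
  refine mem_iUnion₂.2 ⟨i, fun h0 => ?_, hψ.tsupport_subset i (subset_tsupport _ hi)⟩
  have hc := frequencyPiece_continuous hf hh (ψ i)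
  rw [eLpNorm_eq_zero_iff hc.aestronglyMeasurable (by simpa using hp)] at h0
  have h1 := (Continuous.ae_eq_iff_eq volume hc continuous_zero).1 h0
  rw [frequencyPiece_eq_fourierInv hf] at h1
  have h2 := eq_zero_of_fourierInv_eq_zero (integrable_testFunction_mul (ψ i) hh)
    ((Complex.continuous_ofReal.comp (ψ i).continuous).mul hh) (congrFun h1) x
  rcases mul_eq_zero.1 h2 with h3 | h3
  · exact hi (by exact_mod_cast h3)
  · exact hx h3

/-- The essential support is a union of whole members, so one of its points is located only up to a
member that also contains a point of nonvanishing density. -/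
theorem exists_density_ne_zero_of_mem_essentialSupport (hψ : IsBAPU Q ψ) {f : FourierReservoir E}
    {h : E → ℂ} (hf : ∀ χ, reservoirFourier f χ = ∫ ξ, h ξ * χ ξ) {p : ℝ} {z : E}
    (hz : z ∈ essentialSupport Q ψ p f) : ∃ i ξ, z ∈ Q i ∧ ξ ∈ Q i ∧ h ξ ≠ 0 := by
  obtain ⟨i, hi, hzi⟩ := mem_iUnion₂.1 hz
  by_contra hcon
  push Not at hcon
  refine hi ?_
  rw [frequencyPiece_eq_fourierInv hf]
  have h0 : (fun ξ => (ψ i ξ : ℂ) * h ξ) = 0 := by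
    ext ξ
    by_cases hξ : ψ i ξ = 0
    · simp [hξ]
    · simp [hcon i ξ hzi (hψ.tsupport_subset i (subset_tsupport _ hξ))]
  have h1 : 𝓕⁻ (fun ξ => (ψ i ξ : ℂ) * h ξ) = 0 := by
    rw [h0]
    ext x
    rw [Real.fourierInv_eq]
    simp
  rw [h1, eLpNorm_zero]

/-- Each step to a neighbour enlarges the radius by a bounded operation. The dependence of the
radius on `k` is the source of the constants `C_k`. -/
theorem exists_ball_of_mem_starSet {G : StratifiedGroup E} {ν : E → ℝ}
    (hν : G.IsQuasiNorm ν) (hQ : StratifiedGroup.IsUniformCovering G ν Q) (k : ℕ) :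
    ∃ R > 0, ∀ i, ∀ x ∈ starSet Q i k, ∀ y ∈ starSet Q i k, y ∈ G.ball ν x R := by
  obtain ⟨r, hr0, hr⟩ := hQ.exists_mem_ball hν
  have key : ∀ k : ℕ, ∃ R > 0, ∀ i, ∀ c ∈ Q i, ∀ x ∈ starSet Q i k, x ∈ G.ball ν c R := by
    intro k
    induction k with
    | zero =>
      refine ⟨r, hr0, fun i c hc x hx => ?_⟩
      obtain ⟨j, hj, hxj⟩ := mem_iUnion₂.1 hx
      obtain rfl : j = i := hj
      exact hr j c hc x hxj
    | succ k ih =>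
      obtain ⟨R, hR0, hR⟩ := ih
      obtain ⟨R', hR'0, hR'⟩ := hν.exists_ball_trans (max R r)
      refine ⟨R', hR'0, fun i c hc x hx => ?_⟩
      obtain ⟨j, ⟨l, hl, y, hyl, hyj⟩, hxj⟩ := mem_iUnion₂.1 hx
      exact hR' c y x
        (StratifiedGroup.IsQuasiNorm.ball_mono (le_max_left _ _)
          (hR i c hc y (mem_iUnion₂.2 ⟨l, hl, hyl⟩)))
        (StratifiedGroup.IsQuasiNorm.ball_mono (le_max_right _ _) (hr j y hyj x hxj))
  obtain ⟨R, hR0, hR⟩ := key k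
  obtain ⟨R', hR'0, hR'⟩ := hν.exists_ball_trans R
  refine ⟨R', hR'0, fun i x hx y hy => ?_⟩
  obtain ⟨c, hc⟩ := hQ.admissible.nonempty i
  exact hR' x c y (hν.mem_ball_comm.1 (hR i c hc x hx)) (hR i c hc y hy)

end EssentialSupport

/-! ### The coverings of the modulation data -/

namespace ModulationData

variable {E : Type*} [NormedAddCommGroup E] [InnerProductSpace ℝ E] [FiniteDimensional ℝ E]
  [MeasurableSpace E] [BorelSpace E] {G : StratifiedGroup E}

theorem isUniformCovering_covering (D : ModulationData G) :
    StratifiedGroup.IsUniformCovering G D.ν D.covering :=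
  StratifiedGroup.isUniformCovering_latticeCovering D.isQuasiNorm D.R_pos D.isAdmissible

theorem isUniformCovering_P [Nontrivial E] (D : ModulationData G) :
    StratifiedGroup.IsUniformCovering G D.ν D.P :=
  D.isAlphaCovering.isUniformCovering D.isQuasiNorm

theorem exists_isIntervalPartition (D : ModulationData (StratifiedGroup.abelian ℝ)) :
    ∃ b t, IsIntervalPartition D.P D.φ b t := by
  obtain ⟨a, b, -, hb, hab⟩ := D.isAlphaCovering.exists_volume_bounds
  choose t ht using D.isAlphaCovering.admissible.nonempty
  exact ⟨b, t, D.isAlphaCovering.admissible, D.isAlphaCovering.isOpen,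
    D.isAlphaCovering.isConnected, D.isBAPU_φ, hb, fun i => (hab i).2, ht⟩

/-- On the line, covering distance and distance are comparable. -/
theorem exists_coveringDist_real (D : ModulationData (StratifiedGroup.abelian ℝ)) :
    ∃ A > 0, ∃ C > 0, ∀ x y, |x - y| ≤ A * coveringDist D.covering x y ∧
      (coveringDist D.covering x y : ℝ) ≤ A * |x - y| + C := by
  -- In the abelian group `ℝ` the second layer is zero, so the identity is an admissible functional;
  -- the one-parameter subgroup of `1` is the whole line.
  obtain ⟨A₁, hA₁, h₁⟩ := D.isUniformCovering_covering.exists_le_coveringDist D.isQuasiNorm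
    LinearMap.id (fun z hz => (Submodule.mem_bot ℝ).1 hz)
  obtain ⟨A₂, hA₂, h₂⟩ := D.isUniformCovering_covering.exists_coveringDist_le D.isQuasiNorm (1 : ℝ)
  obtain ⟨C, hC, h₃⟩ := h₂ 1
  refine ⟨max A₁ A₂, lt_max_of_lt_left hA₁, C, hC, fun x y => ⟨?_, ?_⟩⟩
  · exact (h₁ x y).trans (mul_le_mul_of_nonneg_right (le_max_left _ _) (Nat.cast_nonneg _))
  · have hself : ∀ s : ℝ, s ∈ (StratifiedGroup.abelian ℝ).ball D.ν (s • (1 : ℝ)) 1 := fun s => by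
      rw [smul_eq_mul, mul_one]
      exact D.isQuasiNorm.mem_ball_self one_pos
    have := (h₃ x y x (hself x) y (hself y)).2
    linarith [mul_le_mul_of_nonneg_right (le_max_right A₁ A₂) (abs_nonneg (x - y))]

end ModulationData

/-! ### Assembling the embedding -/

theorem corollary6p6 (n : ℕ) (hn : 0 < n) (G : StratifiedGroup (EuclideanSpace ℝ (Fin n)))
    (hG : G.IsRational) (p q : ℝ) (hp : 1 ≤ p) (hq : 1 ≤ q)
    (D : ModulationData (StratifiedGroup.abelian ℝ)) (D' : ModulationData G) :
    ∃ F : D.space 1 1 le_rfl →ₗ[ℂ] D'.space p q hq,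
      IsGeometricEmbedding D D' 1 1 p q le_rfl hq F := by
  have : NeZero n := ⟨hn.ne'⟩
  have : Nontrivial (EuclideanSpace ℝ (Fin n)) := by
    rw [← Module.finrank_pos_iff (R := ℝ)]
    simpa using hn
  obtain ⟨X, hX1, hX0⟩ := Submodule.exists_mem_ne_zero_of_ne_bot G.V₁_ne_bot
  have hX2 : X ∉ G.V₂ := fun h => hX0 (Submodule.disjoint_def.1 G.isCompl.disjoint X hX1 h)
  obtain ⟨l, hl1, hl2⟩ : ∃ l : EuclideanSpace ℝ (Fin n) →ₗ[ℝ] ℝ, l X = 1 ∧ ∀ z ∈ G.V₂, l z = 0 := by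
    obtain ⟨l, hl, hl'⟩ := Submodule.exists_le_ker_of_notMem hX2
    refine ⟨(l X)⁻¹ • l, by simp [hl], fun z hz => ?_⟩
    have : l z = 0 := hl' hz
    simp [this]
  obtain ⟨θ, hθ, hθ'⟩ := exists_testFunction_pos (EuclideanSpace ℝ (Fin n))
  obtain ⟨b, t, hpart⟩ := D.exists_isIntervalPartition
  obtain ⟨C, hC⟩ := exists_bound_shearedReservoir G X θ hpart D'.isQuasiNorm D'.isUniformCovering_P
    D'.isBAPU_φ hp
  have hnorm : ∀ f (hf : f ∈ D.space 1 1 le_rfl),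
      D'.norm p q (shearedReservoir G X θ hpart hf) ≤ C * D.norm 1 1 f := fun f hf =>
    (tsum_rpow_le _ hq).trans (hC f hf)
  have hmem : ∀ f (hf : f ∈ D.space 1 1 le_rfl),
      shearedReservoir G X θ hpart hf ∈ D'.space p q hq := by
    intro f hf
    have hfin : (C : ℝ≥0∞) * modulationNorm D.φ 1 1 f < ⊤ :=
      ENNReal.mul_lt_top ENNReal.coe_lt_top hf.2
    have hi := integrable_shearedSum G X θ hpart hf
    refine ⟨fun j => ⟨?_, ?_⟩, (hnorm f hf).trans_lt hfin⟩
    · exact (frequencyPiece_continuous (reservoirFourier_reservoirOfIntegrable hi)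
        (fourier_continuous hi) _).aestronglyMeasurable
    · exact ((ENNReal.le_tsum j).trans (hC f hf)).trans_lt hfin
  let F : D.space 1 1 le_rfl →ₗ[ℂ] D'.space p q hq :=
    { toFun := fun f => ⟨shearedReservoir G X θ hpart f.2, hmem f.1 f.2⟩
      map_add' := fun f g => by
        refine Subtype.ext ?_
        change shearedReservoir G X θ hpart (f + g).2 =
          shearedReservoir G X θ hpart f.2 + shearedReservoir G X θ hpart g.2
        unfold shearedReservoir
        rw [← reservoirOfIntegrable_add]
        congr 1
        exact shearedSum_add G X θ hpart f.2 g.2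
      map_smul' := fun c f => by
        refine Subtype.ext ?_
        change shearedReservoir G X θ hpart (c • f).2 = c • shearedReservoir G X θ hpart f.2
        unfold shearedReservoir
        rw [← reservoirOfIntegrable_smul]
        congr 1
        exact shearedSum_smul G X θ c f.1 }
  refine ⟨F, ?_, ⟨C, fun f => hnorm f.1 f.2⟩, ?_⟩
  · rw [injective_iff_map_eq_zero]
    intro f hf
    refine Subtype.ext (shearedReservoir_eq_zero G X θ hpart f.2 hX2 hθ hθ' ?_)
    exact congrArg Subtype.val hf
  -- essential supports of images lie near the one-parameter subgroup of `X`
  obtain ⟨ρ, hρ0, hρ⟩ : ∃ ρ > 0, ∀ f : D.space 1 1 le_rfl, ∀ z ∈ D'.essSupp p (F f),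
      ∃ s ∈ D.essSupp 1 f, z ∈ G.ball D'.ν (s • X) ρ := by
    obtain ⟨R, hR0, hR⟩ := G.exists_radius_window X θ D'.isQuasiNorm b
    obtain ⟨r, hr0, hr⟩ := D'.isUniformCovering_covering.exists_mem_ball D'.isQuasiNorm
    obtain ⟨ρ, hρ0, hρ⟩ := D'.isQuasiNorm.exists_ball_trans (max R r)
    refine ⟨ρ, hρ0, fun f z hz => ?_⟩
    have hi := integrable_shearedSum G X θ hpart f.2
    obtain ⟨m, ξ, hzm, hξm, hne⟩ := exists_density_ne_zero_of_mem_essentialSupport D'.isBAPU_ψ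
      (reservoirFourier_reservoirOfIntegrable hi) hz
    obtain ⟨h, hh, hfh, -⟩ := hpart.exists_density f.2
    obtain ⟨i, hi'⟩ : ∃ i, 𝓕 (shearedTerm G X θ D.φ t f.1 i) ξ ≠ 0 := by
      by_contra hcon
      push Not at hcon
      have := hasSum_fourier_shearedTerm G X θ hpart f.2 ξ
      simp only [hcon] at this
      exact hne (this.unique hasSum_zero)
    obtain ⟨s, -, hs, -, hball⟩ :=
      exists_of_fourier_shearedTerm_ne_zero G X θ hpart hh hfh hR hi'
    refine ⟨s, mem_essentialSupport_of_density_ne_zero D.isBAPU_ψ hh hfh one_pos hs, ?_⟩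
    exact hρ _ ξ z (StratifiedGroup.IsQuasiNorm.ball_mono (le_max_left _ _) hball)
      (StratifiedGroup.IsQuasiNorm.ball_mono (le_max_right _ _) (hr m ξ hξm z hzm))
  obtain ⟨A, hA, C₁, hC₁, hline⟩ := D.exists_coveringDist_real
  obtain ⟨A', hA', hupper⟩ :=
    D'.isUniformCovering_covering.exists_coveringDist_le D'.isQuasiNorm X
  obtain ⟨C₂, hC₂, hupper⟩ := hupper ρ
  obtain ⟨A'', hA'', hlower⟩ :=
    D'.isUniformCovering_covering.exists_le_coveringDist D'.isQuasiNorm l hl2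
  -- As `l` is a homomorphism with `l X = 1`, it reads off the parameter `s` up to its oscillation
  -- on a ball of radius `ρ`.
  obtain ⟨Λ, hΛ0, hΛ⟩ : ∃ Λ > 0, ∀ s, ∀ z ∈ G.ball D'.ν (s • X) ρ, |l z - s| ≤ Λ := by
    have hc : Continuous l := LinearMap.continuous_of_finiteDimensional l
    obtain ⟨c, hc⟩ := ((D'.isQuasiNorm.isBounded_sublevel ρ).isCompact_closure.image
      hc.abs).isBounded.bddAbove
    refine ⟨max c 1, by positivity, fun s z hz => ?_⟩
    have h1 : l (G.mul (-(s • X)) z) = l z - s := by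
      rw [G.map_mul_of_vanish l hl2, map_neg, map_smul, hl1, smul_eq_mul, mul_one]
      ring
    rw [← h1]
    exact (hc ⟨_, subset_closure hz, rfl⟩).trans (le_max_left _ _)
  -- `A' * A` serves the upper bound and `A'' * A` the lower one. Neither depends on `k`, which
  -- enters only through the diameter bound `T` of the sets `Q_i^{k*}`.
  refine ⟨max (A' * A) (A'' * A), by positivity, fun k => ?_⟩
  obtain ⟨T, hT0, hT⟩ : ∃ T > 0, ∀ i, ∀ x ∈ starSet D.covering i k,
      ∀ y ∈ starSet D.covering i k, |x - y| ≤ T := by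
    obtain ⟨R, hR0, hR⟩ := exists_ball_of_mem_starSet D.isQuasiNorm
      D.isUniformCovering_covering k
    obtain ⟨c, hc⟩ := (D.isQuasiNorm.isBounded_sublevel R).exists_norm_le
    refine ⟨max c 1, by positivity, fun i x hx y hy => ?_⟩
    have h1 : (StratifiedGroup.abelian ℝ).mul (-x) y = y - x := by
      simp [StratifiedGroup.mul, StratifiedGroup.abelian]
      ring
    have h2 := hc _ (hR i x hx y hy)
    rw [h1, Real.norm_eq_abs, abs_sub_comm] at h2
    exact h2.trans (le_max_left _ _)
  -- The first two terms are the error of the upper estimate, the quotient that of the lower one; `2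
  -- * T` pays for replacing `x, y` by the parameters `s, s'`, and `2 * Λ` for replacing these by `l
  -- z, l w`.
  refine ⟨2 * A' * T + C₂ + (C₁ / A + 2 * T + 2 * Λ) / A'', by positivity,
    fun i j f g hf hg x hx y hy z hz w hw => ?_⟩
  obtain ⟨s, hs, hzs⟩ := hρ f z hz
  obtain ⟨s', hs', hws⟩ := hρ g w hw
  have hxs := abs_le.1 (hT i x hx s (hf hs))
  have hys := abs_le.1 (hT j y hy s' (hg hs'))
  have hzw := (hupper s s' z hzs w hws).2
  have hzw' := hlower z w
  obtain ⟨hxy, hxy'⟩ := hline x y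
  have hlz := abs_le.1 (hΛ s z hzs)
  have hlw := abs_le.1 (hΛ s' w hws)
  set d : ℝ := (coveringDist D.covering x y : ℝ)
  set d' : ℝ := (coveringDist D'.covering z w : ℝ)
  have hd0 : 0 ≤ d := Nat.cast_nonneg _
  have hss : |s - s'| ≤ |x - y| + 2 * T := by
    have := abs_le.1 (le_refl |x - y|)
    exact abs_le.2 ⟨by linarith, by linarith⟩
  have hxl : |x - y| ≤ |l z - l w| + 2 * T + 2 * Λ := by
    have := abs_le.1 (le_refl |l z - l w|)
    exact abs_le.2 ⟨by linarith, by linarith⟩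
  have hrest : 0 ≤ (C₁ / A + 2 * T + 2 * Λ) / A'' := by positivity
  constructor
  · have h1 : d ≤ A * (A'' * d' + 2 * T + 2 * Λ) + C₁ :=
      hxy'.trans (by gcongr; linarith)
    have h2 : 1 / max (A' * A) (A'' * A) * d ≤ 1 / (A'' * A) * d := by
      gcongr
      exact le_max_right _ _
    have h3 : 1 / (A'' * A) * d ≤ d' + (C₁ / A + 2 * T + 2 * Λ) / A'' := by
      calc 1 / (A'' * A) * d ≤ 1 / (A'' * A) * (A * (A'' * d' + 2 * T + 2 * Λ) + C₁) := by gcongr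
        _ = d' + (C₁ / A + 2 * T + 2 * Λ) / A'' := by
          field_simp
          ring
    have h4 : 0 ≤ 2 * A' * T + C₂ := by positivity
    linarith
  · have h1 : A' * |s - s'| ≤ A' * (A * d + 2 * T) := by
      gcongr
      linarith
    have h2 : A' * A * d ≤ max (A' * A) (A'' * A) * d := by
      gcongr
      exact le_max_left _ _
    linarith

end
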